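/- Let $X$ be a smooth $m$-manifold without boundary (Hausdorff, second countable, possibly noncompact), and let $\mu$ be a smooth measure on $X$, i.e. a Borel measure which in every chart has a smooth, strictly positive density with respect to Lebesgue measure. Let $p\in[1,\infty)$, $s\in\mathbb N$, $k_1,\dots,k_s\in\mathbb N_{\ge 0}$, let $E\to X$ and $F_i\to X$ ($i=1,\dots,s$) be smooth Hermitian (complex, finite rank) vector bundles, and let $\mathfrak P=\{P_1,\dots,P_s\}$, where $P_i$ is a smooth linear partial differential operator of order at most $k_i$ from $E$ to $F_i$. Put $k:=\max\{k_1,\dots,k_s\}$. Sections are Borel sections modulo equality $\mu$-almost everywhere. $\Gamma_{L^p_\mu}(X,E)$ denotes the space of sections $f$ of $E$ with $\|f\|_{p,\mu}:=(\int_X|f(x)|_x^p\,d\mu(x))^{1/p}<\infty$, and $$\Gamma_{W^{\mathfrak P,p}_\mu}(X,E):=\{f\in\Gamma_{L^p_\mu}(X,E) : P_if\in\Gamma_{L^p_\mu}(X,F_i)\text{ for all } i\},\qquad \|f\|_{\mathfrak P,p,\mu}:=\Big(\|f\|_{p,\mu}^p+\sum_{i=1}^s\|P_if\|_{p,\mu}^p\Big)^{1/p},$$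 where $P_if$ is understood in the sense of distributions: $P_if=g$ means $\int_X h_E(P_i^{\dagger}\psi,f)\,d\mu=\int_X h_{F_i}(\psi,g)\,d\mu$ for all smooth compactly supported sections $\psi$ of $F_i$, with $h_E,h_{F_i}$ the Hermitian structures and $P_i^{\dagger}$ the formal adjoint of $P_i$ with respect to $\mu,h_E,h_{F_i}$. $\Gamma_{W^{r,p}_{\mathrm{loc}}}(X,E)$ denotes the space of sections whose components, in every chart domain $U$ which admits a smooth frame of $E$ and with respect to every such frame, lie in $W^{r,p}_{\mathrm{loc}}(U)$. Assume that, in case $k\ge 2$, one has $\Gamma_{W^{\mathfrak P,p}_\mu}(X,E)\subset\Gamma_{W^{k-1,p}_{\mathrm{loc}}}(X,E)$. Then for every $f\in\Gamma_{W^{\mathfrak P,p}_\mu}(X,E)$ there is a sequence $(f_n)\subset\Gamma_{C^\infty}(X,E)\cap\Gamma_{W^{\mathfrak P,p}_\mu}(X,E)$ such that $\|f_n-f\|_{\mathfrak P,p,\mu}\to0$ as $n\to\infty$; if $f$ is compactly supported (i.e. has compact essential support), then $(f_n)$ can be chosen in $\Gamma_{C^\infty_c}(X,E)$. -/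

import Mathlib

open Bundle MeasureTheory Filter Topology TopologicalSpace
open scoped Manifold ContDiff ENNReal

noncomputable section

namespace MeyersSerrin

/-! ### Euclidean preliminaries: multi-indices, partial derivatives, local Sobolev spaces -/

/-- The `i`-th partial derivative of `u : ℝᵐ → ℂ`. -/
def partialD {m : ℕ} (i : Fin m) (u : EuclideanSpace ℝ (Fin m) → ℂ) :
    EuclideanSpace ℝ (Fin m) → ℂ :=
  fun y => fderiv ℝ u y (EuclideanSpace.single i 1)

/-- The iterated partial derivative `∂^α u = ∂₀^{α₀} ∂₁^{α₁} ⋯ u` for a multi-index `α`. -/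
def multiD {m : ℕ} (α : Fin m → ℕ) (u : EuclideanSpace ℝ (Fin m) → ℂ) :
    EuclideanSpace ℝ (Fin m) → ℂ :=
  (List.finRange m).foldr (fun i v => (partialD i)^[α i] v) u

/-- The finite set of multi-indices `α ∈ ℕᵐ` with `|α| ≤ k`. -/
def multiIndices (m k : ℕ) : Finset (Fin m → ℕ) :=
  (Fintype.piFinset fun _ => Finset.range (k + 1)).filter fun α => ∑ i, α i ≤ k

theorem mem_multiIndices {m k : ℕ} {α : Fin m → ℕ} :
    α ∈ multiIndices m k ↔ ∑ i, α i ≤ k := by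
  simp only [multiIndices, Finset.mem_filter, Fintype.mem_piFinset, Finset.mem_range,
    and_iff_right_iff_imp]
  intro h i
  exact Nat.lt_succ_of_le ((Finset.single_le_sum (fun _ _ => Nat.zero_le _)
    (Finset.mem_univ i)).trans h)

/-- `u ∈ L^p_loc(Ω)`. -/
def MemLpLoc {m : ℕ} (p : ℝ≥0∞) (Ω : Set (EuclideanSpace ℝ (Fin m)))
    (u : EuclideanSpace ℝ (Fin m) → ℂ) : Prop :=
  ∀ K, IsCompact K → K ⊆ Ω → MemLp u p (volume.restrict K)

/-- `v` is the weak derivative `∂^α u` on `Ω` (for locally integrable `u`, `v`). -/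
def IsWeakDeriv {m : ℕ} (Ω : Set (EuclideanSpace ℝ (Fin m))) (α : Fin m → ℕ)
    (u v : EuclideanSpace ℝ (Fin m) → ℂ) : Prop :=
  ∀ χ : EuclideanSpace ℝ (Fin m) → ℂ, ContDiff ℝ ∞ χ → HasCompactSupport χ → tsupport χ ⊆ Ω →
    ∫ y in Ω, u y * multiD α χ y = (-1 : ℂ) ^ (∑ i, α i) * ∫ y in Ω, v y * χ y

/-- `u ∈ W^{k,p}_loc(Ω)`. -/
def MemSobolevLoc {m : ℕ} (k : ℕ) (p : ℝ≥0∞) (Ω : Set (EuclideanSpace ℝ (Fin m)))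
    (u : EuclideanSpace ℝ (Fin m) → ℂ) : Prop :=
  MemLpLoc p Ω u ∧ ∀ α ∈ multiIndices m k, ∃ v, MemLpLoc p Ω v ∧ IsWeakDeriv Ω α u v

/-! ### Smooth measures -/

/-- A smooth measure on an `m`-manifold: in every chart of the smooth structure it has a smooth
strictly positive density with respect to Lebesgue measure. -/
def IsSmoothMeasure {m : ℕ} {X : Type*} [TopologicalSpace X]
    [ChartedSpace (EuclideanSpace ℝ (Fin m)) X] [MeasurableSpace X] (μ : Measure X) : Prop :=
  ∀ φ ∈ IsManifold.maximalAtlas (𝓡 m) ∞ X, ∃ ρ : EuclideanSpace ℝ (Fin m) → ℝ,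
    ContDiffOn ℝ ∞ ρ φ.target ∧ (∀ y ∈ φ.target, 0 < ρ y) ∧
      ∀ A : Set X, MeasurableSet A → A ⊆ φ.source →
        μ A = ∫⁻ y in φ '' A, ENNReal.ofReal (ρ y)

/-! ### Smooth complex vector bundles over a (real) manifold and their sections -/

section Bundles

variable {m : ℕ} {X : Type*} [TopologicalSpace X] [ChartedSpace (EuclideanSpace ℝ (Fin m)) X]
variable (F : Type*) [NormedAddCommGroup F] [NormedSpace ℂ F]
variable (E : X → Type*) [∀ x, AddCommGroup (E x)] [∀ x, Module ℂ (E x)]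
  [∀ x, TopologicalSpace (E x)] [TopologicalSpace (TotalSpace F E)]
  [FiberBundle F E] [VectorBundle ℂ F E]

variable (m) in
/-- A complex vector bundle over a real `m`-manifold is smooth if its transition functions are
smooth (in the real sense) as maps to the `ℂ`-linear endomorphisms of the model fibre. -/
class IsSmoothComplexBundle : Prop where
  contMDiffOn_coordChangeL :
    ∀ (e e' : Trivialization F (π F E)) [MemTrivializationAtlas e] [MemTrivializationAtlas e'],
      ContMDiffOn (𝓡 m) 𝓘(ℝ, F →L[ℂ] F) ∞ (fun b : X => (e.coordChangeL ℂ e' b : F →L[ℂ] F))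
        (e.baseSet ∩ e'.baseSet)

variable (m) in
/-- The complex vector space `Γ_{C^∞}(U, E)` of smooth sections over the open set `U`. -/
def SmoothSec (U : Opens X) : Submodule ℂ (∀ x : U, E x) where
  carrier := {s | ContMDiff (𝓡 m) ((𝓡 m).prod 𝓘(ℝ, F)) ∞
    fun x : U => TotalSpace.mk' F (x : X) (s x)}
  zero_mem' x₀ := by
    refine contMDiffAt_totalSpace.2 ⟨contMDiff_subtype_val x₀, ?_⟩
    have hx := mem_baseSet_trivializationAt F E (x₀ : X)
    refine (contMDiffAt_const (c := (0 : F))).congr_of_eventuallyEq ?_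
    filter_upwards [continuousAt_subtype_val.preimage_mem_nhds
      ((trivializationAt F E (x₀ : X)).open_baseSet.mem_nhds hx)] with x hx
    exact ((trivializationAt F E (x₀ : X)).linear ℂ hx).map_zero
  add_mem' {s t} hs ht x₀ := by
    have hs := (contMDiffAt_totalSpace.1 (hs x₀)).2
    have ht := (contMDiffAt_totalSpace.1 (ht x₀)).2
    refine contMDiffAt_totalSpace.2 ⟨contMDiff_subtype_val x₀, ?_⟩
    have hx := mem_baseSet_trivializationAt F E (x₀ : X)
    refine (hs.add ht).congr_of_eventuallyEq ?_
    filter_upwards [continuousAt_subtype_val.preimage_mem_nhds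
      ((trivializationAt F E (x₀ : X)).open_baseSet.mem_nhds hx)] with x hx
    exact ((trivializationAt F E (x₀ : X)).linear ℂ hx).map_add _ _
  smul_mem' c s hs x₀ := by
    have hs := (contMDiffAt_totalSpace.1 (hs x₀)).2
    refine contMDiffAt_totalSpace.2 ⟨contMDiff_subtype_val x₀, ?_⟩
    have hx := mem_baseSet_trivializationAt F E (x₀ : X)
    have hc : ContDiff ℝ ∞ fun v : F => c • v := contDiff_const_smul c
    refine (hc.contMDiff.contMDiffAt.comp x₀ hs).congr_of_eventuallyEq ?_
    filter_upwards [continuousAt_subtype_val.preimage_mem_nhds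
      ((trivializationAt F E (x₀ : X)).open_baseSet.mem_nhds hx)] with x hx
    exact ((trivializationAt F E (x₀ : X)).linear ℂ hx).map_smul _ _

variable {F E}

/-- Restriction of smooth sections. -/
def restrictSec {U W : Opens X} (h : W ≤ U) (s : SmoothSec m F E U) : SmoothSec m F E W :=
  ⟨fun x => s.1 ⟨x.1, h x.2⟩, ContMDiff.comp s.2 (contMDiff_inclusion h)⟩

/-- A smooth section over the open set `X`, as a section of `E → X`. -/
def globalSec (s : SmoothSec m F E ⊤) : ∀ x, E x := fun x => s.1 ⟨x, trivial⟩

/-- Compactly supported (not necessarily continuous) sections. -/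
def HasCompactSupp (f : ∀ x, E x) : Prop := ∃ K : Set X, IsCompact K ∧ ∀ x, x ∉ K → f x = 0

/-- Compact essential support with respect to `μ`. -/
def HasCompactEssSupp [MeasurableSpace X] (μ : Measure X) (f : ∀ x, E x) : Prop :=
  ∃ K : Set X, IsCompact K ∧ ∀ᵐ x ∂μ, x ∉ K → f x = 0

variable (F) in
/-- Borel sections of `E → X`. -/
def IsBorelSection [MeasurableSpace X] (f : ∀ x, E x) : Prop :=
  @Measurable X (TotalSpace F E) _ (borel _) fun x => TotalSpace.mk' F x (f x)

/-- A smooth local frame of `E` over `U`. -/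
def IsFrame {U : Opens X} (e : Fin (Module.finrank ℂ F) → SmoothSec m F E U) : Prop :=
  ∀ x : U, LinearIndependent ℂ (fun i => (e i).1 x) ∧
    ⊤ ≤ Submodule.span ℂ (Set.range fun i => (e i).1 x)

/-- The domain of a chart, as an open subset. -/
def chartDom (φ : OpenPartialHomeomorph X (EuclideanSpace ℝ (Fin m))) : Opens X :=
  ⟨φ.source, φ.open_source⟩

variable (m F) in
/-- `f ∈ Γ_{W^{k,p}_loc}(X, E)`: over every chart domain which admits a smooth frame of `E`, the
components of `f`, written in the chart, are in `W^{k,p}_loc`. -/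
def MemSobolevLocSection [MeasurableSpace X] (k : ℕ) (p : ℝ≥0∞) (f : ∀ x, E x) : Prop :=
  IsBorelSection F f ∧
  ∀ φ ∈ IsManifold.maximalAtlas (𝓡 m) ∞ X,
    ∀ e : Fin (Module.finrank ℂ F) → SmoothSec m F E (chartDom φ), IsFrame e →
      ∀ u : Fin (Module.finrank ℂ F) → EuclideanSpace ℝ (Fin m) → ℂ,
        (∀ x : chartDom φ, f x = ∑ i, u i (φ x) • (e i).1 x) →
          ∀ i, MemSobolevLoc k p φ.target (u i)

variable (m F E) in
/-- A smooth Hermitian structure on `E`: a family of inner products on the fibres (conjugate linear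
in the first variable) such that `x ↦ h_x(s(x), t(x))` is smooth for smooth local sections. -/
structure HermitianStructure where
  inner : ∀ x, E x →ₗ⋆[ℂ] E x →ₗ[ℂ] ℂ
  conj_symm : ∀ x v w, (starRingEnd ℂ) (inner x v w) = inner x w v
  pos : ∀ x v, v ≠ 0 → 0 < (inner x v v).re
  smooth : ∀ (U : Opens X) (s t : SmoothSec m F E U),
    ContMDiff (𝓡 m) 𝓘(ℝ, ℂ) ∞ fun x : U => inner x (s.1 x) (t.1 x)

/-- The norm on the fibre `E x`. -/
def HermitianStructure.norm (h : HermitianStructure m F E) (x : X) (v : E x) : ℝ :=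
  Real.sqrt (h.inner x v v).re

/-- The norm `‖f‖_{p,μ}` of a section. -/
def HermitianStructure.lpNorm [MeasurableSpace X] (h : HermitianStructure m F E) (p : ℝ≥0∞)
    (μ : Measure X) (f : ∀ x, E x) : ℝ≥0∞ :=
  eLpNorm (fun x => h.norm x (f x)) p μ

/-- `f ∈ Γ_{L^p_μ}(X, E)`. -/
def HermitianStructure.MemLpSection [MeasurableSpace X] (h : HermitianStructure m F E) (p : ℝ≥0∞)
    (μ : Measure X) (f : ∀ x, E x) : Prop :=
  IsBorelSection F f ∧ h.lpNorm p μ f < ⊤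

end Bundles

/-! ### Differential operators -/

section Operators

variable {m : ℕ} {X : Type*} [TopologicalSpace X] [ChartedSpace (EuclideanSpace ℝ (Fin m)) X]
variable {F : Type*} [NormedAddCommGroup F] [NormedSpace ℂ F]
variable {E : X → Type*} [∀ x, AddCommGroup (E x)] [∀ x, Module ℂ (E x)]
  [∀ x, TopologicalSpace (E x)] [TopologicalSpace (TotalSpace F E)]
  [FiberBundle F E] [VectorBundle ℂ F E]
variable {G : Type*} [NormedAddCommGroup G] [NormedSpace ℂ G]
variable {V : X → Type*} [∀ x, AddCommGroup (V x)] [∀ x, Module ℂ (V x)]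
  [∀ x, TopologicalSpace (V x)] [TopologicalSpace (TotalSpace G V)]
  [FiberBundle G V] [VectorBundle ℂ G V]

variable (m F E G V) in
/-- A morphism of linear sheaves from the smooth sections of `E` to the smooth sections of `V`. -/
structure SheafMorphism where
  app : ∀ U : Opens X, SmoothSec m F E U →ₗ[ℂ] SmoothSec m G V U
  app_restrict : ∀ {U W : Opens X} (h : W ≤ U) (s : SmoothSec m F E U),
    app W (restrictSec h s) = restrictSec h (app U s)

/-- `P` is a smooth linear partial differential operator of order at most `k`: over every chart
domain admitting smooth frames `e` of `E` and `f` of `V` one has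
`P (∑ᵢ uⁱ eᵢ) = ∑ⱼ ∑ᵢ ∑_{|α| ≤ k} a_{α i j} ∂^α uⁱ fⱼ` with smooth coefficients `a_{α i j}`
(all functions being written in the chart). -/
def SheafMorphism.IsDiffOp (P : SheafMorphism m F E G V) (k : ℕ) : Prop :=
  ∀ φ ∈ IsManifold.maximalAtlas (𝓡 m) ∞ X,
    ∀ e : Fin (Module.finrank ℂ F) → SmoothSec m F E (chartDom φ), IsFrame e →
    ∀ f : Fin (Module.finrank ℂ G) → SmoothSec m G V (chartDom φ), IsFrame f →
    ∃ a : (Fin m → ℕ) → Fin (Module.finrank ℂ F) → Fin (Module.finrank ℂ G) →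
        EuclideanSpace ℝ (Fin m) → ℂ,
      (∀ α i j, ContDiffOn ℝ ∞ (a α i j) φ.target) ∧
      ∀ u : Fin (Module.finrank ℂ F) → EuclideanSpace ℝ (Fin m) → ℂ,
        (∀ i, ContDiffOn ℝ ∞ (u i) φ.target) →
        ∀ s : SmoothSec m F E (chartDom φ),
          (∀ x : chartDom φ, s.1 x = ∑ i, u i (φ x) • (e i).1 x) →
          ∀ x : chartDom φ, (P.app _ s).1 x =
            ∑ j, ∑ i, ∑ α ∈ multiIndices m k,
              (a α i j (φ x) * multiD α (u i) (φ x)) • (f j).1 x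

variable [MeasurableSpace X]

/-- `η = P^{μ,h_E,h_V} ψ`, where `P^{μ,h_E,h_V}` is the formal adjoint of `P`: for smooth `ψ` with
compact support, `η` is the unique smooth section with compact support such that
`∫ h_E(η, φ) dμ = ∫ h_V(ψ, P φ) dμ` for all smooth sections `φ`. -/
def IsFormalAdjointOf (μ : Measure X) (hE : HermitianStructure m F E)
    (hV : HermitianStructure m G V) (P : SheafMorphism m F E G V)
    (ψ : SmoothSec m G V ⊤) (η : SmoothSec m F E ⊤) : Prop :=
  HasCompactSupp (globalSec η) ∧ ∀ φ : SmoothSec m F E ⊤,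
    ∫ x, hE.inner x (globalSec η x) (globalSec φ x) ∂μ =
      ∫ x, hV.inner x (globalSec ψ x) (globalSec (P.app ⊤ φ) x) ∂μ

/-- `P f = g` in the sense of distributions, for locally integrable sections `f`, `g`:
`∫ h_E(P^{μ,h_E,h_V} ψ, f) dμ = ∫ h_V(ψ, g) dμ` for all smooth `ψ` with compact support. -/
def IsDistribImage (μ : Measure X) (hE : HermitianStructure m F E)
    (hV : HermitianStructure m G V) (P : SheafMorphism m F E G V)
    (f : ∀ x, E x) (g : ∀ x, V x) : Prop :=
  ∀ ψ : SmoothSec m G V ⊤, HasCompactSupp (globalSec ψ) →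
    ∀ η : SmoothSec m F E ⊤, IsFormalAdjointOf μ hE hV P ψ η →
      ∫ x, hE.inner x (globalSec η x) (f x) ∂μ = ∫ x, hV.inner x (globalSec ψ x) (g x) ∂μ

/-- The distribution `P f` is an `L^p_μ`-section. -/
def DistribImageMemLp (μ : Measure X) (hE : HermitianStructure m F E)
    (hV : HermitianStructure m G V) (P : SheafMorphism m F E G V) (p : ℝ≥0∞)
    (f : ∀ x, E x) : Prop :=
  ∃ g : ∀ x, V x, hV.MemLpSection p μ g ∧ IsDistribImage μ hE hV P f g

open Classical in
/-- The distribution `P f` as an `L^p_μ`-section (unique up to `μ`-null sets) if it is one. -/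
def distribImage (μ : Measure X) (hE : HermitianStructure m F E)
    (hV : HermitianStructure m G V) (P : SheafMorphism m F E G V) (p : ℝ≥0∞)
    (f : ∀ x, E x) : ∀ x, V x :=
  if H : DistribImageMemLp μ hE hV P p f then H.choose else fun _ => 0

end Operators

/-! ### The Sobolev space of a family of operators -/

section Sobolev

variable {m : ℕ} {X : Type*} [TopologicalSpace X] [ChartedSpace (EuclideanSpace ℝ (Fin m)) X]
variable {F : Type*} [NormedAddCommGroup F] [NormedSpace ℂ F]
variable {E : X → Type*} [∀ x, AddCommGroup (E x)] [∀ x, Module ℂ (E x)]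
  [∀ x, TopologicalSpace (E x)] [TopologicalSpace (TotalSpace F E)]
  [FiberBundle F E] [VectorBundle ℂ F E]
variable {s : ℕ} {G : Fin s → Type*} [∀ i, NormedAddCommGroup (G i)] [∀ i, NormedSpace ℂ (G i)]
variable {V : Fin s → X → Type*} [∀ i x, AddCommGroup (V i x)] [∀ i x, Module ℂ (V i x)]
  [∀ i x, TopologicalSpace (V i x)] [∀ i, TopologicalSpace (TotalSpace (G i) (V i))]
  [∀ i, FiberBundle (G i) (V i)] [∀ i, VectorBundle ℂ (G i) (V i)]
variable [MeasurableSpace X]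

/-- `f ∈ Γ_{W^{𝔓,p}_μ}(X, E)` for `𝔓 = {P₁, …, P_s}`. -/
def MemSobolev (μ : Measure X) (hE : HermitianStructure m F E)
    (hV : ∀ i, HermitianStructure m (G i) (V i)) (P : ∀ i, SheafMorphism m F E (G i) (V i))
    (p : ℝ≥0∞) (f : ∀ x, E x) : Prop :=
  hE.MemLpSection p μ f ∧ ∀ i, DistribImageMemLp μ hE (hV i) (P i) p f

/-- The norm `‖f‖_{𝔓,p,μ} = (‖f‖_{p,μ}^p + ∑ᵢ ‖Pᵢ f‖_{p,μ}^p)^{1/p}` of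
`f ∈ Γ_{W^{𝔓,p}_μ}(X, E)`. -/
def sobolevNorm (μ : Measure X) (hE : HermitianStructure m F E)
    (hV : ∀ i, HermitianStructure m (G i) (V i)) (P : ∀ i, SheafMorphism m F E (G i) (V i))
    (p : ℝ≥0∞) (f : ∀ x, E x) : ℝ≥0∞ :=
  (hE.lpNorm p μ f ^ p.toReal +
    ∑ i, (hV i).lpNorm p μ (distribImage μ hE (hV i) (P i) p f) ^ p.toReal) ^ (1 / p.toReal)

end Sobolev

end MeyersSerrin

end

set_option linter.unusedSectionVars false

noncomputable section

namespace MeyersSerrin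

/-! ### Iterated partial derivatives and test functions -/

section Calculus

variable {m : ℕ}

local notation "𝔼" => EuclideanSpace ℝ (Fin m)

/-! The proof combines Friedrichs mollification in charts with the partition of unity argument of
Meyers and Serrin.

Local part. Put r = max(k - 1, 0). In a chart with frames, f becomes a vector u whose weak
derivatives of order at most r are L^p_loc functions: by the regularity hypothesis if k ≥ 2,
trivially otherwise. Each component of P_i f = g becomes a scalar linear equation of order at most r
+ 1 in the weak sense. Multiplying u by a cut-off function χ keeps the right-hand side in L^p_loc,
because the Leibniz terms in P(χu) - χPu differentiate u at most r times (`length_of_mem_leibRest`,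
`WeakEq.cut`). It remains to mollify V = χu. A term a ∂_i ∂^w V with |w| ≤ r need not be a function.
Still, the commutator of b∂_i with mollification, applied to the L^p function ∂^w V, tends to 0 in
L^p. It is an integral of V(x - t) - V(x), with ∂^w V in place of V, against a kernel whose integral
is 0 and whose L^1 norm is bounded uniformly in ε: the Lipschitz bound |b(x) - b(x - t)| ≤ C|t|
compensates the factor 1/ε in the gradient of the mollifier. Continuity of translations in L^p
finishes the estimate (`tendsto_eLpNorm_friedrichs`, `tendsto_eLpNorm_diffExpr_sub`). Hence
mollification converges in the graph norms of all the operators at once, although the top order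
derivatives of u need not exist as functions.

Passage to the manifold. On compact subsets of a chart the measure has density bounded above and
below, and fibre norms are comparable with component norms, so smallness transfers. The
distributional equation P f = g is tested by pairs of a section ψ and a formal adjoint section η.
For ψ supported in a chart, η is constructed explicitly from the transposed operator and the inverse
Gram matrix, which turns the global definition into the scalar equations (`IsDistribImage.weakEq`).
The way back, for sections supported in a chart, needs in addition that formal adjoints are local
(`isDistribImage_of_weakEq`).

Global part. A locally finite atlas of relatively compact charts and a subordinate partition of
unity (χ_c) split f. Each χ_c f is approximated by a smooth w_c supported in the chart, with error
δ_c in every seminorm and the δ_c summing to less than ε. For the smooth section W = ∑ w_c the error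
W - f is the locally finite sum of the w_c - χ_c f. Its norm and the norms of its images are
controlled by Fatou's lemma along a compact exhaustion (`HermitianStructure.lpNorm_finsum_le`).
Since w_c = 0 wherever f vanishes almost everywhere on the chart, compact essential support of f
leaves only finitely many nonzero w_c. -/

/-- `χ` is a smooth function with compact support in `Ω`. -/
structure IsTest (Ω : Set (EuclideanSpace ℝ (Fin m))) (χ : EuclideanSpace ℝ (Fin m) → ℂ) :
    Prop where
  smooth : ContDiff ℝ ∞ χ
  compact : HasCompactSupport χ
  subset : tsupport χ ⊆ Ω

/-- The iterated partial derivative along a word of directions. -/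
def wordD (w : List (Fin m)) (u : 𝔼 → ℂ) : 𝔼 → ℂ := w.foldr partialD u

/-- The nondecreasing word in which each letter `i` occurs `α i` times. -/
def word (α : Fin m → ℕ) : List (Fin m) := (List.finRange m).flatMap fun i => List.replicate (α i) i

@[simp] theorem wordD_nil (u : 𝔼 → ℂ) : wordD [] u = u := rfl

@[simp] theorem wordD_cons (i : Fin m) (w : List (Fin m)) (u : 𝔼 → ℂ) :
    wordD (i :: w) u = partialD i (wordD w u) := rfl

theorem wordD_append (w w' : List (Fin m)) (u : 𝔼 → ℂ) :
    wordD (w ++ w') u = wordD w (wordD w' u) := by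
  simp [wordD, List.foldr_append]

theorem wordD_replicate (n : ℕ) (i : Fin m) (u : 𝔼 → ℂ) :
    wordD (List.replicate n i) u = (partialD i)^[n] u := by
  induction n with
  | zero => rfl
  | succ n ih => rw [List.replicate_succ, wordD_cons, ih, Function.iterate_succ_apply']

theorem multiD_eq_wordD (α : Fin m → ℕ) (u : 𝔼 → ℂ) : multiD α u = wordD (word α) u := by
  unfold multiD word
  induction List.finRange m with
  | nil => rfl
  | cons i l ih => rw [List.foldr_cons, ih, List.flatMap_cons, wordD_append, wordD_replicate]

theorem count_word (α : Fin m → ℕ) (i : Fin m) : (word α).count i = α i := by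
  have h : ∀ l : List (Fin m), l.Nodup →
      (l.flatMap fun i => List.replicate (α i) i).count i = if i ∈ l then α i else 0 := by
    intro l
    induction l with
    | nil => simp
    | cons j l ih =>
      intro hl
      rw [List.nodup_cons] at hl
      rw [List.flatMap_cons, List.count_append, ih hl.2, List.count_replicate]
      by_cases hij : j = i
      · subst hij; simp [hl.1]
      · simp [hij, Ne.symm hij]
  rw [word, h _ (List.nodup_finRange m), if_pos (List.mem_finRange i)]

theorem length_word (α : Fin m → ℕ) : (word α).length = ∑ i, α i := by
  have : (word α).length = ∑ i, (word α).count i := by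
    rw [← Multiset.coe_card, ← Multiset.toFinset_sum_count_eq]
    simp only [Multiset.coe_count]
    refine Finset.sum_subset (Finset.subset_univ _) fun i _ hi => ?_
    simpa [List.count_eq_zero] using hi
  simp [this, count_word]

theorem contDiffOn_partialD {Ω : Set 𝔼} (hΩ : IsOpen Ω) {u : 𝔼 → ℂ} (hu : ContDiffOn ℝ ∞ u Ω)
    (i : Fin m) : ContDiffOn ℝ ∞ (partialD i u) Ω :=
  (hu.fderiv_of_isOpen hΩ (m := ∞) (by simp)).clm_apply contDiffOn_const

theorem contDiffOn_wordD {Ω : Set 𝔼} (hΩ : IsOpen Ω) {u : 𝔼 → ℂ} (hu : ContDiffOn ℝ ∞ u Ω)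
    (w : List (Fin m)) : ContDiffOn ℝ ∞ (wordD w u) Ω := by
  induction w with
  | nil => exact hu
  | cons i w ih => exact contDiffOn_partialD hΩ ih i

theorem contDiff_wordD {u : 𝔼 → ℂ} (hu : ContDiff ℝ ∞ u) (w : List (Fin m)) :
    ContDiff ℝ ∞ (wordD w u) :=
  contDiffOn_univ.1 (contDiffOn_wordD isOpen_univ hu.contDiffOn w)

theorem contDiff_partialD {u : 𝔼 → ℂ} (hu : ContDiff ℝ ∞ u) (i : Fin m) :
    ContDiff ℝ ∞ (partialD i u) := contDiff_wordD hu [i]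

theorem partialD_eqOn {Ω : Set 𝔼} (hΩ : IsOpen Ω) {u v : 𝔼 → ℂ} (h : Set.EqOn u v Ω) (i : Fin m) :
    Set.EqOn (partialD i u) (partialD i v) Ω := fun y hy => by
  have : u =ᶠ[𝓝 y] v := h.eventuallyEq_of_mem (hΩ.mem_nhds hy)
  simp only [partialD, this.fderiv_eq]

theorem wordD_eqOn {Ω : Set 𝔼} (hΩ : IsOpen Ω) {u v : 𝔼 → ℂ} (h : Set.EqOn u v Ω)
    (w : List (Fin m)) : Set.EqOn (wordD w u) (wordD w v) Ω := by
  induction w with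
  | nil => exact h
  | cons i w ih => exact partialD_eqOn hΩ ih i

theorem partialD_comm {Ω : Set 𝔼} (hΩ : IsOpen Ω) {u : 𝔼 → ℂ} (hu : ContDiffOn ℝ ∞ u Ω)
    (i j : Fin m) : Set.EqOn (partialD i (partialD j u)) (partialD j (partialD i u)) Ω := by
  intro y hy
  have hat : ContDiffAt ℝ ∞ u y := hu.contDiffAt (hΩ.mem_nhds hy)
  have hd : DifferentiableAt ℝ (fderiv ℝ u) y :=
    ((hat.fderiv_right (m := 1)
    (by rw [one_add_one_eq_two]; exact ENat.LEInfty.out)).differentiableAt (by simp))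
  have key : ∀ i j : Fin m, partialD i (partialD j u) y =
      fderiv ℝ (fderiv ℝ u) y (EuclideanSpace.single i 1) (EuclideanSpace.single j 1) := by
    intro i j
    change fderiv ℝ (fun y => fderiv ℝ u y (EuclideanSpace.single j 1)) y _ = _
    rw [fderiv_clm_apply hd (differentiableAt_const _)]
    simp
  rw [key, key]
  exact (hat.isSymmSndFDerivAt (by simpa using ENat.LEInfty.out)).eq _ _

/-- Schwarz's theorem. Derivatives are indexed by words, so that a derivative can be added in front
in an induction; this lemma makes the order of the letters irrelevant and gives the passage to
multi-indices. -/
theorem wordD_perm {Ω : Set 𝔼} (hΩ : IsOpen Ω) {u : 𝔼 → ℂ} (hu : ContDiffOn ℝ ∞ u Ω)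
    {w w' : List (Fin m)} (h : w.Perm w') : Set.EqOn (wordD w u) (wordD w' u) Ω := by
  induction h with
  | nil => exact fun _ _ => rfl
  | cons i _ ih => exact partialD_eqOn hΩ ih i
  | swap i j l => exact partialD_comm hΩ (contDiffOn_wordD hΩ hu l) j i
  | trans _ _ ih ih' => exact ih.trans ih'

theorem wordD_perm_univ {u : 𝔼 → ℂ} (hu : ContDiff ℝ ∞ u) {w w' : List (Fin m)} (h : w.Perm w') :
    wordD w u = wordD w' u :=
  funext fun _ => wordD_perm isOpen_univ hu.contDiffOn h (Set.mem_univ _)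

theorem partialD_mul {u v : 𝔼 → ℂ} {y : 𝔼} (hu : DifferentiableAt ℝ u y)
    (hv : DifferentiableAt ℝ v y) (i : Fin m) :
    partialD i (fun y => u y * v y) y = partialD i u y * v y + u y * partialD i v y := by
  simp only [partialD]
  rw [fderiv_fun_mul hu hv]
  simp [mul_comm, add_comm]

theorem tsupport_partialD_subset (u : 𝔼 → ℂ) (i : Fin m) :
    tsupport (partialD i u) ⊆ tsupport u := by
  refine (closure_mono fun y hy => ?_).trans (tsupport_fderiv_subset ℝ (f := u))
  simp only [Function.mem_support, partialD] at hy ⊢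
  exact fun h => hy (by rw [h]; rfl)

theorem tsupport_wordD_subset (u : 𝔼 → ℂ) (w : List (Fin m)) :
    tsupport (wordD w u) ⊆ tsupport u := by
  induction w with
  | nil => exact subset_rfl
  | cons i w ih => exact (tsupport_partialD_subset _ i).trans ih

variable {Ω : Set (EuclideanSpace ℝ (Fin m))} {θ χ : EuclideanSpace ℝ (Fin m) → ℂ}

theorem IsTest.wordD (hθ : IsTest Ω θ) (w : List (Fin m)) : IsTest Ω (wordD w θ) :=
  ⟨contDiff_wordD hθ.smooth w,
    hθ.compact.mono' ((subset_tsupport _).trans (tsupport_wordD_subset θ w)),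
    (tsupport_wordD_subset θ w).trans hθ.subset⟩

theorem IsTest.partialD (hθ : IsTest Ω θ) (i : Fin m) : IsTest Ω (partialD i θ) := hθ.wordD [i]

theorem IsTest.multiD (hθ : IsTest Ω θ) (α : Fin m → ℕ) : IsTest Ω (multiD α θ) := by
  rw [multiD_eq_wordD]; exact hθ.wordD _

theorem IsTest.eq_zero (hθ : IsTest Ω θ) {y : 𝔼} (hy : y ∉ Ω) : θ y = 0 :=
  image_eq_zero_of_notMem_tsupport fun h => hy (hθ.subset h)

theorem IsTest.mono (hθ : IsTest Ω θ) {Ω' : Set 𝔼} (h : Ω ⊆ Ω') : IsTest Ω' θ :=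
  ⟨hθ.smooth, hθ.compact, hθ.subset.trans h⟩

theorem isTest_zero : IsTest Ω (fun _ => 0) :=
  ⟨contDiff_const, HasCompactSupport.zero, by simp [tsupport]⟩

/-- Off Ω the product vanishes near every point, so the values of `a` there are irrelevant. This
allows coefficients that are smooth only on a chart target. -/
theorem contDiff_mul_of_tsupport_subset (hΩ : IsOpen Ω) {a : 𝔼 → ℂ} (ha : ContDiffOn ℝ ∞ a Ω)
    (hθ : ContDiff ℝ ∞ θ) (hs : tsupport θ ⊆ Ω) : ContDiff ℝ ∞ fun y => a y * θ y := by
  rw [contDiff_iff_contDiffAt]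
  intro y
  by_cases hy : y ∈ Ω
  · exact (ha.contDiffAt (hΩ.mem_nhds hy)).mul hθ.contDiffAt
  · have : (fun y => a y * θ y) =ᶠ[𝓝 y] fun _ => 0 := by
      filter_upwards [(isClosed_tsupport θ).isOpen_compl.mem_nhds fun h => hy (hs h)] with z hz
      rw [image_eq_zero_of_notMem_tsupport hz, mul_zero]
    exact contDiffAt_const.congr_of_eventuallyEq this

theorem IsTest.mul (hθ : IsTest Ω θ) (hΩ : IsOpen Ω) {a : 𝔼 → ℂ} (ha : ContDiffOn ℝ ∞ a Ω) :
    IsTest Ω fun y => a y * θ y :=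
  ⟨contDiff_mul_of_tsupport_subset hΩ ha hθ.smooth hθ.subset, hθ.compact.mul_left,
    (tsupport_mul_subset_right).trans hθ.subset⟩

theorem IsTest.mul_smooth (hθ : IsTest Ω θ) {a : 𝔼 → ℂ} (ha : ContDiff ℝ ∞ a) :
    IsTest Ω fun y => a y * θ y :=
  ⟨ha.mul hθ.smooth, hθ.compact.mul_left, (tsupport_mul_subset_right).trans hθ.subset⟩

theorem IsTest.add (hθ : IsTest Ω θ) (hχ : IsTest Ω χ) : IsTest Ω fun y => θ y + χ y :=
  ⟨hθ.smooth.add hχ.smooth, hθ.compact.add hχ.compact,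
    (tsupport_add θ χ).trans (Set.union_subset hθ.subset hχ.subset)⟩

theorem IsTest.sum {ι : Type*} (s : Finset ι) {θ : ι → 𝔼 → ℂ} (h : ∀ i ∈ s, IsTest Ω (θ i)) :
    IsTest Ω fun y => ∑ i ∈ s, θ i y := by
  classical
  induction s using Finset.induction_on with
  | empty => simpa using isTest_zero
  | insert i s hi ih =>
    simp only [Finset.sum_insert hi]
    exact (h i (by simp)).add (ih fun j hj => h j (by simp [hj]))

theorem IsTest.integrable (hθ : IsTest Ω θ) : Integrable θ :=
  hθ.smooth.continuous.integrable_of_hasCompactSupport hθ.compact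

/-- Integration by parts without boundary terms; differentiability of `v` is needed only on the
support of θ. -/
theorem integral_partialD_mul (hΩ : IsOpen Ω) (hθ : IsTest Ω θ) {v : 𝔼 → ℂ}
    (hv : ContDiffOn ℝ ∞ v Ω) (i : Fin m) :
    ∫ y, v y * partialD i θ y = -∫ y, partialD i v y * θ y := by
  refine integral_mul_fderiv_eq_neg_fderiv_mul_of_integrable
    ((hθ.mul hΩ (contDiffOn_partialD hΩ hv i)).integrable) ((hθ.partialD i).mul hΩ hv).integrable
    (hθ.mul hΩ hv).integrable (fun y hy => ?_) fun y _ => ?_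
  · exact (hv.contDiffAt (hΩ.mem_nhds (hθ.subset hy))).differentiableAt (by simp)
  · exact hθ.smooth.contDiffAt.differentiableAt (by simp)

theorem integral_mul_wordD (hΩ : IsOpen Ω) (hθ : IsTest Ω θ) {v : 𝔼 → ℂ}
    (hv : ContDiffOn ℝ ∞ v Ω) (w : List (Fin m)) :
    ∫ y, v y * wordD w θ y = (-1) ^ w.length * ∫ y, wordD w v y * θ y := by
  induction w generalizing v with
  | nil => simp
  | cons i w ih =>
    rw [wordD_cons, integral_partialD_mul hΩ (hθ.wordD w) hv, ih (contDiffOn_partialD hΩ hv i),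
      List.length_cons, pow_succ, show wordD w (MeyersSerrin.partialD i v) = wordD (w ++ [i]) v from
        (wordD_append w [i] v).symm]
    -- Peeling off the outermost derivative of θ puts it innermost on `v`; on Ω the two orders
    -- agree, and off Ω the test function vanishes.
    have : ∫ y, wordD (w ++ [i]) v y * θ y = ∫ y, wordD (i :: w) v y * θ y := by
      refine integral_congr_ae (Eventually.of_forall fun y => ?_)
      by_cases hy : y ∈ Ω
      · simp only [wordD_perm hΩ hv (List.perm_append_singleton i w) hy]
      · simp [hθ.eq_zero hy]
    rw [this, wordD_cons]; ring

theorem integral_mul_multiD (hΩ : IsOpen Ω) (hθ : IsTest Ω θ) {v : 𝔼 → ℂ}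
    (hv : ContDiffOn ℝ ∞ v Ω) (α : Fin m → ℕ) :
    ∫ y, v y * multiD α θ y = (-1) ^ (∑ i, α i) * ∫ y, multiD α v y * θ y := by
  rw [multiD_eq_wordD, multiD_eq_wordD, integral_mul_wordD hΩ hθ hv, length_word]

/-- A cut-off function: a test function which is `1` near a given compact set. -/
theorem exists_isTest_eq_one (hΩ : IsOpen Ω) {K : Set 𝔼} (hK : IsCompact K) (hKΩ : K ⊆ Ω) :
    ∃ κ : 𝔼 → ℂ, IsTest Ω κ ∧ ∃ W, IsOpen W ∧ K ⊆ W ∧ ∀ y ∈ W, κ y = 1 := by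
  obtain ⟨L, hL, hKL, hLΩ⟩ := exists_compact_between hK hΩ hKΩ
  obtain ⟨f, hf1, hf0, -⟩ := exists_contMDiffMap_one_nhds_of_subset_interior (n := ⊤)
    𝓘(ℝ, EuclideanSpace ℝ (Fin m)) hK.isClosed hKL
  have hts : tsupport (fun y => (f y : ℂ)) ⊆ L :=
    closure_minimal (fun y hy => by
      by_contra h
      exact hy (by simp [hf0 y h])) hL.isClosed
  obtain ⟨W, hW, hKW, hW1⟩ := mem_nhdsSet_iff_exists.1 hf1
  refine ⟨fun y => (f y : ℂ), ⟨?_, hL.of_isClosed_subset (isClosed_tsupport _) hts,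
    hts.trans hLΩ⟩, W, hW, hKW, fun y hy => ?_⟩
  · exact Complex.ofRealCLM.contDiff.comp (contMDiff_iff_contDiff.1 f.contMDiff)
  · have : f y = 1 := hW1 hy
    simp [this]

end Calculus

/-! ### Weak derivatives and jets of weak derivatives -/

section Weak

variable {m : ℕ} {p : ℝ≥0∞} {Ω : Set (EuclideanSpace ℝ (Fin m))}

local notation "𝔼" => EuclideanSpace ℝ (Fin m)

theorem MemLpLoc.mul {a u : 𝔼 → ℂ} (hu : MemLpLoc p Ω u) (ha : ContinuousOn a Ω) :
    MemLpLoc p Ω fun y => a y * u y := by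
  intro K hK hKΩ
  have haK := ha.mono hKΩ
  obtain ⟨C, hC⟩ := hK.exists_bound_of_continuousOn haK
  refine MemLp.of_le_mul (c := C) (hu K hK hKΩ)
    ((haK.aestronglyMeasurable hK.measurableSet).mul (hu K hK hKΩ).1) ?_
  filter_upwards [ae_restrict_mem hK.measurableSet] with y hy
  rw [norm_mul]
  exact mul_le_mul_of_nonneg_right (hC y hy) (norm_nonneg _)

theorem MemLpLoc.add {u v : 𝔼 → ℂ} (hu : MemLpLoc p Ω u) (hv : MemLpLoc p Ω v) :
    MemLpLoc p Ω fun y => u y + v y := fun K hK hKΩ => (hu K hK hKΩ).add (hv K hK hKΩ)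

theorem memLpLoc_zero : MemLpLoc p Ω fun _ => 0 := fun _ _ _ => MemLp.zero'

theorem MemLpLoc.sum {ι : Type*} (s : Finset ι) {u : ι → 𝔼 → ℂ}
    (h : ∀ i ∈ s, MemLpLoc p Ω (u i)) : MemLpLoc p Ω fun y => ∑ i ∈ s, u i y :=
  fun K hK hKΩ => memLp_finsetSum s fun i hi => h i hi K hK hKΩ

theorem MemLpLoc.integrable_mul (hp : 1 ≤ p) {u θ : 𝔼 → ℂ} (hu : MemLpLoc p Ω u)
    (hθ : Continuous θ) (hc : HasCompactSupport θ) (hs : tsupport θ ⊆ Ω) :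
    Integrable fun y => u y * θ y := by
  have hK : IsCompact (tsupport θ) := hc
  rw [← integrableOn_iff_integrable_of_support_subset (s := tsupport θ)]
  · have : IsFiniteMeasure (volume.restrict (tsupport θ)) := ⟨by
      rw [Measure.restrict_apply_univ]; exact hK.measure_lt_top⟩
    have hi : Integrable u (volume.restrict (tsupport θ)) := (hu _ hK hs).integrable hp
    obtain ⟨C, hC⟩ := hc.exists_bound_of_continuous hθ
    exact hi.mul_bdd (c := C) hθ.aestronglyMeasurable (Eventually.of_forall hC)
  · intro y hy
    exact subset_tsupport _ fun h => hy (by simp [h])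

theorem MemLpLoc.integrable_test (hp : 1 ≤ p) {u θ : 𝔼 → ℂ} (hu : MemLpLoc p Ω u)
    (hθ : IsTest Ω θ) : Integrable fun y => u y * θ y :=
  hu.integrable_mul hp hθ.smooth.continuous hθ.compact hθ.subset

/-- `v` is the weak `i`-th partial derivative of `u` on `Ω`. -/
def HasWeakD (Ω : Set (EuclideanSpace ℝ (Fin m))) (i : Fin m) (u v : 𝔼 → ℂ) : Prop :=
  ∀ θ, IsTest Ω θ → ∫ y, u y * partialD i θ y = -∫ y, v y * θ y

/-- Leibniz rule: test the weak derivative of `u` with χθ and expand ∂ᵢ(χθ). -/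
theorem HasWeakD.mul (hp : 1 ≤ p) {i : Fin m} {u v χ : 𝔼 → ℂ} (h : HasWeakD Ω i u v)
    (hu : MemLpLoc p Ω u) (hv : MemLpLoc p Ω v) (hχ : ContDiff ℝ ∞ χ) :
    HasWeakD Ω i (fun y => χ y * u y) fun y => partialD i χ y * u y + χ y * v y := by
  intro θ hθ
  have h1 := h _ (hθ.mul_smooth hχ)
  have e1 : ∀ y, u y * partialD i (fun y => χ y * θ y) y =
      u y * (partialD i χ y * θ y) + χ y * u y * partialD i θ y := fun y => by
    rw [partialD_mul (hχ.differentiable (by simp) y) (hθ.smooth.differentiable (by simp) y)]; ring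
  have i1 := hu.integrable_test hp (hθ.mul_smooth (contDiff_partialD hχ i))
  have i2 := hu.integrable_test hp ((hθ.partialD i).mul_smooth hχ)
  have i3 := hv.integrable_test hp (hθ.mul_smooth hχ)
  have i2' : Integrable fun y => χ y * u y * partialD i θ y := by
    convert i2 using 2; ring
  simp only [e1] at h1
  rw [integral_add i1 i2'] at h1
  have e2 : ∀ y, (partialD i χ y * u y + χ y * v y) * θ y =
      u y * (partialD i χ y * θ y) + v y * (χ y * θ y) := fun y => by ring
  simp only [e2]
  rw [integral_add i1 i3]
  linear_combination h1

theorem HasWeakD.add (hp : 1 ≤ p) {i : Fin m} {u v u' v' : 𝔼 → ℂ} (h : HasWeakD Ω i u v)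
    (h' : HasWeakD Ω i u' v') (hu : MemLpLoc p Ω u) (hv : MemLpLoc p Ω v) (hu' : MemLpLoc p Ω u')
    (hv' : MemLpLoc p Ω v') :
    HasWeakD Ω i (fun y => u y + u' y) fun y => v y + v' y := by
  intro θ hθ
  simp only [add_mul]
  rw [integral_add (hu.integrable_test hp (hθ.partialD i)) (hu'.integrable_test hp (hθ.partialD i)),
    integral_add (hv.integrable_test hp hθ) (hv'.integrable_test hp hθ), h θ hθ, h' θ hθ]
  ring

/-- A family `U w` of weak derivatives, along words `w` of length at most `r`, of `U []`. -/
structure IsJet (p : ℝ≥0∞) (Ω : Set (EuclideanSpace ℝ (Fin m))) (r : ℕ)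
    (U : List (Fin m) → EuclideanSpace ℝ (Fin m) → ℂ) : Prop where
  memLpLoc : ∀ w, w.length ≤ r → MemLpLoc p Ω (U w)
  weak : ∀ i w, w.length + 1 ≤ r → HasWeakD Ω i (U w) (U (i :: w))

theorem isWeakDeriv_iff {α : Fin m → ℕ} {u v : 𝔼 → ℂ} : IsWeakDeriv Ω α u v ↔
    ∀ θ, IsTest Ω θ → ∫ y, u y * multiD α θ y = (-1 : ℂ) ^ (∑ i, α i) * ∫ y, v y * θ y := by
  have key : ∀ (u : 𝔼 → ℂ) {θ}, IsTest Ω θ → ∫ y in Ω, u y * θ y = ∫ y, u y * θ y := fun u θ hθ =>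
    setIntegral_eq_integral_of_forall_compl_eq_zero fun y hy => by rw [hθ.eq_zero hy, mul_zero]
  constructor
  · intro h θ hθ
    rw [← key u (hθ.multiD α), ← key v hθ]
    exact h θ hθ.smooth hθ.compact hθ.subset
  · intro h θ h1 h2 h3
    have hθ : IsTest Ω θ := ⟨h1, h2, h3⟩
    rw [key u (hθ.multiD α), key v hθ]
    exact h θ hθ

/-- The weak derivative along a word is the one for the multi-index counting its letters.
Compatibility along single derivatives follows by testing with ∂ᵢθ. -/
theorem MemSobolevLoc.exists_isJet {r : ℕ} {u : 𝔼 → ℂ} (h : MemSobolevLoc r p Ω u) :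
    ∃ U, IsJet p Ω r U ∧ U [] = u := by
  classical
  have hlen : ∀ w : List (Fin m), ∑ i, w.count i = w.length := fun w => by
    rw [← Multiset.coe_card, ← Multiset.toFinset_sum_count_eq]
    simp only [Multiset.coe_count]
    refine (Finset.sum_subset (Finset.subset_univ _) fun i _ hi => ?_).symm
    simpa [List.count_eq_zero] using hi
  have hex : ∀ w : List (Fin m), ∃ v, w.length ≤ r → MemLpLoc p Ω v ∧ (w = [] → v = u) ∧
      ∀ θ, IsTest Ω θ → ∫ y, u y * wordD w θ y = (-1 : ℂ) ^ w.length * ∫ y, v y * θ y := by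
    intro w
    -- For the empty word `u` itself is taken, since the weak derivative of index 0 supplied by the
    -- hypothesis agrees with `u` only almost everywhere.
    by_cases hw : w = []
    · subst hw
      exact ⟨u, fun _ => ⟨h.1, fun _ => rfl, fun θ _ => by simp⟩⟩
    by_cases hr : w.length ≤ r
    · obtain ⟨v, hv, hv'⟩ := h.2 (fun i => w.count i) (mem_multiIndices.2 (by rwa [hlen]))
      refine ⟨v, fun _ => ⟨hv, fun h => absurd h hw, fun θ hθ => ?_⟩⟩
      have := isWeakDeriv_iff.1 hv' θ hθ
      rw [hlen, multiD_eq_wordD] at this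
      rw [← this, wordD_perm_univ hθ.smooth]
      rw [List.perm_iff_count]
      intro i; rw [count_word]
    · exact ⟨u, fun h => absurd h hr⟩
  choose U hU using hex
  refine ⟨U, ⟨fun w hw => (hU w hw).1, fun i w hw θ hθ => ?_⟩, (hU [] (by simp)).2.1 rfl⟩
  have h1 := (hU w (by omega)).2.2 _ (hθ.partialD i)
  have h2 := (hU (i :: w) (by simpa using hw)).2.2 θ hθ
  have h3 : wordD w (partialD i θ) = wordD (i :: w) θ :=
    (wordD_append w [i] θ).symm.trans
      (wordD_perm_univ hθ.smooth (List.perm_append_singleton i w))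
  rw [h3, h2, List.length_cons, pow_succ] at h1
  have h4 : ((-1 : ℂ) ^ w.length) ≠ 0 := by simp
  apply mul_left_cancel₀ h4
  linear_combination -h1

theorem IsJet.integral_wordD {r : ℕ} {U : List (Fin m) → 𝔼 → ℂ} (hU : IsJet p Ω r U)
    {w : List (Fin m)} (hw : w.length ≤ r) {θ : 𝔼 → ℂ} (hθ : IsTest Ω θ) :
    ∫ y, U [] y * wordD w θ y = (-1) ^ w.length * ∫ y, U w y * θ y := by
  induction w generalizing θ with
  | nil => simp
  | cons i w ih =>
    have h3 : wordD (i :: w) θ = wordD w (partialD i θ) :=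
      ((wordD_append w [i] θ).symm.trans
        (wordD_perm_univ hθ.smooth (List.perm_append_singleton i w))).symm
    rw [h3, ih (by simp at hw; omega) (hθ.partialD i), hU.weak i w (by simpa using hw) θ hθ,
      List.length_cons, pow_succ]
    ring

/-- The pairing of the weak derivative along `w` of `U []` with a test function, written with
derivatives of `U []` of order less than the length of `w` only. -/
def jetPair (U : List (Fin m) → 𝔼 → ℂ) : List (Fin m) → (𝔼 → ℂ) → ℂ
  | [], φ => ∫ y, U [] y * φ y
  | i :: w, φ => -∫ y, U w y * partialD i φ y

/-- One derivative stays on the test function, so words of length r + 1 are covered although the jet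
stops at r. This is where the single order missing from the regularity hypothesis is gained. -/
theorem IsJet.jetPair_eq {r : ℕ} {U : List (Fin m) → 𝔼 → ℂ} (hU : IsJet p Ω r U)
    {w : List (Fin m)} (hw : w.length ≤ r + 1) {φ : 𝔼 → ℂ} (hφ : IsTest Ω φ) :
    jetPair U w φ = (-1) ^ w.length * ∫ y, U [] y * wordD w φ y := by
  cases w with
  | nil => simp [jetPair]
  | cons i w =>
    have h3 : wordD (i :: w) φ = wordD w (partialD i φ) :=
      ((wordD_append w [i] φ).symm.trans
        (wordD_perm_univ hφ.smooth (List.perm_append_singleton i w))).symm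
    rw [h3, hU.integral_wordD (by simpa using hw) (hφ.partialD i), jetPair, ← mul_assoc, ← pow_add,
      List.length_cons]
    have : (-1 : ℂ) ^ (w.length + 1 + w.length) = -1 := by
      rw [show w.length + 1 + w.length = 2 * w.length + 1 by ring, pow_succ, pow_mul]; simp
    rw [this]; ring

/-- The effect of a further derivative on the terms `∂^a χ ∂^b u` of a Leibniz formula. -/
def leibExpand (i : Fin m) (L : List (List (Fin m) × List (Fin m))) :
    List (List (Fin m) × List (Fin m)) :=
  L.flatMap fun t => [(i :: t.1, t.2), (t.1, i :: t.2)]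

/-- The terms `∂^a χ ∂^b u` of `∂^w (χ u) - χ ∂^w u`. -/
def leibRest : List (Fin m) → List (List (Fin m) × List (Fin m))
  | [] => []
  | i :: w => ([i], w) :: leibExpand i (leibRest w)

/-- The sum of the terms `∂^a χ ∂^b u` over a list of pairs `(a, b)`. -/
def leibSum (χ : 𝔼 → ℂ) (U : List (Fin m) → 𝔼 → ℂ) (L : List (List (Fin m) × List (Fin m))) :
    𝔼 → ℂ :=
  fun y => (L.map fun t => wordD t.1 χ y * U t.2 y).sum

/-- The jet of `χ u` in terms of the jet of `u`. -/
def cutJet (χ : 𝔼 → ℂ) (U : List (Fin m) → 𝔼 → ℂ) (w : List (Fin m)) : 𝔼 → ℂ :=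
  fun y => χ y * U w y + leibSum χ U (leibRest w) y

/-- Each remaining Leibniz term spends at least one derivative on χ. Hence the commutator of an
operator of order at most r + 1 with χ involves only the jet of `u` up to order r. -/
theorem length_of_mem_leibRest {w : List (Fin m)} {t : List (Fin m) × List (Fin m)}
    (ht : t ∈ leibRest w) : t.2.length + 1 ≤ w.length := by
  induction w generalizing t with
  | nil => simp [leibRest] at ht
  | cons i w ih =>
    simp only [leibRest, leibExpand, List.mem_cons, List.mem_flatMap, List.not_mem_nil,
      or_false] at ht
    rcases ht with rfl | ⟨t', ht', rfl | rfl⟩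
    · simp
    · have := ih ht'; simp at this ⊢; omega
    · have := ih ht'; simp at this ⊢; omega

theorem leibSum_cons (χ : 𝔼 → ℂ) (U : List (Fin m) → 𝔼 → ℂ) (t : List (Fin m) × List (Fin m))
    (L : List (List (Fin m) × List (Fin m))) (y : 𝔼) :
    leibSum χ U (t :: L) y = wordD t.1 χ y * U t.2 y + leibSum χ U L y := by
  simp [leibSum]

theorem leibExpand_cons (i : Fin m) (t : List (Fin m) × List (Fin m))
    (L : List (List (Fin m) × List (Fin m))) :
    leibExpand i (t :: L) = (i :: t.1, t.2) :: (t.1, i :: t.2) :: leibExpand i L := by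
  simp [leibExpand]

/-! ### The Leibniz rule for jets -/

variable {r : ℕ} {U : List (Fin m) → EuclideanSpace ℝ (Fin m) → ℂ}
  {χ : EuclideanSpace ℝ (Fin m) → ℂ}

theorem IsJet.memLpLoc_leibSum (hU : IsJet p Ω r U) (hχ : ContDiff ℝ ∞ χ)
    {L : List (List (Fin m) × List (Fin m))} (hL : ∀ t ∈ L, t.2.length ≤ r) :
    MemLpLoc p Ω (leibSum χ U L) := by
  induction L with
  | nil => exact memLpLoc_zero
  | cons t L ih =>
    have := ((hU.memLpLoc t.2 (hL t (by simp))).mul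
      (contDiff_wordD hχ t.1).continuous.continuousOn).add (ih fun t ht => hL t (by simp [ht]))
    simpa only [← leibSum_cons] using this

theorem length_of_mem_leibExpand {i : Fin m} {L : List (List (Fin m) × List (Fin m))}
    (hL : ∀ t ∈ L, t.2.length + 1 ≤ r) : ∀ t ∈ leibExpand i L, t.2.length ≤ r := by
  intro t ht
  simp only [leibExpand, List.mem_flatMap, List.mem_cons, List.not_mem_nil, or_false] at ht
  obtain ⟨t', ht', rfl | rfl⟩ := ht
  · exact (Nat.le_succ _).trans (hL t' ht')
  · simpa using hL t' ht'

theorem IsJet.hasWeakD_leibSum (hp : 1 ≤ p) (hU : IsJet p Ω r U) (hχ : ContDiff ℝ ∞ χ) (i : Fin m)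
    {L : List (List (Fin m) × List (Fin m))} (hL : ∀ t ∈ L, t.2.length + 1 ≤ r) :
    HasWeakD Ω i (leibSum χ U L) (leibSum χ U (leibExpand i L)) := by
  induction L with
  | nil => intro θ _; simp [leibSum, leibExpand]
  | cons t L ih =>
    have ht := hL t (by simp)
    have hL' : ∀ t ∈ L, t.2.length + 1 ≤ r := fun t ht => hL t (by simp [ht])
    have m1 := hU.memLpLoc t.2 (by omega)
    have m2 := hU.memLpLoc (i :: t.2) (by simpa using ht)
    have c1 := contDiff_wordD hχ t.1
    have c2 := contDiff_wordD hχ (i :: t.1)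
    have := ((hU.weak i t.2 ht).mul hp m1 m2 c1).add hp (ih hL') (m1.mul c1.continuous.continuousOn)
      ((m1.mul c2.continuous.continuousOn).add (m2.mul c1.continuous.continuousOn))
      (hU.memLpLoc_leibSum hχ fun t ht => (Nat.le_succ _).trans (hL' t ht))
      (hU.memLpLoc_leibSum hχ (length_of_mem_leibExpand hL'))
    intro θ hθ
    have h := this θ hθ
    simp only [leibExpand_cons, leibSum_cons, wordD_cons] at h ⊢
    simpa only [add_assoc] using h

/-- The recursion of `leibRest` reproduces ∂ᵢ(χ ∂^w u + rest): the new term ∂ᵢχ ∂^w u comes from the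
principal part, all others from differentiating the rest. -/
theorem IsJet.cut (hp : 1 ≤ p) (hU : IsJet p Ω r U) (hχ : ContDiff ℝ ∞ χ) :
    IsJet p Ω r (cutJet χ U) := by
  refine ⟨fun w hw => ((hU.memLpLoc w hw).mul hχ.continuous.continuousOn).add
    (hU.memLpLoc_leibSum hχ fun t ht => by have := length_of_mem_leibRest ht; omega),
    fun i w hw => ?_⟩
  have m1 := hU.memLpLoc w (by omega)
  have m2 := hU.memLpLoc (i :: w) (by simpa using hw)
  have hL : ∀ t ∈ leibRest w, t.2.length + 1 ≤ r := fun t ht => by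
    have := length_of_mem_leibRest ht; omega
  have := ((hU.weak i w hw).mul hp m1 m2 hχ).add hp (hU.hasWeakD_leibSum hp hχ i hL)
      (m1.mul hχ.continuous.continuousOn)
      ((m1.mul (contDiff_partialD hχ i).continuous.continuousOn).add
        (m2.mul hχ.continuous.continuousOn))
      (hU.memLpLoc_leibSum hχ fun t ht => (Nat.le_succ _).trans (hL t ht))
      (hU.memLpLoc_leibSum hχ (length_of_mem_leibExpand hL))
  intro θ hθ
  have h := this θ hθ
  simp only [cutJet, leibRest, leibSum_cons, wordD_cons, wordD_nil] at h ⊢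
  rw [h]
  congr 2 with y
  ring

/-- The Leibniz formula one order beyond the jet. The top derivative of `u` appears only as a
functional, moved onto χφ by χ ∂ᵢφ = ∂ᵢ(χφ) - ∂ᵢχ φ, while all lower terms are honest functions. -/
theorem IsJet.jetPair_cut (hp : 1 ≤ p) (hU : IsJet p Ω r U) (hχ : ContDiff ℝ ∞ χ)
    {w : List (Fin m)} (hw : w.length ≤ r + 1) {φ : 𝔼 → ℂ} (hφ : IsTest Ω φ) :
    jetPair (cutJet χ U) w φ =
      jetPair U w (fun y => χ y * φ y) + ∫ y, leibSum χ U (leibRest w) y * φ y := by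
  cases w with
  | nil =>
    simp only [jetPair, cutJet, leibRest, leibSum, List.map_nil, List.sum_nil, add_zero, zero_mul,
      integral_zero]
    congr 1 with y; ring
  | cons i w =>
    have hw' : w.length ≤ r := by simpa using hw
    have hL : ∀ t ∈ leibRest w, t.2.length + 1 ≤ r := fun t ht => by
      have := length_of_mem_leibRest ht; omega
    have m1 := hU.memLpLoc w hw'
    have m3 := hU.memLpLoc_leibSum hχ (fun t ht => (Nat.le_succ _).trans (hL t ht))
    have m4 := hU.memLpLoc_leibSum hχ (length_of_mem_leibExpand (i := i) hL)
    have i1 := m1.integrable_test hp ((hφ.partialD i).mul_smooth hχ)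
    have i2 := m1.integrable_test hp (hφ.mul_smooth (contDiff_partialD hχ i))
    have i3 := m3.integrable_test hp (hφ.partialD i)
    have i4 := m4.integrable_test hp hφ
    have hR := hU.hasWeakD_leibSum hp hχ i hL φ hφ
    have e1 : ∀ y, cutJet χ U w y * partialD i φ y =
        U w y * (χ y * partialD i φ y) + leibSum χ U (leibRest w) y * partialD i φ y := fun y => by
      simp only [cutJet]; ring
    have e2 : ∀ y, U w y * partialD i (fun y => χ y * φ y) y =
        U w y * (partialD i χ y * φ y) + U w y * (χ y * partialD i φ y) := fun y => by
      rw [partialD_mul (hχ.differentiable (by simp) y) (hφ.smooth.differentiable (by simp) y)]; ring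
    have e3 : ∀ y, leibSum χ U (leibRest (i :: w)) y * φ y =
        U w y * (partialD i χ y * φ y) + leibSum χ U (leibExpand i (leibRest w)) y * φ y :=
      fun y => by simp only [leibRest, leibSum_cons, wordD_cons, wordD_nil]; ring
    simp only [jetPair, e1, e2, e3]
    rw [integral_add i1 i3, integral_add i2 i1, integral_add i2 i4, hR]
    ring

/-- The components `u` satisfy the scalar linear equation `∑ᵢ ∑_{|α| ≤ k} a_{α i} ∂^α uᵢ = g` on `Ω`
in the sense of distributions. -/
def WeakEq {d : ℕ} (Ω : Set (EuclideanSpace ℝ (Fin m))) (k : ℕ)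
    (a : (Fin m → ℕ) → Fin d → EuclideanSpace ℝ (Fin m) → ℂ)
    (u : Fin d → EuclideanSpace ℝ (Fin m) → ℂ) (g : EuclideanSpace ℝ (Fin m) → ℂ) : Prop :=
  ∀ θ, IsTest Ω θ → ∑ i, ∑ α ∈ multiIndices m k,
    (-1 : ℂ) ^ (∑ l, α l) * ∫ y, u i y * multiD α (fun y => a α i y * θ y) y = ∫ y, g y * θ y

/-! ### Weak linear equations and cut-off functions -/

variable {d k : ℕ} {a : (Fin m → ℕ) → Fin d → EuclideanSpace ℝ (Fin m) → ℂ}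

theorem weakEq_iff_jetPair (hΩ : IsOpen Ω) (hk : k ≤ r + 1) (ha : ∀ α i, ContDiffOn ℝ ∞ (a α i) Ω)
    {U : Fin d → List (Fin m) → 𝔼 → ℂ} (hU : ∀ i, IsJet p Ω r (U i)) {g : 𝔼 → ℂ} :
    WeakEq Ω k a (fun i => U i []) g ↔ ∀ θ, IsTest Ω θ → ∑ i, ∑ α ∈ multiIndices m k,
      jetPair (U i) (word α) (fun y => a α i y * θ y) = ∫ y, g y * θ y := by
  refine forall₂_congr fun θ hθ => ?_
  have : ∀ i, ∀ α ∈ multiIndices m k, jetPair (U i) (word α) (fun y => a α i y * θ y) =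
      (-1 : ℂ) ^ (∑ l, α l) * ∫ y, U i [] y * multiD α (fun y => a α i y * θ y) y := by
    intro i α hα
    rw [mem_multiIndices] at hα
    rw [(hU i).jetPair_eq (by rw [length_word]; omega) (hθ.mul hΩ (ha α i)), length_word,
      multiD_eq_wordD]
  rw [Finset.sum_congr rfl fun i _ => Finset.sum_congr rfl (this i)]

/-- The right-hand side of the equation satisfied by `χ u`. -/
def cutRhs (k : ℕ) (a : (Fin m → ℕ) → Fin d → 𝔼 → ℂ) (χ : 𝔼 → ℂ)
    (U : Fin d → List (Fin m) → 𝔼 → ℂ) (g : 𝔼 → ℂ) : 𝔼 → ℂ := fun y =>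
  χ y * g y + ∑ i, ∑ α ∈ multiIndices m k, a α i y * leibSum χ (U i) (leibRest (word α)) y

theorem memLpLoc_cutRhs (hk : k ≤ r + 1) (ha : ∀ α i, ContDiffOn ℝ ∞ (a α i) Ω)
    {U : Fin d → List (Fin m) → 𝔼 → ℂ} (hU : ∀ i, IsJet p Ω r (U i)) (hχ : ContDiff ℝ ∞ χ)
    {g : 𝔼 → ℂ} (hg : MemLpLoc p Ω g) : MemLpLoc p Ω (cutRhs k a χ U g) := by
  refine (hg.mul hχ.continuous.continuousOn).add (MemLpLoc.sum _ fun i _ => MemLpLoc.sum _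
    fun α hα => MemLpLoc.mul ?_ (ha α i).continuousOn)
  refine (hU i).memLpLoc_leibSum hχ fun t ht => ?_
  have := length_of_mem_leibRest ht
  rw [length_word] at this
  have := mem_multiIndices.1 hα
  omega

/-- Testing the equation for `u` with χθ gives the term χg; the difference is the sum of the
commutators from `IsJet.jetPair_cut`, which only need order r. -/
theorem WeakEq.cut (hp : 1 ≤ p) (hΩ : IsOpen Ω) (hk : k ≤ r + 1)
    (ha : ∀ α i, ContDiffOn ℝ ∞ (a α i) Ω) {U : Fin d → List (Fin m) → 𝔼 → ℂ}
    (hU : ∀ i, IsJet p Ω r (U i)) {g : 𝔼 → ℂ} (hg : MemLpLoc p Ω g)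
    (h : WeakEq Ω k a (fun i => U i []) g) (hχ : ContDiff ℝ ∞ χ) :
    WeakEq Ω k a (fun i => cutJet χ (U i) []) (cutRhs k a χ U g) := by
  rw [weakEq_iff_jetPair hΩ hk ha hU] at h
  rw [weakEq_iff_jetPair hΩ hk ha fun i => (hU i).cut hp hχ]
  intro θ hθ
  have h1 := h _ (hθ.mul_smooth hχ)
  have hm : ∀ i, ∀ α ∈ multiIndices m k,
      MemLpLoc p Ω (leibSum χ (U i) (leibRest (word α))) := fun i α hα => by
    refine (hU i).memLpLoc_leibSum hχ fun t ht => ?_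
    have := length_of_mem_leibRest ht
    rw [length_word] at this
    have := mem_multiIndices.1 hα
    omega
  have h2 : ∀ i, ∀ α ∈ multiIndices m k,
      jetPair (cutJet χ (U i)) (word α) (fun y => a α i y * θ y) =
      jetPair (U i) (word α) (fun y => a α i y * (χ y * θ y)) +
        ∫ y, leibSum χ (U i) (leibRest (word α)) y * (a α i y * θ y) := fun i α hα => by
    rw [(hU i).jetPair_cut hp hχ (by rw [length_word]; have := mem_multiIndices.1 hα; omega)
      (hθ.mul hΩ (ha α i))]
    congr 3 with y; ring
  rw [Finset.sum_congr rfl fun i _ => Finset.sum_congr rfl (h2 i)]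
  simp only [Finset.sum_add_distrib]
  rw [h1]
  have hi : ∀ i, ∀ α ∈ multiIndices m k, Integrable fun y =>
      leibSum χ (U i) (leibRest (word α)) y * (a α i y * θ y) := fun i α hα =>
    (hm i α hα).integrable_test hp (hθ.mul hΩ (ha α i))
  have e : ∀ y, cutRhs k a χ U g y * θ y = g y * (χ y * θ y) + ∑ i, ∑ α ∈ multiIndices m k,
      leibSum χ (U i) (leibRest (word α)) y * (a α i y * θ y) := fun y => by
    simp only [cutRhs, add_mul, Finset.sum_mul]
    congr 1
    · ring
    · exact Finset.sum_congr rfl fun i _ => Finset.sum_congr rfl fun α _ => by ring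
  simp only [e]
  rw [integral_add (hg.integrable_test hp (hθ.mul_smooth hχ))
      (integrable_finsetSum _ fun i _ => integrable_finsetSum _ (hi i)),
    integral_finsetSum _ fun i _ => integrable_finsetSum _ (hi i)]
  congr 1
  exact Finset.sum_congr rfl fun i _ => (integral_finsetSum _ (hi i)).symm

end Weak

/-! ### Mollifiers and the Friedrichs commutator lemma -/

section Friedrichs

variable {m : ℕ} {p : ℝ≥0∞}

local notation "𝔼" => EuclideanSpace ℝ (Fin m)

/-- Continuity of translations in `L^p`. -/
theorem exists_eLpNorm_translate_sub_le (hp1 : 1 ≤ p) (hp : p ≠ ⊤) {V : 𝔼 → ℂ}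
    (hV : MemLp V p volume) {ε : ℝ≥0∞} (hε : 0 < ε) :
    ∃ δ > (0 : ℝ), ∀ t : 𝔼, ‖t‖ < δ → eLpNorm (fun x => V (x - t) - V x) p volume ≤ ε := by
  have : Fact (1 ≤ p) := ⟨hp1⟩
  have : Fact (p ≠ ⊤) := ⟨hp⟩
  -- Translations act continuously on L^p for finite p; acting by -t yields x ↦ V(x - t).
  have hc : Continuous fun t : 𝔼 => DomAddAct.mk (-t) +ᵥ hV.toLp V :=
    (DomAddAct.continuous_mk.comp continuous_neg).vadd continuous_const
  have h0 : DomAddAct.mk (-(0 : 𝔼)) +ᵥ hV.toLp V = hV.toLp V := by simp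
  have := EMetric.tendsto_nhds.1 (hc.tendsto 0) ε hε
  obtain ⟨δ, hδ, h⟩ := Metric.eventually_nhds_iff.1 this
  refine ⟨δ, hδ, fun t ht => ?_⟩
  have h1 := (h (y := t) (by simpa using ht)).le
  rw [h0, DomAddAct.mk_vadd_toLp, Lp.edist_toLp_toLp] at h1
  have h2 : (fun x => V (x - t) - V x) = (fun x => V (-t +ᵥ x)) - V := by
    funext x
    simp [sub_eq_neg_add]
  rwa [h2]

/-- Hölder's inequality for the splitting f k = (f k^{1/q}) k^{1/q'}, where q' is the conjugate
exponent; for q = 1 there is nothing to prove. It is the pointwise half of Young's inequality. -/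
theorem lintegral_mul_rpow_le {α : Type*} [MeasurableSpace α] {μ : Measure α} {q : ℝ} (hq : 1 ≤ q)
    {f k : α → ℝ≥0∞} (hf : AEMeasurable f μ) (hk : Measurable k) :
    (∫⁻ t, f t * k t ∂μ) ^ q ≤ (∫⁻ t, k t ∂μ) ^ (q - 1) * ∫⁻ t, f t ^ q * k t ∂μ := by
  have hq0 : 0 < q := by linarith
  rcases hq.eq_or_lt with rfl | hq1
  · simp
  have hconj : q.HolderConjugate (Real.conjExponent q) := Real.HolderConjugate.conjExponent hq1
  set r := Real.conjExponent q
  have h := ENNReal.lintegral_mul_le_Lp_mul_Lq μ hconj (f := fun t => f t * k t ^ (1 / q))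
    (g := fun t => k t ^ (1 / r)) (hf.mul (hk.pow_const _).aemeasurable)
    (hk.pow_const _).aemeasurable
  have hr0 := hconj.symm.pos
  have e0 : ∀ t, ((fun t => f t * k t ^ (1 / q)) * fun t => k t ^ (1 / r)) t = f t * k t := by
    intro t
    simp only [Pi.mul_apply]
    rw [mul_assoc, ← ENNReal.rpow_add_of_nonneg _ _ (by positivity) (by positivity)]
    have : 1 / q + 1 / r = 1 := by simpa using hconj.inv_add_inv_eq_one
    rw [this, ENNReal.rpow_one]
  have e1 : ∀ t, (f t * k t ^ (1 / q)) ^ q = f t ^ q * k t := fun t => by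
    rw [ENNReal.mul_rpow_of_nonneg _ _ hq0.le, ← ENNReal.rpow_mul, one_div,
      inv_mul_cancel₀ hq0.ne', ENNReal.rpow_one]
  have e2 : ∀ t, (k t ^ (1 / r)) ^ r = k t := fun t => by
    rw [← ENNReal.rpow_mul, one_div, inv_mul_cancel₀ hr0.ne', ENNReal.rpow_one]
  simp only [e0, e1, e2] at h
  calc (∫⁻ t, f t * k t ∂μ) ^ q
      ≤ ((∫⁻ t, f t ^ q * k t ∂μ) ^ (1 / q) * (∫⁻ t, k t ∂μ) ^ (1 / r)) ^ q :=
        ENNReal.rpow_le_rpow h hq0.le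
    _ = _ := by
        rw [ENNReal.mul_rpow_of_nonneg _ _ hq0.le, ← ENNReal.rpow_mul, ← ENNReal.rpow_mul, one_div,
          inv_mul_cancel₀ hq0.ne', ENNReal.rpow_one, mul_comm]
        congr 2
        have h3 : q⁻¹ + r⁻¹ = 1 := hconj.inv_add_inv_eq_one
        have : r⁻¹ = 1 - q⁻¹ := by linarith
        rw [one_div, this]; field_simp

/-- A form of Young's inequality for functions dominated by averages of differences. -/
theorem eLpNorm_le_of_le_lintegral_translate (hp1 : 1 ≤ p) (hp : p ≠ ⊤) {V F : 𝔼 → ℂ}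
    (hV : AEStronglyMeasurable V volume) {k : 𝔼 → ℝ≥0∞} (hk : Measurable k) {δ : ℝ}
    (hkδ : ∀ t, δ ≤ ‖t‖ → k t = 0) {M η : ℝ≥0∞} (hkM : ∫⁻ t, k t ≤ M)
    (hη : ∀ t : 𝔼, ‖t‖ < δ → eLpNorm (fun x => V (x - t) - V x) p volume ≤ η)
    (hF : ∀ x, ‖F x‖ₑ ≤ ∫⁻ t, ‖V (x - t) - V x‖ₑ * k t) : eLpNorm F p volume ≤ M * η := by
  have hp0 : p ≠ 0 := (zero_lt_one.trans_le hp1).ne'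
  have hq : 1 ≤ p.toReal := by
    rw [← ENNReal.toReal_one]; exact ENNReal.toReal_mono hp hp1
  set q := p.toReal
  have hq0 : 0 < q := by linarith
  have hprod : AEStronglyMeasurable (fun z : 𝔼 × 𝔼 => V (z.1 - z.2) - V z.1)
      (volume.prod volume) :=
    (hV.comp_quasiMeasurePreserving (quasiMeasurePreserving_sub_of_right_invariant volume volume)).sub
      hV.comp_fst
  have hx : ∀ x : 𝔼, AEMeasurable (fun t => ‖V (x - t) - V x‖ₑ) volume := fun x =>
    ((hV.comp_quasiMeasurePreserving (quasiMeasurePreserving_sub_left_of_right_invariant volume x)).sub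
      aestronglyMeasurable_const).enorm
  have ht : ∀ t, (∫⁻ x, ‖V (x - t) - V x‖ₑ ^ q) * k t ≤ η ^ q * k t := by
    intro t
    rcases lt_or_ge ‖t‖ δ with h | h
    · gcongr
      have := hη t h
      rw [eLpNorm_eq_lintegral_rpow_enorm_toReal hp0 hp, one_div,
        ENNReal.rpow_inv_le_iff hq0] at this
      exact this
    · simp [hkδ t h]
  rw [eLpNorm_eq_lintegral_rpow_enorm_toReal hp0 hp, one_div, ENNReal.rpow_inv_le_iff hq0]
  calc ∫⁻ x, ‖F x‖ₑ ^ q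
      ≤ ∫⁻ x, (∫⁻ t, ‖V (x - t) - V x‖ₑ * k t) ^ q :=
        lintegral_mono fun x => ENNReal.rpow_le_rpow (hF x) hq0.le
    -- Hölder in t with weight k; Tonelli then exchanges the integrals, so that only translates by
    -- |t| < δ contribute.
    _ ≤ ∫⁻ x, M ^ (q - 1) * ∫⁻ t, ‖V (x - t) - V x‖ₑ ^ q * k t :=
        lintegral_mono fun x => (lintegral_mul_rpow_le hq (hx x) hk).trans
          (mul_le_mul_left (ENNReal.rpow_le_rpow hkM (by linarith)) _)
    _ = M ^ (q - 1) * ∫⁻ t, ∫⁻ x, ‖V (x - t) - V x‖ₑ ^ q * k t := by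
        have hm : AEMeasurable (Function.uncurry fun x t : 𝔼 => ‖V (x - t) - V x‖ₑ ^ q * k t)
            (volume.prod volume) :=
          (hprod.enorm.pow_const q).mul (hk.comp measurable_snd).aemeasurable
        rw [← lintegral_lintegral_swap hm]
        exact lintegral_const_mul'' _ hm.lintegral_prod_right'
    _ ≤ M ^ (q - 1) * ∫⁻ t, η ^ q * k t := by
        gcongr with t
        rcases eq_or_ne (k t) ⊤ with h | h
        · rw [lintegral_mul_const'']
          · exact ht t
          · have h1 : AEStronglyMeasurable (fun x => V (x - t)) volume :=
              hV.comp_measurePreserving (measurePreserving_sub_right volume t)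
            exact (h1.sub hV).enorm.pow_const q
        · rw [lintegral_mul_const' _ _ h]
          exact ht t
    _ ≤ M ^ (q - 1) * (η ^ q * M) := by
        rw [lintegral_const_mul _ hk]
        gcongr
    _ = (M * η) ^ q := by
        rw [ENNReal.mul_rpow_of_nonneg _ _ hq0.le, mul_comm (η ^ q), ← mul_assoc]
        congr 1
        conv_lhs => rw [← ENNReal.rpow_one M]
        rw [← ENNReal.rpow_mul, one_mul, ← ENNReal.rpow_add_of_nonneg _ _ (by linarith) zero_le_one]
        congr 1; ring

/-- Kernels shrinking to the origin with uniformly bounded mass average V(x - t) - V(x) to 0 in L^p.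
It serves both for mollification and for the Friedrichs commutator. -/
theorem tendsto_eLpNorm_of_le_lintegral_translate (hp1 : 1 ≤ p) (hp : p ≠ ⊤) {V : 𝔼 → ℂ}
    (hV : MemLp V p volume) {F : ℝ → 𝔼 → ℂ} {k : ℝ → 𝔼 → ℝ≥0∞} {M : ℝ≥0∞} (hM : M ≠ ⊤)
    (hk : ∀ ε > 0, Measurable (k ε)) (hkε : ∀ ε > 0, ∀ t, ε < ‖t‖ → k ε t = 0)
    (hkM : ∀ ε > 0, ∫⁻ t, k ε t ≤ M)
    (hF : ∀ ε > 0, ∀ x, ‖F ε x‖ₑ ≤ ∫⁻ t, ‖V (x - t) - V x‖ₑ * k ε t) :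
    Tendsto (fun ε => eLpNorm (F ε) p volume) (𝓝[>] 0) (𝓝 0) := by
  rw [ENNReal.tendsto_nhds_zero]
  intro c hc
  obtain ⟨η, hη, hηc⟩ : ∃ η : ℝ≥0∞, 0 < η ∧ M * η ≤ c := by
    refine ⟨c / (M + 1), ENNReal.div_pos hc.ne' (by simp [hM]), ?_⟩
    calc M * (c / (M + 1)) ≤ (M + 1) * (c / (M + 1)) := by gcongr; exact le_self_add
      _ ≤ c := ENNReal.mul_div_le
  obtain ⟨δ, hδ, h⟩ := exists_eLpNorm_translate_sub_le hp1 hp hV hη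
  filter_upwards [Ioo_mem_nhdsGT hδ] with ε hε
  exact (eLpNorm_le_of_le_lintegral_translate hp1 hp hV.1 (hk ε hε.1)
    (fun t ht => hkε ε hε.1 t (hε.2.trans_le ht)) (hkM ε hε.1) h (hF ε hε.1)).trans hηc

/-- The convolution of two complex functions. -/
def conv (k V : 𝔼 → ℂ) (x : 𝔼) : ℂ := ∫ t, k t * V (x - t)

theorem conv_eq_convolution (k V : 𝔼 → ℂ) :
    conv k V = convolution k V (ContinuousLinearMap.mul ℝ ℂ) volume := rfl

theorem conv_eq_integral (k V : 𝔼 → ℂ) (x : 𝔼) : conv k V x = ∫ y, V y * k (x - y) := by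
  rw [conv, ← integral_sub_left_eq_self _ volume x]
  simp [mul_comm]

/-! ### Convolution with test functions -/

theorem integrable_conv {k V : 𝔼 → ℂ} (hk : IsTest Set.univ k) (hV : LocallyIntegrable V volume)
    (x : 𝔼) : Integrable fun t => k t * V (x - t) :=
  hk.compact.convolutionExists_left (ContinuousLinearMap.mul ℝ ℂ) hk.smooth.continuous hV x

theorem contDiff_conv {k V : 𝔼 → ℂ} (hk : IsTest Set.univ k) (hV : LocallyIntegrable V volume) :
    ContDiff ℝ ∞ (conv k V) :=
  hk.compact.contDiff_convolution_left (n := ⊤) (ContinuousLinearMap.mul ℝ ℂ) hk.smooth hV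

theorem partialD_conv {k V : 𝔼 → ℂ} (hk : IsTest Set.univ k) (hV : LocallyIntegrable V volume)
    (i : Fin m) : partialD i (conv k V) = conv (partialD i k) V := by
  funext x
  have h := hk.compact.hasFDerivAt_convolution_left (ContinuousLinearMap.mul ℝ ℂ)
    (hk.smooth.of_le (by exact_mod_cast le_top)) hV x
  rw [← conv_eq_convolution] at h
  have hi : Integrable fun t => (ContinuousLinearMap.mul ℝ ℂ).precompL 𝔼 (fderiv ℝ k t) (V (x - t)) :=
    (hk.compact.fderiv ℝ).convolutionExists_left _
      (hk.smooth.continuous_fderiv (by simp)) hV x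
  simp only [partialD, h.fderiv, conv]
  exact ContinuousLinearMap.integral_apply hi _

/-- Convolution does not see null sets. This makes approximants vanish identically, and not just
almost everywhere, on charts where the section is null, as compact support of the approximants
requires. -/
theorem conv_eq_zero_of_ae {k V : 𝔼 → ℂ} (hV : V =ᵐ[volume] 0) : conv k V = 0 := by
  funext x
  rw [conv_eq_integral]
  refine integral_eq_zero_of_ae ?_
  filter_upwards [hV] with y hy
  simp [hy]

/-- A fixed smooth bump function with integral one. -/
def bumpKernel (m : ℕ) : EuclideanSpace ℝ (Fin m) → ℂ := fun z =>
  ((⟨1 / 2, 1, by norm_num, by norm_num⟩ : ContDiffBump (0 : EuclideanSpace ℝ (Fin m))).normed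
    volume z : ℝ)

/-- The standard family of mollifiers. -/
def mollifier (ε : ℝ) : 𝔼 → ℂ := fun z => ((ε ^ m)⁻¹ : ℝ) * bumpKernel m (ε⁻¹ • z)

/-! ### Supports and scaling of the mollifiers -/

theorem contDiff_bumpKernel : ContDiff ℝ ∞ (bumpKernel m) :=
  Complex.ofRealCLM.contDiff.comp (ContDiffBump.contDiff_normed _ (n := ⊤))

theorem tsupport_bumpKernel : tsupport (bumpKernel m) ⊆ Metric.closedBall 0 1 := by
  refine (closure_mono fun z hz => ?_).trans (ContDiffBump.tsupport_normed_eq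
    (⟨1 / 2, 1, by norm_num, by norm_num⟩ : ContDiffBump (0 : 𝔼)) (μ := volume)).subset
  intro h
  exact hz (by simp only [bumpKernel, h, Complex.ofReal_zero])

theorem integral_bumpKernel : ∫ z, bumpKernel m z = 1 := by
  simp only [bumpKernel]
  rw [integral_complex_ofReal, ContDiffBump.integral_normed, Complex.ofReal_one]

theorem integral_norm_bumpKernel : ∫ z, ‖bumpKernel m z‖ = 1 := by
  simp only [bumpKernel, Complex.norm_real, Real.norm_eq_abs,
    abs_of_nonneg (ContDiffBump.nonneg_normed _ _)]
  exact ContDiffBump.integral_normed _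

theorem partialD_mollifier (ε : ℝ) (i : Fin m) (z : 𝔼) : partialD i (mollifier ε) z =
    ((ε ^ m)⁻¹ * ε⁻¹ : ℝ) * partialD i (bumpKernel m) (ε⁻¹ • z) := by
  have h1 : HasFDerivAt (bumpKernel m) (fderiv ℝ (bumpKernel m) (ε⁻¹ • z)) (ε⁻¹ • z) :=
    (contDiff_bumpKernel.differentiable (by simp) _).hasFDerivAt
  have h2 : HasFDerivAt (fun z : 𝔼 => ε⁻¹ • z) (ε⁻¹ • ContinuousLinearMap.id ℝ 𝔼) z :=
    (hasFDerivAt_id (𝕜 := ℝ) z).const_smul ε⁻¹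
  have h3 := (h1.comp z h2).const_mul (((ε ^ m)⁻¹ : ℝ) : ℂ)
  simp only [partialD]
  rw [show mollifier ε = fun y : 𝔼 => (((ε ^ m)⁻¹ : ℝ) : ℂ) *
    (bumpKernel m ∘ fun z : 𝔼 => ε⁻¹ • z) y from rfl, h3.fderiv]
  simp
  ring

theorem tsupport_mollifier {ε : ℝ} (hε : 0 < ε) :
    tsupport (mollifier ε : 𝔼 → ℂ) ⊆ Metric.closedBall 0 ε := by
  refine closure_minimal (fun z hz => ?_) Metric.isClosed_closedBall
  have h1 : bumpKernel m (ε⁻¹ • z) ≠ 0 := fun h => hz (by simp [mollifier, h])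
  have := tsupport_bumpKernel (subset_tsupport _ h1)
  rw [mem_closedBall_zero_iff, norm_smul, norm_inv, Real.norm_eq_abs, abs_of_pos hε,
    inv_mul_le_iff₀ hε, mul_one] at this
  rwa [mem_closedBall_zero_iff]

theorem isTest_mollifier {ε : ℝ} (hε : 0 < ε) : IsTest Set.univ (mollifier ε : 𝔼 → ℂ) :=
  ⟨contDiff_const.mul (contDiff_bumpKernel.comp (contDiff_const_smul _)),
    (isCompact_closedBall 0 ε).of_isClosed_subset (isClosed_tsupport _) (tsupport_mollifier hε),
    Set.subset_univ _⟩

theorem integral_scale {H : Type*} [NormedAddCommGroup H] [NormedSpace ℝ H] (g : 𝔼 → H) {ε : ℝ}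
    (hε : 0 < ε) : ∫ z, (ε ^ m)⁻¹ • g (ε⁻¹ • z) = ∫ z, g z := by
  rw [integral_smul, Measure.integral_comp_smul, finrank_euclideanSpace_fin, inv_pow, inv_inv,
    abs_of_pos (by positivity), smul_smul, inv_mul_cancel₀ (by positivity), one_smul]

theorem integral_mollifier {ε : ℝ} (hε : 0 < ε) : ∫ z, (mollifier ε : 𝔼 → ℂ) z = 1 := by
  rw [← integral_bumpKernel (m := m), ← integral_scale (bumpKernel m) hε]
  simp [mollifier]

theorem integral_norm_mollifier {ε : ℝ} (hε : 0 < ε) : ∫ z, ‖(mollifier ε : 𝔼 → ℂ) z‖ = 1 := by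
  rw [← integral_norm_bumpKernel (m := m), ← integral_scale (fun z => ‖bumpKernel m z‖) hε]
  simp [mollifier, abs_of_pos hε]

/-- Differentiation costs 1/ε and the weight |z| gives back ε, so the integral is scale invariant.
This is the uniform bound behind the commutator lemma. -/
theorem integral_norm_mul_partialD_mollifier {ε : ℝ} (hε : 0 < ε) (i : Fin m) :
    ∫ z : 𝔼, ‖z‖ * ‖partialD i (mollifier ε) z‖ = ∫ z, ‖z‖ * ‖partialD i (bumpKernel m) z‖ := by
  rw [← integral_scale (fun z => ‖z‖ * ‖partialD i (bumpKernel m) z‖) hε]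
  congr 1 with z
  rw [partialD_mollifier]
  simp only [norm_mul, norm_smul, Complex.norm_real, Real.norm_eq_abs, smul_eq_mul, 
    abs_inv, abs_pow, abs_of_pos hε]
  ring

theorem eq_zero_of_lt_norm {ε : ℝ} (hε : 0 < ε) {t : 𝔼} (ht : ε < ‖t‖) (w : List (Fin m)) :
    wordD w (mollifier ε) t = 0 :=
  image_eq_zero_of_notMem_tsupport fun h => by
    have := tsupport_mollifier hε (tsupport_wordD_subset _ w h)
    rw [mem_closedBall_zero_iff] at this
    linarith

/-- Mollifiers have integral one, so the error is the average of V(x - t) - V(x) against a kernel of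
mass one. -/
theorem tendsto_eLpNorm_conv_sub (hp1 : 1 ≤ p) (hp : p ≠ ⊤) {V : 𝔼 → ℂ} (hV : MemLp V p volume) :
    Tendsto (fun ε => eLpNorm (fun x => conv (mollifier ε) V x - V x) p volume) (𝓝[>] 0) (𝓝 0) := by
  refine tendsto_eLpNorm_of_le_lintegral_translate hp1 hp hV (M := 1)
    (k := fun ε t => ‖mollifier ε t‖ₑ) (by simp)
    (fun ε hε => (isTest_mollifier hε).smooth.continuous.measurable.enorm)
    (fun ε hε t ht => by simpa using eq_zero_of_lt_norm hε ht []) (fun ε hε => ?_) fun ε hε x => ?_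
  · rw [← ofReal_integral_norm_eq_lintegral_enorm (isTest_mollifier hε).integrable,
      integral_norm_mollifier hε, ENNReal.ofReal_one]
  · have h1 := integrable_conv (isTest_mollifier hε) (hV.locallyIntegrable hp1) x
    have h2 : conv (mollifier ε) V x - V x = ∫ t, (V (x - t) - V x) * mollifier ε t := by
      have h3 : Integrable fun t : 𝔼 => mollifier ε t * V x :=
        (isTest_mollifier hε).integrable.mul_const _
      have h4 : V x = ∫ t : 𝔼, mollifier ε t * V x := by
        rw [integral_mul_const, integral_mollifier hε, one_mul]
      calc conv (mollifier ε) V x - V x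
          = (∫ t, mollifier ε t * V (x - t)) - ∫ t : 𝔼, mollifier ε t * V x := by rw [← h4, conv]
        _ = _ := by rw [← integral_sub h1 h3]; congr 1 with t; ring
    rw [h2]
    refine (enorm_integral_le_lintegral_enorm _).trans_eq ?_
    simp only [enorm_mul]

/-- The Friedrichs commutator of multiplication by `b` followed by `∂ᵢ` with mollification. -/
def friedrichs (b V : 𝔼 → ℂ) (i : Fin m) (ε : ℝ) (x : 𝔼) : ℂ :=
  b x * conv (partialD i (mollifier ε)) V x + conv (mollifier ε) (fun y => partialD i b y * V y) x -
    conv (partialD i (mollifier ε)) (fun y => b y * V y) x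

theorem IsTest.memLp_mul {Ω : Set (EuclideanSpace ℝ (Fin m))} {b V : 𝔼 → ℂ} (hb : IsTest Ω b)
    (hV : MemLp V p volume) : MemLp (fun y => b y * V y) p volume := by
  obtain ⟨C, hC⟩ := hb.compact.exists_bound_of_continuous hb.smooth.continuous
  refine MemLp.of_le_mul (c := C) hV (hb.smooth.continuous.aestronglyMeasurable.mul hV.1)
    (Eventually.of_forall fun y => ?_)
  rw [norm_mul]
  exact mul_le_mul_of_nonneg_right (hC y) (norm_nonneg _)

theorem continuous_friedrichs (hp1 : 1 ≤ p) {b V : 𝔼 → ℂ} (hb : IsTest Set.univ b)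
    (hV : MemLp V p volume) (i : Fin m) {ε : ℝ} (hε : 0 < ε) : Continuous (friedrichs b V i ε) :=
  ((hb.smooth.continuous.mul (contDiff_conv ((isTest_mollifier hε).partialD i)
    (hV.locallyIntegrable hp1)).continuous).add (contDiff_conv (isTest_mollifier hε)
      (((hb.partialD i).memLp_mul hV).locallyIntegrable hp1)).continuous).sub
    (contDiff_conv ((isTest_mollifier hε).partialD i)
      ((hb.memLp_mul hV).locallyIntegrable hp1)).continuous

/-- The integrand is the i-th derivative in t of (b(x) - b(x - t)) times the mollifier, which has
compact support. The cancellation allows V(x) to be subtracted from V(x - t) in the commutator. -/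
theorem integral_friedrichs_kernel {b : 𝔼 → ℂ} (hb : IsTest Set.univ b) (i : Fin m) {ε : ℝ}
    (hε : 0 < ε) (x : 𝔼) :
    ∫ t, ((b x - b (x - t)) * partialD i (mollifier ε) t +
      partialD i b (x - t) * mollifier ε t) = 0 := by
  have hm := isTest_mollifier (m := m) hε
  have hd : ∀ t, partialD i (fun t => b (x - t)) t = -partialD i b (x - t) := by
    intro t
    have h1 : HasFDerivAt b (fderiv ℝ b (x - t)) (x - t) :=
      (hb.smooth.differentiable (by simp) _).hasFDerivAt
    have h2 : HasFDerivAt (fun t : 𝔼 => x - t) (-ContinuousLinearMap.id ℝ 𝔼) t :=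
      (hasFDerivAt_id (𝕜 := ℝ) t).const_sub x
    simp only [partialD]
    rw [show (fun t => b (x - t)) = b ∘ fun t => x - t from rfl, (h1.comp t h2).fderiv]
    simp
  have hs : ContDiff ℝ ∞ fun t => b x - b (x - t) :=
    contDiff_const.sub (hb.smooth.comp (contDiff_const.sub contDiff_id))
  have hs' : ContDiff ℝ ∞ fun t => partialD i b (x - t) :=
    (contDiff_partialD hb.smooth i).comp (contDiff_const.sub contDiff_id)
  have h := integral_partialD_mul isOpen_univ hm hs.contDiffOn i
  have h4 : ∀ t, partialD i (fun t => b x - b (x - t)) t = partialD i b (x - t) := by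
    intro t
    have := hd t
    simp only [partialD] at this ⊢
    rw [fderiv_const_sub]
    simp [this]
  simp only [h4] at h
  rw [integral_add ((hm.partialD i).mul_smooth hs).integrable (hm.mul_smooth hs').integrable, h]
  ring

/-- Written as an integral in t, the commutator has kernel (b(x) - b(x - t)) ∂ᵢρ_ε(t) + ∂ᵢb(x - t)
ρ_ε(t), where ρ_ε is the mollifier. Its integral is zero, and with `C₁` a Lipschitz constant of b
and `C₂` a bound of ∂ᵢb its mass is at most `C₁ * I + C₂`, independently of ε. No derivative of V
enters. -/
theorem tendsto_eLpNorm_friedrichs (hp1 : 1 ≤ p) (hp : p ≠ ⊤) {b V : 𝔼 → ℂ}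
    (hb : IsTest Set.univ b) (hV : MemLp V p volume) (i : Fin m) :
    Tendsto (fun ε => eLpNorm (friedrichs b V i ε) p volume) (𝓝[>] 0) (𝓝 0) := by
  obtain ⟨C₁, hC₁⟩ := hb.smooth.lipschitzWith_of_hasCompactSupport hb.compact (by simp)
  obtain ⟨C₂, hC₂⟩ := (hb.partialD i).compact.exists_bound_of_continuous
    (hb.partialD i).smooth.continuous
  have hC₂0 : 0 ≤ C₂ := (norm_nonneg _).trans (hC₂ 0)
  set I := ∫ z, ‖z‖ * ‖partialD i (bumpKernel m) z‖
  have hcont : ∀ ε > 0, Continuous fun t : 𝔼 =>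
      C₁ * (‖t‖ * ‖partialD i (mollifier ε) t‖) + C₂ * ‖mollifier ε t‖ := fun ε hε => by
    have h1 := (isTest_mollifier (m := m) hε).smooth.continuous
    have h2 := ((isTest_mollifier (m := m) hε).partialD i).smooth.continuous
    fun_prop
  refine tendsto_eLpNorm_of_le_lintegral_translate hp1 hp hV (M := ENNReal.ofReal (C₁ * I + C₂))
    (k := fun ε t => ENNReal.ofReal
      (C₁ * (‖t‖ * ‖partialD i (mollifier ε) t‖) + C₂ * ‖mollifier ε t‖)) (by simp)
    (fun ε hε => (hcont ε hε).measurable.ennreal_ofReal) (fun ε hε t ht => ?_)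
    (fun ε hε => ?_) fun ε hε x => ?_
  · have h1 := eq_zero_of_lt_norm hε ht []
    have h2 := eq_zero_of_lt_norm hε ht [i]
    simp only [wordD_cons, wordD_nil] at h1 h2
    simp [h1, h2]
  · have hm := isTest_mollifier (m := m) hε
    have i1 : Integrable fun t : 𝔼 => ‖t‖ * ‖partialD i (mollifier ε) t‖ :=
      (continuous_norm.mul (hm.partialD i).smooth.continuous.norm).integrable_of_hasCompactSupport
        (hm.partialD i).compact.norm.mul_left
    have i2 := hm.integrable.norm
    have i3 : Integrable fun t : 𝔼 =>
        C₁ * (‖t‖ * ‖partialD i (mollifier ε) t‖) + C₂ * ‖mollifier ε t‖ :=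
      (i1.const_mul _).add (i2.const_mul _)
    rw [← ofReal_integral_eq_lintegral_ofReal i3 (Eventually.of_forall fun t => by positivity),
      integral_add (i1.const_mul _) (i2.const_mul _),
      integral_const_mul, integral_const_mul, integral_norm_mul_partialD_mollifier hε,
      integral_norm_mollifier hε, mul_one]
  · have hm := isTest_mollifier (m := m) hε
    have hL := hV.locallyIntegrable hp1
    have i1 := (integrable_conv (hm.partialD i) hL x).const_mul (b x)
    have i2 := integrable_conv hm (((hb.partialD i).memLp_mul hV).locallyIntegrable hp1) x
    have i3 := integrable_conv (hm.partialD i) ((hb.memLp_mul hV).locallyIntegrable hp1) x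
    have hs : ContDiff ℝ ∞ fun t => b x - b (x - t) :=
      contDiff_const.sub (hb.smooth.comp (contDiff_const.sub contDiff_id))
    have hs' : ContDiff ℝ ∞ fun t => partialD i b (x - t) :=
      (contDiff_partialD hb.smooth i).comp (contDiff_const.sub contDiff_id)
    have i12 : Integrable fun t => b x * (partialD i (mollifier ε) t * V (x - t)) +
        mollifier ε t * (partialD i b (x - t) * V (x - t)) := i1.add i2
    have i123 : Integrable fun t => b x * (partialD i (mollifier ε) t * V (x - t)) +
        mollifier ε t * (partialD i b (x - t) * V (x - t)) -
        partialD i (mollifier ε) t * (b (x - t) * V (x - t)) := i12.sub i3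
    have i4 : Integrable fun t => ((b x - b (x - t)) * partialD i (mollifier ε) t +
        partialD i b (x - t) * mollifier ε t) * V x :=
      (((hm.partialD i).mul_smooth hs).integrable.add (hm.mul_smooth hs').integrable).mul_const _
    -- The subtracted multiple of V(x) has zero integral by `integral_friedrichs_kernel`.
    have e : friedrichs b V i ε x = ∫ t, ((b x - b (x - t)) * partialD i (mollifier ε) t +
        partialD i b (x - t) * mollifier ε t) * (V (x - t) - V x) := by
      have h0 := integral_friedrichs_kernel hb i hε x
      simp only [friedrichs, conv]
      rw [← integral_const_mul, ← integral_add i1 i2, ← integral_sub i12 i3]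
      calc _ = (∫ t, (b x * (partialD i (mollifier ε) t * V (x - t)) +
            mollifier ε t * (partialD i b (x - t) * V (x - t)) -
            partialD i (mollifier ε) t * (b (x - t) * V (x - t)))) -
            ∫ t, ((b x - b (x - t)) * partialD i (mollifier ε) t +
              partialD i b (x - t) * mollifier ε t) * V x := by
              rw [integral_mul_const, h0, zero_mul, sub_zero]
        _ = _ := by rw [← integral_sub i123 i4]; congr 1 with t; ring
    rw [e]
    refine (enorm_integral_le_lintegral_enorm _).trans (lintegral_mono fun t => ?_)
    rw [enorm_mul, mul_comm]
    gcongr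
    rw [← ofReal_norm]
    refine ENNReal.ofReal_le_ofReal ((norm_add_le _ _).trans ?_)
    rw [norm_mul, norm_mul, ← mul_assoc]
    gcongr
    · have := hC₁.dist_le_mul x (x - t)
      simpa [dist_eq_norm] using this
    · exact hC₂ _

/-- Up to sign this is the mollification of the distribution b ∂ᵢV at x, with the derivative moved
onto b and the mollifier. -/
theorem integral_mul_partialD_translate (hp1 : 1 ≤ p) {b V : 𝔼 → ℂ} (hb : IsTest Set.univ b)
    (hV : MemLp V p volume) (i : Fin m) {ε : ℝ} (hε : 0 < ε) (x : 𝔼) :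
    ∫ y, V y * partialD i (fun y => b y * mollifier ε (x - y)) y =
      conv (mollifier ε) (fun y => partialD i b y * V y) x -
        conv (partialD i (mollifier ε)) (fun y => b y * V y) x := by
  have hm := isTest_mollifier (m := m) hε
  have hc : ∀ k W, IsTest Set.univ k → MemLp W p volume →
      Integrable fun y => W y * k (x - y) := fun k W hk hW => by
    have := (integrable_conv hk (hW.locallyIntegrable hp1) x).comp_sub_left x
    simpa [mul_comm] using this
  rw [conv_eq_integral, conv_eq_integral, ← integral_sub (hc _ _ hm ((hb.partialD i).memLp_mul hV))
    (hc _ _ (hm.partialD i) (hb.memLp_mul hV))]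
  congr 1 with y
  have h1 : HasFDerivAt (mollifier ε) (fderiv ℝ (mollifier ε) (x - y)) (x - y) :=
    (hm.smooth.differentiable (by simp) _).hasFDerivAt
  have h2 : HasFDerivAt (fun t : 𝔼 => x - t) (-ContinuousLinearMap.id ℝ 𝔼) y :=
    (hasFDerivAt_id (𝕜 := ℝ) y).const_sub x
  have h3 : partialD i (fun y => mollifier ε (x - y)) y = -partialD i (mollifier ε) (x - y) := by
    simp only [partialD]
    rw [show (fun y => mollifier ε (x - y)) = mollifier ε ∘ fun y => x - y from rfl,
      (h1.comp y h2).fderiv]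
    simp
  rw [partialD_mul (v := fun y => mollifier ε (x - y)) (hb.smooth.differentiable (by simp) y)
    (h1.comp y h2).differentiableAt, h3]
  ring

end Friedrichs

/-! ### Approximation of local solutions -/

section Local

variable {m : ℕ} {p : ℝ≥0∞} {Ω K : Set (EuclideanSpace ℝ (Fin m))}

local notation "𝔼" => EuclideanSpace ℝ (Fin m)

theorem MemLpLoc.memLp {u : 𝔼 → ℂ} (hu : MemLpLoc p Ω u) (hK : IsCompact K) (hKΩ : K ⊆ Ω)
    (h0 : ∀ y, y ∉ K → u y = 0) : MemLp u p volume := by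
  have h := (memLp_indicator_iff_restrict hK.measurableSet).2 (hu K hK hKΩ)
  rwa [Set.indicator_eq_self.2] at h
  intro y hy
  by_contra hyK
  exact hy (h0 y hyK)

theorem MemLp.memLpLoc {u : 𝔼 → ℂ} (hu : MemLp u p volume) : MemLpLoc p Ω u :=
  fun _ _ _ => hu.restrict _

/-- Extension by zero: a global test function may be multiplied by a cut-off equal to 1 near K
without changing either integral. -/
theorem HasWeakD.univ {i : Fin m} {u v : 𝔼 → ℂ} (h : HasWeakD Ω i u v) (hΩ : IsOpen Ω)
    (hK : IsCompact K) (hKΩ : K ⊆ Ω) (hu : ∀ y, y ∉ K → u y = 0) (hv : ∀ y, y ∉ K → v y = 0) :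
    HasWeakD Set.univ i u v := by
  obtain ⟨κ, hκ, W, hW, hKW, hκ1⟩ := exists_isTest_eq_one hΩ hK hKΩ
  intro θ hθ
  have hκθ : IsTest Ω fun y => κ y * θ y := by
    simpa only [mul_comm] using hκ.mul_smooth hθ.smooth
  have h1 := h _ hκθ
  have e1 : Set.EqOn (fun y => κ y * θ y) θ W := fun y hy => by simp [hκ1 y hy]
  have e2 := partialD_eqOn hW e1 i
  convert h1 using 2
  · ext y
    by_cases hy : y ∈ K
    · rw [e2 (hKW hy)]
    · simp [hu y hy]
  · congr 1
    ext y
    by_cases hy : y ∈ K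
    · rw [hκ1 y (hKW hy), one_mul]
    · simp [hv y hy]

theorem wordD_eq_zero {χ : 𝔼 → ℂ} {y : 𝔼} (hy : y ∉ tsupport χ) (w : List (Fin m)) :
    wordD w χ y = 0 :=
  image_eq_zero_of_notMem_tsupport fun h => hy (tsupport_wordD_subset _ w h)

theorem leibSum_eq_zero {χ : 𝔼 → ℂ} {y : 𝔼} (hy : y ∉ tsupport χ) (U : List (Fin m) → 𝔼 → ℂ)
    (L : List (List (Fin m) × List (Fin m))) : leibSum χ U L y = 0 := by
  simp [leibSum, wordD_eq_zero hy]

theorem cutJet_eq_zero {χ : 𝔼 → ℂ} {y : 𝔼} (hy : y ∉ tsupport χ) (U : List (Fin m) → 𝔼 → ℂ)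
    (w : List (Fin m)) : cutJet χ U w y = 0 := by
  simp [cutJet, leibSum_eq_zero hy, image_eq_zero_of_notMem_tsupport hy]

theorem cutJet_nil (χ : 𝔼 → ℂ) (U : List (Fin m) → 𝔼 → ℂ) :
    cutJet χ U [] = fun y => χ y * U [] y := by
  funext y
  simp [cutJet, leibRest, leibSum]

theorem tsupport_conv_subset {V : 𝔼 → ℂ} (hV : ∀ y, y ∉ K → V y = 0) {ε : ℝ} (hε : 0 < ε) :
    tsupport (conv (mollifier ε) V) ⊆ Metric.cthickening ε K := by
  refine closure_minimal (fun x hx => ?_) Metric.isClosed_cthickening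
  obtain ⟨t, ht⟩ : ∃ t, mollifier ε t * V (x - t) ≠ 0 := by
    by_contra! h
    exact hx (by simp [conv, h])
  have h1 : t ∈ Metric.closedBall (0 : 𝔼) ε :=
    tsupport_mollifier hε (subset_tsupport _ (left_ne_zero_of_mul ht))
  have h2 : x - t ∈ K := by
    by_contra h
    exact ht (by simp [hV _ h])
  refine Metric.mem_cthickening_of_dist_le x (x - t) ε K h2 ?_
  simpa [dist_eq_norm] using h1

theorem HasWeakD.conv_partialD {i : Fin m} {u v k : 𝔼 → ℂ} (h : HasWeakD Set.univ i u v)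
    (hk : IsTest Set.univ k) : conv (partialD i k) u = conv k v := by
  funext x
  have hs : ContDiff ℝ ∞ fun y => k (x - y) := hk.smooth.comp (contDiff_const.sub contDiff_id)
  have ht : IsTest Set.univ fun y => k (x - y) :=
    ⟨hs, hk.compact.comp_homeomorph (Homeomorph.subLeft x), Set.subset_univ _⟩
  have h3 : ∀ y, partialD i (fun y => k (x - y)) y = -partialD i k (x - y) := by
    intro y
    have h1 : HasFDerivAt k (fderiv ℝ k (x - y)) (x - y) :=
      (hk.smooth.differentiable (by simp) _).hasFDerivAt
    have h2 : HasFDerivAt (fun t : 𝔼 => x - t) (-ContinuousLinearMap.id ℝ 𝔼) y :=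
      (hasFDerivAt_id (𝕜 := ℝ) y).const_sub x
    simp only [partialD]
    rw [show (fun y => k (x - y)) = k ∘ fun y => x - y from rfl, (h1.comp y h2).fderiv]
    simp
  have := h _ ht
  simp only [h3, mul_neg, integral_neg, neg_inj] at this
  rw [conv_eq_integral, conv_eq_integral, this]

/-! ### Commutators of differential operators with mollification -/

variable {r : ℕ} {V : List (Fin m) → EuclideanSpace ℝ (Fin m) → ℂ}

theorem IsJet.wordD_conv (hp1 : 1 ≤ p) (hV : IsJet p Set.univ r V)
    (hVp : ∀ w, w.length ≤ r → MemLp (V w) p volume) {k : 𝔼 → ℂ} (hk : IsTest Set.univ k)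
    {w : List (Fin m)} (hw : w.length ≤ r) : wordD w (conv k (V [])) = conv k (V w) := by
  induction w with
  | nil => rfl
  | cons i w ih =>
    have hw' : w.length + 1 ≤ r := by simpa using hw
    rw [wordD_cons, ih (by omega), partialD_conv hk
      ((hVp w (by omega)).locallyIntegrable hp1), (hV.weak i w hw').conv_partialD hk]

/-- The commutator of `b ∂^w` with mollification, applied to `V []`. -/
def mollComm (b : 𝔼 → ℂ) (V : List (Fin m) → 𝔼 → ℂ) : List (Fin m) → ℝ → 𝔼 → ℂ
  | [], ε => fun x => b x * conv (mollifier ε) (V []) x - conv (mollifier ε) (fun y => b y * V [] y) x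
  | i :: w, ε => friedrichs b (V w) i ε

/-- The last r derivatives pass through the mollification as weak derivatives of V; the first letter
is left to the Friedrichs commutator. The subtracted pairing is the mollified distribution b ∂^w V.
-/
theorem mollComm_eq (hp1 : 1 ≤ p) (hV : IsJet p Set.univ r V)
    (hVp : ∀ w, w.length ≤ r → MemLp (V w) p volume) {b : 𝔼 → ℂ} (hb : IsTest Set.univ b)
    {w : List (Fin m)} (hw : w.length ≤ r + 1) {ε : ℝ} (hε : 0 < ε) (x : 𝔼) :
    mollComm b V w ε x = b x * wordD w (conv (mollifier ε) (V [])) x -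
      jetPair V w (fun y => b y * mollifier ε (x - y)) := by
  cases w with
  | nil =>
    simp only [mollComm, wordD_nil, jetPair, conv_eq_integral _ (fun y => b y * V [] y)]
    congr 2 with y; ring
  | cons i w =>
    have hw' : w.length ≤ r := by simpa using hw
    rw [wordD_cons, hV.wordD_conv hp1 hVp (isTest_mollifier hε) hw', jetPair,
      integral_mul_partialD_translate hp1 hb (hVp w hw') i hε x,
      partialD_conv (isTest_mollifier hε) ((hVp w hw').locallyIntegrable hp1), mollComm, friedrichs]
    ring

theorem continuous_mollComm (hp1 : 1 ≤ p) (hVp : ∀ w, w.length ≤ r → MemLp (V w) p volume)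
    {b : 𝔼 → ℂ} (hb : IsTest Set.univ b) {w : List (Fin m)} (hw : w.length ≤ r + 1) {ε : ℝ}
    (hε : 0 < ε) : Continuous (mollComm b V w ε) := by
  cases w with
  | nil =>
    exact (hb.smooth.continuous.mul (contDiff_conv (isTest_mollifier hε)
      ((hVp [] (by simp)).locallyIntegrable hp1)).continuous).sub
      (contDiff_conv (isTest_mollifier hε)
        ((hb.memLp_mul (hVp [] (by simp))).locallyIntegrable hp1)).continuous
  | cons i w => exact continuous_friedrichs hp1 hb (hVp w (by simpa using hw)) i hε

theorem tendsto_eLpNorm_mollComm (hp1 : 1 ≤ p) (hp : p ≠ ⊤)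
    (hVp : ∀ w, w.length ≤ r → MemLp (V w) p volume) {b : 𝔼 → ℂ} (hb : IsTest Set.univ b)
    {w : List (Fin m)} (hw : w.length ≤ r + 1) :
    Tendsto (fun ε => eLpNorm (mollComm b V w ε) p volume) (𝓝[>] 0) (𝓝 0) := by
  cases w with
  | cons i w => exact tendsto_eLpNorm_friedrichs hp1 hp hb (hVp w (by simpa using hw)) i
  | nil =>
    have hV := hVp [] (by simp)
    have hbV := hb.memLp_mul hV
    obtain ⟨C, hC⟩ := hb.compact.exists_bound_of_continuous hb.smooth.continuous
    have h1 := ENNReal.Tendsto.const_mul (a := ENNReal.ofReal C)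
      (tendsto_eLpNorm_conv_sub hp1 hp hV) (Or.inr ENNReal.ofReal_ne_top)
    have h2 := h1.add (tendsto_eLpNorm_conv_sub hp1 hp hbV)
    rw [mul_zero, add_zero] at h2
    refine tendsto_of_tendsto_of_tendsto_of_le_of_le' tendsto_const_nhds h2
      (Eventually.of_forall fun _ => zero_le) ?_
    filter_upwards [self_mem_nhdsWithin] with ε (hε : 0 < ε)
    have c1 := (contDiff_conv (isTest_mollifier hε) (hV.locallyIntegrable hp1)).continuous
    have c2 := (contDiff_conv (isTest_mollifier hε) (hbV.locallyIntegrable hp1)).continuous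
    have a1 : AEStronglyMeasurable (fun x => conv (mollifier ε) (V []) x - V [] x) volume :=
      c1.aestronglyMeasurable.sub hV.1
    have a2 : AEStronglyMeasurable (fun x => conv (mollifier ε) (fun y => b y * V [] y) x -
      b x * V [] x) volume := c2.aestronglyMeasurable.sub hbV.1
    have e : mollComm b V [] ε = (fun x => b x * (conv (mollifier ε) (V []) x - V [] x)) -
        fun x => conv (mollifier ε) (fun y => b y * V [] y) x - b x * V [] x := by
      funext x
      simp only [mollComm, Pi.sub_apply]
      ring
    rw [e]
    refine (eLpNorm_sub_le (hb.smooth.continuous.aestronglyMeasurable.mul a1) a2 hp1).trans ?_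
    gcongr
    refine eLpNorm_le_mul_eLpNorm_of_ae_le_mul (Eventually.of_forall fun x => ?_) p
    rw [Pi.mul_apply, norm_mul]
    exact mul_le_mul_of_nonneg_right (hC x) (norm_nonneg _)

/-! ### Differential expressions and Friedrichs' theorem -/

variable {d k : ℕ} {a : (Fin m → ℕ) → Fin d → EuclideanSpace ℝ (Fin m) → ℂ}

/-- The classical differential expression `∑ᵢ ∑_{|α| ≤ k} a_{α i} ∂^α uᵢ`. -/
def diffExpr (k : ℕ) (a : (Fin m → ℕ) → Fin d → 𝔼 → ℂ) (u : Fin d → 𝔼 → ℂ) : 𝔼 → ℂ := fun y =>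
  ∑ i, ∑ α ∈ multiIndices m k, a α i y * multiD α (u i) y

theorem isTest_diffExpr (hΩ : IsOpen Ω) (ha : ∀ α i, ContDiffOn ℝ ∞ (a α i) Ω)
    {u : Fin d → 𝔼 → ℂ} (hu : ∀ i, IsTest Ω (u i)) : IsTest Ω (diffExpr k a u) :=
  IsTest.sum _ fun i _ => IsTest.sum _ fun α _ => ((hu i).multiD α).mul hΩ (ha α i)

theorem weakEq_diffExpr (hΩ : IsOpen Ω) (ha : ∀ α i, ContDiffOn ℝ ∞ (a α i) Ω)
    {u : Fin d → 𝔼 → ℂ} (hu : ∀ i, ContDiffOn ℝ ∞ (u i) Ω) : WeakEq Ω k a u (diffExpr k a u) := by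
  intro θ hθ
  have hw : ∀ i (α : Fin m → ℕ), ContDiffOn ℝ ∞ (multiD α (u i)) Ω := fun i α => by
    rw [multiD_eq_wordD]; exact contDiffOn_wordD hΩ (hu i) _
  have hi : ∀ i, ∀ α ∈ multiIndices m k,
      Integrable fun y => multiD α (u i) y * (a α i y * θ y) := fun i α _ =>
    ((hθ.mul hΩ (ha α i)).mul hΩ (hw i α)).integrable
  have e : ∀ y, diffExpr k a u y * θ y =
      ∑ i, ∑ α ∈ multiIndices m k, multiD α (u i) y * (a α i y * θ y) := fun y => by
    simp only [diffExpr, Finset.sum_mul]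
    exact Finset.sum_congr rfl fun i _ => Finset.sum_congr rfl fun α _ => by ring
  simp only [e]
  rw [integral_finsetSum _ fun i _ => integrable_finsetSum _ (hi i)]
  refine Finset.sum_congr rfl fun i _ => ?_
  rw [integral_finsetSum _ (hi i)]
  refine Finset.sum_congr rfl fun α _ => ?_
  rw [integral_mul_multiD hΩ (hθ.mul hΩ (ha α i)) (hu i), ← mul_assoc, ← pow_add, ← two_mul,
    pow_mul]
  simp

theorem WeakEq.sub (hp1 : 1 ≤ p) (hΩ : IsOpen Ω) (ha : ∀ α i, ContDiffOn ℝ ∞ (a α i) Ω)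
    {u v : Fin d → 𝔼 → ℂ} {g h : 𝔼 → ℂ} (hu : ∀ i, MemLpLoc p Ω (u i))
    (hv : ∀ i, MemLpLoc p Ω (v i)) (hg : MemLpLoc p Ω g) (hh : MemLpLoc p Ω h)
    (h1 : WeakEq Ω k a u g) (h2 : WeakEq Ω k a v h) :
    WeakEq Ω k a (fun i y => u i y - v i y) fun y => g y - h y := by
  intro θ hθ
  simp only [sub_mul]
  rw [integral_sub (hg.integrable_test hp1 hθ) (hh.integrable_test hp1 hθ), ← h1 θ hθ, ← h2 θ hθ]
  simp only [← Finset.sum_sub_distrib, ← mul_sub]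
  refine Finset.sum_congr rfl fun i _ => Finset.sum_congr rfl fun α _ => ?_
  rw [integral_sub]
  · exact (hu i).integrable_test hp1 ((hθ.mul hΩ (ha α i)).multiD α)
  · exact (hv i).integrable_test hp1 ((hθ.mul hΩ (ha α i)).multiD α)

theorem IsTest.memLpLoc {θ : 𝔼 → ℂ} (hθ : IsTest Ω θ) : MemLpLoc p Ω θ :=
  fun _ _ _ => (hθ.smooth.continuous.memLp_of_hasCompactSupport hθ.compact).restrict _

theorem cutRhs_eq_zero {χ : 𝔼 → ℂ} {y : 𝔼} (hy : y ∉ tsupport χ)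
    (U : Fin d → List (Fin m) → 𝔼 → ℂ) (g : 𝔼 → ℂ) : cutRhs k a χ U g y = 0 := by
  simp [cutRhs, leibSum_eq_zero hy, image_eq_zero_of_notMem_tsupport hy]

/-- Friedrichs' theorem: the mollifications of a compactly supported solution `V []` of a linear
equation approximate it in the graph norm. -/
theorem tendsto_eLpNorm_diffExpr_sub (hp1 : 1 ≤ p) (hp : p ≠ ⊤) (hΩ : IsOpen Ω)
    (hK : IsCompact K) (hKΩ : K ⊆ Ω) (hk : k ≤ r + 1) (ha : ∀ α i, ContDiffOn ℝ ∞ (a α i) Ω)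
    {V : Fin d → List (Fin m) → 𝔼 → ℂ} (hV : ∀ i, IsJet p Ω r (V i))
    (hV0 : ∀ i w y, y ∉ K → V i w y = 0) {g : 𝔼 → ℂ} (hg : MemLpLoc p Ω g)
    (hg0 : ∀ y, y ∉ K → g y = 0) (h : WeakEq Ω k a (fun i => V i []) g) :
    Tendsto (fun ε => eLpNorm (fun y =>
      diffExpr k a (fun i => conv (mollifier ε) (V i [])) y - g y) p volume) (𝓝[>] 0) (𝓝 0) := by
  obtain ⟨κ, hκ, W, hW, hKW, hκ1⟩ := exists_isTest_eq_one hΩ hK hKΩ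
  have hVp : ∀ i w, w.length ≤ r → MemLp (V i w) p volume := fun i w hw =>
    ((hV i).memLpLoc w hw).memLp hK hKΩ (hV0 i w)
  have hVu : ∀ i, IsJet p Set.univ r (V i) := fun i =>
    ⟨fun w hw => MemLp.memLpLoc (hVp i w hw), fun j w hw =>
      ((hV i).weak j w hw).univ hΩ hK hKΩ (hV0 i w) (hV0 i _)⟩
  have hgp := hg.memLp hK hKΩ hg0
  -- The coefficients are smooth on Ω only; multiplied by κ they become global test functions, as
  -- the commutator lemma demands.
  have hb : ∀ α i, IsTest Set.univ fun y => a α i y * κ y := fun α i =>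
    (hκ.mul hΩ (ha α i)).mono (Set.subset_univ _)
  have hw : ∀ α ∈ multiIndices m k, (word α).length ≤ r + 1 := fun α hα => by
    rw [length_word]; exact (mem_multiIndices.1 hα).trans hk
  rw [weakEq_iff_jetPair hΩ hk ha hV] at h
  have hlim : Tendsto (fun ε => (∑ i, ∑ α ∈ multiIndices m k,
      eLpNorm (mollComm (fun y => a α i y * κ y) (V i) (word α) ε) p volume) +
      eLpNorm (fun x => conv (mollifier ε) g x - g x) p volume) (𝓝[>] 0) (𝓝 0) := by
    have := (tendsto_finsetSum Finset.univ fun i _ => tendsto_finsetSum (multiIndices m k)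
      fun α hα => tendsto_eLpNorm_mollComm hp1 hp (hVp i) (hb α i) (hw α hα)).add
      (tendsto_eLpNorm_conv_sub hp1 hp hgp)
    simpa using this
  refine tendsto_of_tendsto_of_tendsto_of_le_of_le' tendsto_const_nhds hlim
    (Eventually.of_forall fun _ => zero_le) ?_
  -- For ε < δ the mollified functions live where κ = 1, so inserting κ changes nothing.
  obtain ⟨δ, hδ, hδW⟩ := hK.exists_cthickening_subset_open hW hKW
  filter_upwards [Ioo_mem_nhdsGT hδ] with ε hε
  have hε0 : 0 < ε := hε.1
  have hm := isTest_mollifier (m := m) hε0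
  have hsupp : ∀ i, tsupport (conv (mollifier ε) (V i [])) ⊆ W := fun i =>
    (tsupport_conv_subset (hV0 i []) hε0).trans
      ((Metric.cthickening_mono hε.2.le K).trans hδW)
  have e : (fun y => diffExpr k a (fun i => conv (mollifier ε) (V i [])) y - g y) =
      (∑ i, ∑ α ∈ multiIndices m k, mollComm (fun y => a α i y * κ y) (V i) (word α) ε) +
        fun x => conv (mollifier ε) g x - g x := by
    funext x
    simp only [Pi.add_apply, Finset.sum_apply]
    have hs : ContDiff ℝ ∞ fun y => mollifier ε (x - y) :=
      hm.smooth.comp (contDiff_const.sub contDiff_id)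
    -- With this test function the weak equation says that the mollified distributions a ∂^α V add
    -- up to the mollification of g at x. The error is thus a sum of commutators plus the
    -- mollification error of g.
    have hθ : IsTest Ω fun y => κ y * mollifier ε (x - y) := by
      simpa only [mul_comm] using hκ.mul_smooth hs
    have h1 := h _ hθ
    have h2 : ∫ y, g y * (κ y * mollifier ε (x - y)) = conv (mollifier ε) g x := by
      rw [conv_eq_integral]
      congr 1 with y
      by_cases hy : y ∈ K
      · rw [hκ1 y (hKW hy), one_mul]
      · simp [hg0 y hy]
    have h3 : ∀ i, ∀ α ∈ multiIndices m k,
        mollComm (fun y => a α i y * κ y) (V i) (word α) ε x =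
        a α i x * multiD α (conv (mollifier ε) (V i [])) x -
          jetPair (V i) (word α) (fun y => a α i y * (κ y * mollifier ε (x - y))) := by
      intro i α hα
      rw [mollComm_eq hp1 (hVu i) (hVp i) (hb α i) (hw α hα) hε0, multiD_eq_wordD]
      simp only [mul_assoc]
      congr 2
      by_cases hx : x ∈ tsupport (conv (mollifier ε) (V i []))
      · rw [hκ1 x (hsupp i hx), one_mul]
      · rw [wordD_eq_zero hx, mul_zero]
    rw [Finset.sum_congr rfl fun i _ => Finset.sum_congr rfl (h3 i)]
    simp only [Finset.sum_sub_distrib]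
    rw [h1, h2, diffExpr]
    ring
  rw [e]
  have hc : ∀ i, ∀ α ∈ multiIndices m k, AEStronglyMeasurable
      (mollComm (fun y => a α i y * κ y) (V i) (word α) ε) volume := fun i α hα =>
    (continuous_mollComm hp1 (hVp i) (hb α i) (hw α hα) hε0).aestronglyMeasurable
  refine (eLpNorm_add_le (Finset.aestronglyMeasurable_sum _ fun i _ =>
    Finset.aestronglyMeasurable_sum _ (hc i)) ((contDiff_conv hm
      (hgp.locallyIntegrable hp1)).continuous.aestronglyMeasurable.sub hgp.1) hp1).trans ?_
  refine add_le_add ?_ le_rfl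
  refine (eLpNorm_sum_le (fun i _ => Finset.aestronglyMeasurable_sum _ (hc i)) hp1).trans ?_
  gcongr with i _
  exact eLpNorm_sum_le (hc i) hp1

/-- Simultaneous approximation of a localized solution of finitely many linear equations. -/
theorem exists_local_approx (hp1 : 1 ≤ p) (hp : p ≠ ⊤) (hΩ : IsOpen Ω) {Λ : Type*} [Finite Λ]
    {κ : Λ → ℕ} (hκ : ∀ l, κ l ≤ r + 1) {a : Λ → (Fin m → ℕ) → Fin d → 𝔼 → ℂ}
    (ha : ∀ l α i, ContDiffOn ℝ ∞ (a l α i) Ω) {u : Fin d → 𝔼 → ℂ}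
    (hu : ∀ i, MemSobolevLoc r p Ω (u i)) {g : Λ → 𝔼 → ℂ} (hg : ∀ l, MemLpLoc p Ω (g l))
    (h : ∀ l, WeakEq Ω (κ l) (a l) u (g l)) {χ : 𝔼 → ℂ} (hχ : IsTest Ω χ) {ε : ℝ≥0∞}
    (hε : 0 < ε) :
    ∃ w : Fin d → 𝔼 → ℂ, (∀ i, IsTest Ω (w i)) ∧
      (∀ i, eLpNorm (fun y => w i y - χ y * u i y) p volume ≤ ε) ∧
      ((∀ i, ∀ᵐ y, y ∈ Ω → u i y = 0) → ∀ i, w i = 0) ∧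
      ∀ l, ∃ G, Measurable G ∧ (∃ K, IsCompact K ∧ K ⊆ Ω ∧ ∀ y, y ∉ K → G y = 0) ∧
        eLpNorm G p volume ≤ ε ∧
        WeakEq Ω (κ l) (a l) (fun i y => w i y - χ y * u i y) G := by
  choose U hU hUu using fun i => (hu i).exists_isJet
  have hVu : ∀ i, cutJet χ (U i) [] = fun y => χ y * u i y := fun i => by
    rw [cutJet_nil, hUu]
  have hV : ∀ i, IsJet p Ω r (cutJet χ (U i)) := fun i => (hU i).cut hp1 hχ.smooth
  have hV0 : ∀ i w y, y ∉ tsupport χ → cutJet χ (U i) w y = 0 := fun i w y hy =>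
    cutJet_eq_zero hy _ _
  have hK : IsCompact (tsupport χ) := hχ.compact
  have hVp : ∀ i, MemLp (cutJet χ (U i) []) p volume := fun i =>
    ((hV i).memLpLoc [] (by simp)).memLp hK hχ.subset (hV0 i [])
  have hG : ∀ l, WeakEq Ω (κ l) (a l) (fun i => cutJet χ (U i) [])
      (cutRhs (κ l) (a l) χ U (g l)) := fun l =>
    WeakEq.cut hp1 hΩ (hκ l) (ha l) hU (hg l) (by simpa only [hUu] using h l) hχ.smooth
  have hGm : ∀ l, MemLpLoc p Ω (cutRhs (κ l) (a l) χ U (g l)) := fun l =>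
    memLpLoc_cutRhs (hκ l) (ha l) hU hχ.smooth (hg l)
  have hG0 : ∀ l y, y ∉ tsupport χ → cutRhs (κ l) (a l) χ U (g l) y = 0 := fun l y hy =>
    cutRhs_eq_zero hy U _
  obtain ⟨δ, hδ, hδΩ⟩ := hK.exists_cthickening_subset_open hΩ hχ.subset
  have ev1 : ∀ᶠ t in 𝓝[>] (0 : ℝ), ∀ i, eLpNorm (fun y =>
      conv (mollifier t) (cutJet χ (U i) []) y - cutJet χ (U i) [] y) p volume ≤ ε :=
    eventually_all.2 fun i =>
      ENNReal.tendsto_nhds_zero.1 (tendsto_eLpNorm_conv_sub hp1 hp (hVp i)) ε hε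
  have ev2 : ∀ᶠ t in 𝓝[>] (0 : ℝ), ∀ l, eLpNorm (fun y =>
      diffExpr (κ l) (a l) (fun i => conv (mollifier t) (cutJet χ (U i) [])) y -
        cutRhs (κ l) (a l) χ U (g l) y) p volume ≤ ε :=
    eventually_all.2 fun l => ENNReal.tendsto_nhds_zero.1 (tendsto_eLpNorm_diffExpr_sub hp1 hp hΩ hK
      hχ.subset (hκ l) (ha l) hV hV0 (hGm l) (hG0 l) (hG l)) ε hε
  -- One mollification parameter serves all components and all of the finitely many equations; t < δ
  -- keeps the supports inside Ω.
  obtain ⟨t, ⟨ht0, htδ⟩, h1, h2⟩ := ((eventually_mem_set.2 (Ioo_mem_nhdsGT hδ)).and (ev1.and ev2)).exists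
  have hm := isTest_mollifier (m := m) ht0
  have hw : ∀ i, IsTest Ω (conv (mollifier t) (cutJet χ (U i) [])) := fun i => by
    have hs := tsupport_conv_subset (hV0 i []) ht0
    refine ⟨contDiff_conv hm ((hVp i).locallyIntegrable hp1), ?_,
      hs.trans ((Metric.cthickening_mono htδ.le _).trans hδΩ)⟩
    exact hK.cthickening.of_isClosed_subset (isClosed_tsupport _) hs
  refine ⟨fun i => conv (mollifier t) (cutJet χ (U i) []), hw, fun i => ?_, fun h0 i => ?_,
    fun l => ?_⟩
  · simpa only [hVu] using h1 i
  · refine conv_eq_zero_of_ae ?_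
    filter_upwards [h0 i] with y hy
    rw [hVu]
    by_cases hyΩ : y ∈ Ω
    · simp [hy hyΩ]
    · simp [hχ.eq_zero hyΩ]
  · have hQ := isTest_diffExpr (k := κ l) hΩ (ha l) hw
    set G' : 𝔼 → ℂ := fun y =>
      diffExpr (κ l) (a l) (fun i => conv (mollifier t) (cutJet χ (U i) [])) y -
        cutRhs (κ l) (a l) χ U (g l) y with hG'
    have hmeas : AEStronglyMeasurable G' volume :=
      hQ.smooth.continuous.aestronglyMeasurable.sub
        ((hGm l).memLp hK hχ.subset (hG0 l)).1
    set L : Set 𝔼 := tsupport (diffExpr (κ l) (a l)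
      fun i => conv (mollifier t) (cutJet χ (U i) [])) ∪ tsupport χ
    have hL : IsCompact L := hQ.compact.isCompact.union hK
    have hG'0 : ∀ y, y ∉ L → G' y = 0 := fun y hy => by
      simp only [L, Set.mem_union, not_or] at hy
      simp only [hG', hG0 l y hy.2, image_eq_zero_of_notMem_tsupport hy.1, sub_zero]
    -- The error is only almost everywhere measurable. A measurable version, cut to the compact set
    -- `L`, will define a genuine Borel section supported in the chart.
    have hae : L.indicator (hmeas.mk G') =ᵐ[volume] G' := by
      filter_upwards [hmeas.ae_eq_mk] with y hy
      by_cases hyL : y ∈ L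
      · rw [Set.indicator_of_mem hyL, hy]
      · rw [Set.indicator_of_notMem hyL, hG'0 y hyL]
    refine ⟨L.indicator (hmeas.mk G'),
      hmeas.stronglyMeasurable_mk.measurable.indicator hL.measurableSet,
      ⟨L, hL, Set.union_subset hQ.subset hχ.subset, fun y hy => Set.indicator_of_notMem hy _⟩, ?_,
      ?_⟩
    · rw [eLpNorm_congr_ae hae]; exact h2 l
    · have h3 := WeakEq.sub hp1 hΩ (ha l) (fun i => (hw i).memLpLoc (p := p))
        (fun i => (hV i).memLpLoc [] (by simp)) (hQ.memLpLoc (p := p)) (hGm l)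
        (weakEq_diffExpr hΩ (ha l) fun i => (hw i).smooth.contDiffOn) (hG l)
      simp only [hVu] at h3
      intro θ hθ
      have h4 := h3 θ hθ
      simp only [hVu]
      rw [h4]
      refine integral_congr_ae ?_
      filter_upwards [hae] with y hy
      rw [hy]
      simp only [hG', hVu]

end Local

/-! ### Coordinates of sections in trivializations and charts -/

section Coordinates

variable {m : ℕ} {X : Type*} [TopologicalSpace X] [ChartedSpace (EuclideanSpace ℝ (Fin m)) X]
variable {F : Type*} [NormedAddCommGroup F] [NormedSpace ℂ F]
variable {E : X → Type*} [∀ x, AddCommGroup (E x)] [∀ x, Module ℂ (E x)]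
  [∀ x, TopologicalSpace (E x)] [TopologicalSpace (TotalSpace F E)]
  [FiberBundle F E] [VectorBundle ℂ F E]

/-- The base is a real manifold, so smoothness of sections is a real notion; the complex-linear
trivializations are regarded as real-linear by restriction of scalars. -/
theorem vectorBundle_real : VectorBundle ℝ F E := by
  have hl : ∀ (e : Trivialization F (π F E)) [MemTrivializationAtlas e],
      Trivialization.IsLinear ℝ e := fun e _ => ⟨fun b hb =>
    ⟨(e.linear ℂ hb).map_add, fun c v => (e.linear ℂ hb).map_smul (c : ℂ) v⟩⟩
  refine ⟨fun e _ => hl e, fun e e' _ _ => ?_⟩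
  have h := (ContinuousLinearMap.restrictScalarsL ℂ F F ℝ ℝ).continuous.comp_continuousOn
    (VectorBundle.continuousOn_coordChange' (R := ℂ) (E := E) e e')
  refine h.congr fun b hb => ?_
  have := hl e
  have := hl e'
  ext v
  exact (Trivialization.coordChangeL_apply e e' hb v).trans
    (Trivialization.coordChangeL_apply (R := ℂ) e e' hb v).symm

attribute [local instance] vectorBundle_real

theorem contMDiffVectorBundle_real [h : IsSmoothComplexBundle m F E] :
    ContMDiffVectorBundle ∞ F E (𝓡 m) := by
  refine ⟨fun e e' _ _ => ?_⟩
  have h1 := (ContinuousLinearMap.restrictScalarsL ℂ F F ℝ ℝ).contMDiff.comp_contMDiffOn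
    (h.contMDiffOn_coordChangeL e e')
  refine h1.congr fun b hb => ?_
  ext v
  exact (Trivialization.coordChangeL_apply e e' hb v).trans
    (Trivialization.coordChangeL_apply (R := ℂ) e e' hb v).symm

attribute [local instance] contMDiffVectorBundle_real

variable [FiniteDimensional ℂ F] (T : Trivialization F (π F E)) [MemTrivializationAtlas T]

/-- The coordinates of a vector in a trivialization. -/
def coordAt (x : X) : E x →ₗ[ℂ] (Fin (Module.finrank ℂ F) → ℂ) :=
  (Module.finBasis ℂ F).equivFun.toLinearMap ∘ₗ T.linearMapAt ℂ x

/-- The frame defined by a trivialization. -/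
def frameAt (x : X) (i : Fin (Module.finrank ℂ F)) : E x := T.symmₗ ℂ x (Module.finBasis ℂ F i)

variable {T}

theorem linearMapAt_eq_sum (x : X) (v : E x) :
    T.linearMapAt ℂ x v = ∑ i, coordAt T x v i • Module.finBasis ℂ F i :=
  ((Module.finBasis ℂ F).sum_equivFun _).symm

theorem coordAt_sum {x : X} (hx : x ∈ T.baseSet) (c : Fin (Module.finrank ℂ F) → ℂ) :
    coordAt T x (∑ i, c i • frameAt T x i) = c := by
  have : T.linearMapAt ℂ x (∑ i, c i • frameAt T x i) = ∑ i, c i • Module.finBasis ℂ F i := by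
    rw [map_sum]
    refine Finset.sum_congr rfl fun i _ => ?_
    rw [map_smul, frameAt, T.linearMapAt_symmₗ hx]
  rw [coordAt, LinearMap.comp_apply, this]
  rw [← Module.Basis.equivFun_symm_apply]
  exact (Module.finBasis ℂ F).equivFun.apply_symm_apply c

theorem sum_coordAt {x : X} (hx : x ∈ T.baseSet) (v : E x) :
    ∑ i, coordAt T x v i • frameAt T x i = v := by
  conv_rhs => rw [← T.symmₗ_linearMapAt (R := ℂ) hx v, linearMapAt_eq_sum, map_sum]
  simp only [map_smul, frameAt]

theorem coordAt_injective {x : X} (hx : x ∈ T.baseSet) {v w : E x}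
    (h : coordAt T x v = coordAt T x w) : v = w := by
  rw [← sum_coordAt hx v, h, sum_coordAt hx]

theorem contMDiffAt_sec_iff [IsSmoothComplexBundle m F E] {U : Opens X} (f : ∀ x : U, E x) {x₀ : U}
    (hx₀ : (x₀ : X) ∈ T.baseSet) :
    ContMDiffAt (𝓡 m) ((𝓡 m).prod 𝓘(ℝ, F)) ∞ (fun x : U => TotalSpace.mk' F (x : X) (f x)) x₀ ↔
      ∀ i, ContMDiffAt (𝓡 m) 𝓘(ℝ, ℂ) ∞ (fun x : U => coordAt T (x : X) (f x) i) x₀ := by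
  have hs : (TotalSpace.mk' F (x₀ : X) (f x₀)) ∈ T.source := T.mem_source.2 hx₀
  have hN : ∀ᶠ x : U in 𝓝 x₀, (x : X) ∈ T.baseSet :=
    continuousAt_subtype_val.preimage_mem_nhds (T.open_baseSet.mem_nhds hx₀)
  have hcongr : (fun x : U => (T (TotalSpace.mk' F (x : X) (f x))).2) =ᶠ[𝓝 x₀]
      fun x : U => T.linearMapAt ℂ (x : X) (f x) := by
    filter_upwards [hN] with x hx
    rw [T.coe_linearMapAt_of_mem hx]
  rw [Bundle.Trivialization.contMDiffAt_iff (n := ∞) (IB := 𝓡 m) (IM := 𝓡 m)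
    (f := fun x : U => TotalSpace.mk' F (x : X) (f x)) (e := T) hs, hcongr.contMDiffAt_iff]
  constructor
  · rintro ⟨-, h⟩ i
    have hl : ContDiff ℝ ∞ fun v : F => (Module.finBasis ℂ F).equivFun v i :=
      (((LinearMap.toContinuousLinearMap ((LinearMap.proj i).comp
        (Module.finBasis ℂ F).equivFun.toLinearMap)).restrictScalars ℝ : F →L[ℝ] ℂ)).contDiff
    exact hl.contMDiff.contMDiffAt.comp x₀ h
  · intro h
    refine ⟨contMDiff_subtype_val x₀, ?_⟩
    have : (fun x : U => T.linearMapAt ℂ (x : X) (f x)) =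
        fun x : U => ∑ i, coordAt T (x : X) (f x) i • Module.finBasis ℂ F i :=
      funext fun x => linearMapAt_eq_sum _ _
    rw [this]
    refine contMDiffAt_finsetSum fun i _ => ?_
    have hl : ContDiff ℝ ∞ fun c : ℂ => c • Module.finBasis ℂ F i :=
      contDiff_id.smul contDiff_const
    exact hl.contMDiff.contMDiffAt.comp x₀ (h i)

theorem contMDiffAt_globalSec_iff [IsSmoothComplexBundle m F E] (f : ∀ x, E x) {x₀ : X}
    (hx₀ : x₀ ∈ T.baseSet) :
    ContMDiffAt (𝓡 m) ((𝓡 m).prod 𝓘(ℝ, F)) ∞ (fun x : X => TotalSpace.mk' F x (f x)) x₀ ↔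
      ∀ i, ContMDiffAt (𝓡 m) 𝓘(ℝ, ℂ) ∞ (fun x : X => coordAt T x (f x) i) x₀ := by
  have h := contMDiffAt_sec_iff (m := m) (T := T) (U := (⊤ : Opens X)) (fun x => f x)
    (x₀ := ⟨x₀, trivial⟩) hx₀
  have e1 := contMDiffAt_subtype_iff (I := 𝓡 m) (I' := (𝓡 m).prod 𝓘(ℝ, F)) (n := ∞)
    (U := (⊤ : Opens X)) (f := fun x : X => TotalSpace.mk' F x (f x)) (x := ⟨x₀, trivial⟩)
  have e2 := fun i => contMDiffAt_subtype_iff (I := 𝓡 m) (I' := 𝓘(ℝ, ℂ)) (n := ∞)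
    (U := (⊤ : Opens X)) (f := fun x : X => coordAt T x (f x) i) (x := ⟨x₀, trivial⟩)
  rw [← e1, h]
  exact forall_congr' e2

/-- A smooth section, from a family of vectors. -/
def secOfSmooth (f : ∀ x, E x)
    (hf : ContMDiff (𝓡 m) ((𝓡 m).prod 𝓘(ℝ, F)) ∞ fun x : X => TotalSpace.mk' F x (f x)) :
    SmoothSec m F E ⊤ :=
  ⟨fun x => f x, fun x => contMDiffAt_subtype_iff.2 (hf x)⟩

theorem globalSec_contMDiff (s : SmoothSec m F E ⊤) :
    ContMDiff (𝓡 m) ((𝓡 m).prod 𝓘(ℝ, F)) ∞ fun x : X => TotalSpace.mk' F x (globalSec s x) :=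
  fun x => (contMDiffAt_subtype_iff (U := (⊤ : Opens X)) (x := ⟨x, trivial⟩)).1 (s.2 ⟨x, trivial⟩)

/-! ### Components of sections written in a chart -/

section Charts

variable [IsManifold (𝓡 m) ∞ X] [IsSmoothComplexBundle m F E]
variable {φ : OpenPartialHomeomorph X (EuclideanSpace ℝ (Fin m))}

theorem contDiffOn_comp_symm (hφ : φ ∈ IsManifold.maximalAtlas (𝓡 m) ∞ X) {g : X → ℂ}
    (hg : ∀ x ∈ φ.source, ContMDiffAt (𝓡 m) 𝓘(ℝ, ℂ) ∞ g x) :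
    ContDiffOn ℝ ∞ (fun y => g (φ.symm y)) φ.target := by
  rw [← contMDiffOn_iff_contDiffOn]
  intro y hy
  have h1 := (contMDiffOn_symm_of_mem_maximalAtlas hφ) y hy
  exact (hg _ (φ.map_target hy)).comp_contMDiffWithinAt y h1

variable (T φ) in
/-- The components of a section in a trivialization, written in a chart. -/
def comp (f : ∀ x, E x) (i : Fin (Module.finrank ℂ F)) (y : EuclideanSpace ℝ (Fin m)) : ℂ :=
  coordAt T (φ.symm y) (f (φ.symm y)) i

theorem contDiffOn_comp (hφ : φ ∈ IsManifold.maximalAtlas (𝓡 m) ∞ X) (hT : φ.source ⊆ T.baseSet)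
    (s : SmoothSec m F E ⊤) (i : Fin (Module.finrank ℂ F)) :
    ContDiffOn ℝ ∞ (comp T φ (globalSec s) i) φ.target :=
  contDiffOn_comp_symm hφ (g := fun x => coordAt T x (globalSec s x) i) fun x hx =>
    (contMDiffAt_globalSec_iff _ (hT hx)).1 (globalSec_contMDiff s x) i

variable (T) in
/-- The smooth frame defined by a trivialization over a chart domain. -/
def frameSec (hT : φ.source ⊆ T.baseSet) (i : Fin (Module.finrank ℂ F)) :
    SmoothSec m F E (chartDom φ) :=
  ⟨fun x => frameAt T x i, fun x₀ => by
    refine (contMDiffAt_sec_iff (T := T) (fun x : chartDom φ => frameAt T (x : X) i)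
      (hT x₀.2)).2 fun j => ?_
    have : (fun x : chartDom φ => coordAt T (x : X) (frameAt T (x : X) i) j) =
        fun _ => (Pi.single i 1 : Fin (Module.finrank ℂ F) → ℂ) j := by
      funext x
      have := coordAt_sum (hT x.2) (Pi.single i 1 : Fin (Module.finrank ℂ F) → ℂ)
      rw [← this]
      simp [Pi.single_apply]
    rw [this]
    exact contMDiffAt_const⟩

theorem isFrame_frameSec (hT : φ.source ⊆ T.baseSet) : IsFrame (m := m) (frameSec T hT) := by
  intro x
  constructor
  · rw [Fintype.linearIndependent_iff]
    intro c hc i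
    have h := coordAt_sum (hT x.2) c
    have hc' : ∑ i, c i • frameAt T (x : X) i = 0 := hc
    rw [hc', map_zero] at h
    rw [← h]; rfl
  · intro v _
    rw [← sum_coordAt (hT x.2) v]
    exact Submodule.sum_mem _ fun i _ => Submodule.smul_mem _ _ (Submodule.subset_span ⟨i, rfl⟩)

open Classical in
variable (T φ) in
/-- The section with given components over a chart domain, extended by zero. -/
def secOfComp (c : Fin (Module.finrank ℂ F) → EuclideanSpace ℝ (Fin m) → ℂ) (x : X) : E x :=
  if x ∈ φ.source then ∑ i, c i (φ x) • frameAt T x i else 0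

variable {c : Fin (Module.finrank ℂ F) → EuclideanSpace ℝ (Fin m) → ℂ}

theorem secOfComp_of_notMem {x : X} (hx : x ∉ φ.source) : secOfComp T φ c x = 0 := if_neg hx

theorem coordAt_secOfComp (hT : φ.source ⊆ T.baseSet) {x : X} (hx : x ∈ φ.source)
    (i : Fin (Module.finrank ℂ F)) : coordAt T x (secOfComp T φ c x) i = c i (φ x) := by
  rw [secOfComp, if_pos hx, coordAt_sum (hT hx)]

theorem comp_secOfComp (hT : φ.source ⊆ T.baseSet) {y : EuclideanSpace ℝ (Fin m)}
    (hy : y ∈ φ.target) (i : Fin (Module.finrank ℂ F)) :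
    comp T φ (secOfComp T φ c) i y = c i y := by
  rw [comp, coordAt_secOfComp hT (φ.map_target hy), φ.right_inv hy]

theorem secOfComp_comp (hT : φ.source ⊆ T.baseSet) {f : ∀ x, E x} {x : X} (hx : x ∈ φ.source) :
    secOfComp T φ (comp T φ f) x = f x := by
  refine coordAt_injective (hT hx) (funext fun i => ?_)
  rw [coordAt_secOfComp hT hx, comp, φ.left_inv hx]

theorem secOfComp_eq_zero {x : X} (h : ∀ i, c i (φ x) = 0) : secOfComp T φ c x = 0 := by
  simp [secOfComp, h]

theorem isCompact_symm_image {K : Set (EuclideanSpace ℝ (Fin m))} (hK : IsCompact K)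
    (hKt : K ⊆ φ.target) : IsCompact (φ.symm '' K) :=
  hK.image_of_continuousOn (φ.continuousOn_symm.mono hKt)

theorem symm_image_subset {K : Set (EuclideanSpace ℝ (Fin m))} (hKt : K ⊆ φ.target) :
    φ.symm '' K ⊆ φ.source := by
  rintro _ ⟨y, hy, rfl⟩
  exact φ.map_target (hKt hy)

theorem secOfComp_eq_zero_of_notMem {K : Set (EuclideanSpace ℝ (Fin m))}
    (hc : ∀ i y, y ∉ K → c i y = 0) {x : X} (hx : x ∉ φ.symm '' K) : secOfComp T φ c x = 0 := by
  by_cases hxs : x ∈ φ.source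
  · refine secOfComp_eq_zero fun i => hc i _ fun h => hx ⟨φ x, h, φ.left_inv hxs⟩
  · exact secOfComp_of_notMem hxs

theorem exists_compact_of_isTest {ι : Type*} [Finite ι] {Ω : Set (EuclideanSpace ℝ (Fin m))}
    {c : ι → EuclideanSpace ℝ (Fin m) → ℂ} (hc : ∀ i, IsTest Ω (c i)) :
    ∃ K, IsCompact K ∧ K ⊆ Ω ∧ ∀ i y, y ∉ K → c i y = 0 :=
  ⟨⋃ i, tsupport (c i), isCompact_iUnion fun i => (hc i).compact,
    Set.iUnion_subset fun i => (hc i).subset, fun i _ hy =>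
    image_eq_zero_of_notMem_tsupport fun h => hy (Set.mem_iUnion_of_mem i h)⟩

theorem contMDiff_secOfComp [T2Space X] (hφ : φ ∈ IsManifold.maximalAtlas (𝓡 m) ∞ X)
    (hT : φ.source ⊆ T.baseSet) (hc : ∀ i, IsTest φ.target (c i)) :
    ContMDiff (𝓡 m) ((𝓡 m).prod 𝓘(ℝ, F)) ∞
      fun x : X => TotalSpace.mk' F x (secOfComp T φ c x) := by
  intro x₀
  by_cases hx₀ : x₀ ∈ φ.source
  · refine (contMDiffAt_globalSec_iff _ (hT hx₀)).2 fun i => ?_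
    have h1 : ContMDiffAt (𝓡 m) 𝓘(ℝ, ℂ) ∞ (fun x => c i (φ x)) x₀ :=
      (hc i).smooth.contMDiff.contMDiffAt.comp x₀
        ((contMDiffOn_of_mem_maximalAtlas hφ).contMDiffAt (φ.open_source.mem_nhds hx₀))
    refine h1.congr_of_eventuallyEq ?_
    filter_upwards [φ.open_source.mem_nhds hx₀] with x hx
    exact coordAt_secOfComp hT hx i
  -- Outside the chart domain, the support of the components pulls back to a compact, hence closed,
  -- subset of the Hausdorff space X, so the section vanishes near the point.
  · obtain ⟨K, hK, hKt, hK0⟩ := exists_compact_of_isTest hc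
    have hx₀K : x₀ ∉ φ.symm '' K := fun h => hx₀ (symm_image_subset hKt h)
    refine (contMDiffAt_globalSec_iff (T := trivializationAt F E x₀) _
      (mem_baseSet_trivializationAt F E x₀)).2 fun i => ?_
    refine (contMDiffAt_const (c := (0 : ℂ))).congr_of_eventuallyEq ?_
    filter_upwards [(isCompact_symm_image hK hKt).isClosed.isOpen_compl.mem_nhds hx₀K] with x hx
    rw [secOfComp_eq_zero_of_notMem hK0 hx, map_zero]; rfl

/-- A chart around a given point whose domain lies in given neighbourhoods. -/
theorem exists_chart_subset {N : Set X} {x₀ : X} (hN : N ∈ 𝓝 x₀) :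
    ∃ φ ∈ IsManifold.maximalAtlas (𝓡 m) ∞ X, x₀ ∈ φ.source ∧ φ.source ⊆ N := by
  obtain ⟨V, hVN, hV, hxV⟩ := mem_nhds_iff.1 hN
  refine ⟨(chartAt (EuclideanSpace ℝ (Fin m)) x₀).restr V,
    restr_mem_maximalAtlas _ (IsManifold.chart_mem_maximalAtlas x₀) hV, ?_, ?_⟩
  · rw [OpenPartialHomeomorph.restr_source' _ _ hV]
    exact ⟨mem_chart_source _ x₀, hxV⟩
  · rw [OpenPartialHomeomorph.restr_source' _ _ hV]
    exact Set.inter_subset_right.trans hVN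

end Charts

end Coordinates

/-! ### Borel sections -/

section Borel

variable {m : ℕ} {X : Type*} [TopologicalSpace X] [ChartedSpace (EuclideanSpace ℝ (Fin m)) X]
  [SecondCountableTopology X] [MeasurableSpace X] [BorelSpace X]
variable {F : Type*} [NormedAddCommGroup F] [NormedSpace ℂ F] [FiniteDimensional ℂ F]
variable {E : X → Type*} [∀ x, AddCommGroup (E x)] [∀ x, Module ℂ (E x)]
  [∀ x, TopologicalSpace (E x)] [TopologicalSpace (TotalSpace F E)]
  [FiberBundle F E] [VectorBundle ℂ F E]

theorem IsBorelSection.measurable_coordAt {f : ∀ x, E x} (hf : IsBorelSection F f)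
    (T : Trivialization F (π F E)) [MemTrivializationAtlas T] (i : Fin (Module.finrank ℂ F)) :
    Measurable fun x : T.baseSet => coordAt T (x : X) (f x) i := by
  refine measurable_of_isOpen fun O hO => ?_
  have hl : Continuous fun v : F => (Module.finBasis ℂ F).equivFun v i :=
    (LinearMap.toContinuousLinearMap ((LinearMap.proj i).comp
      (Module.finBasis ℂ F).equivFun.toLinearMap) : F →L[ℂ] ℂ).continuous
  have hopen : IsOpen (T.source ∩ T ⁻¹' (Prod.snd ⁻¹' ((fun v : F =>
      (Module.finBasis ℂ F).equivFun v i) ⁻¹' O))) :=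
    T.continuousOn.isOpen_inter_preimage T.open_source ((hO.preimage hl).preimage continuous_snd)
  have h1 : MeasurableSet ((fun x => TotalSpace.mk' F x (f x)) ⁻¹' (T.source ∩ T ⁻¹' (Prod.snd ⁻¹'
      ((fun v : F => (Module.finBasis ℂ F).equivFun v i) ⁻¹' O)))) := by
    let : MeasurableSpace (TotalSpace F E) := borel _
    have : BorelSpace (TotalSpace F E) := ⟨rfl⟩
    exact hf hopen.measurableSet
  convert measurable_subtype_coe h1 using 1
  ext ⟨x, hx⟩
  simp only [Set.mem_preimage, Set.mem_inter_iff, T.mem_source, hx, true_and]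
  rw [coordAt, LinearMap.comp_apply, T.coe_linearMapAt_of_mem hx]
  rfl

/-- Over each neighbourhood the section depends continuously on its measurable coordinates; second
countability reduces the cover to a countable one. -/
theorem isBorelSection_of_locally {f : ∀ x, E x}
    (h : ∀ x₀ : X, ∃ N, IsOpen N ∧ x₀ ∈ N ∧ ∃ (T : Trivialization F (π F E))
      (_ : MemTrivializationAtlas T), N ⊆ T.baseSet ∧
        ∀ i, Measurable fun x : N => coordAt T (x : X) (f x) i) : IsBorelSection F f := by
  let : MeasurableSpace (TotalSpace F E) := borel _
  have : BorelSpace (TotalSpace F E) := ⟨rfl⟩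
  choose N hN hxN T hT hNT hm using h
  obtain ⟨s, hs, hsU⟩ := TopologicalSpace.countable_cover_nhds fun x => (hN x).mem_nhds (hxN x)
  have key : ∀ x₀, Measurable fun x : N x₀ => TotalSpace.mk' F (x : X) (f x) := by
    intro x₀
    have := hT x₀
    have hG : Continuous fun z : N x₀ × (Fin (Module.finrank ℂ F) → ℂ) =>
        (T x₀).toOpenPartialHomeomorph.symm
          ((z.1 : X), ∑ i, z.2 i • Module.finBasis ℂ F i) := by
      refine (T x₀).toOpenPartialHomeomorph.continuousOn_symm.comp_continuous (by fun_prop) ?_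
      intro z
      exact (T x₀).mem_target.2 (hNT x₀ z.1.2)
    have hm' : Measurable fun x : N x₀ => (x, coordAt (T x₀) (x : X) (f x)) :=
      measurable_id.prodMk (measurable_pi_iff.2 (hm x₀))
    convert hG.measurable.comp hm' using 1
    funext x
    simp only [Function.comp]
    rw [← linearMapAt_eq_sum, (T x₀).coe_linearMapAt_of_mem (hNT x₀ x.2)]
    exact ((T x₀).symm_apply_mk_proj ((T x₀).mem_source.2 (hNT x₀ x.2))).symm
  intro O hO
  have : (fun x => TotalSpace.mk' F x (f x)) ⁻¹' O =
      ⋃ x₀ ∈ s, Subtype.val '' ((fun x : N x₀ => TotalSpace.mk' F (x : X) (f x)) ⁻¹' O) := by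
    ext x
    simp only [Set.mem_preimage, Set.mem_iUnion, Set.mem_image, Subtype.exists, exists_and_right,
      exists_eq_right, exists_prop]
    constructor
    · intro hx
      have : x ∈ ⋃ x₀ ∈ s, N x₀ := hsU ▸ Set.mem_univ x
      simp only [Set.mem_iUnion, exists_prop] at this
      obtain ⟨x₀, hx₀, hxx₀⟩ := this
      exact ⟨⟨x₀, hx₀, hxx₀⟩, hx⟩
    · rintro ⟨-, hx⟩
      exact hx
  rw [this]
  exact MeasurableSet.biUnion hs fun x₀ _ => (hN x₀).measurableSet.subtype_image (key x₀ hO)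

theorem isBorelSection_of_coordAt {f : ∀ x, E x}
    (h : ∀ (T : Trivialization F (π F E)) [MemTrivializationAtlas T] (i : Fin (Module.finrank ℂ F)),
      Measurable fun x : T.baseSet => coordAt T (x : X) (f x) i) : IsBorelSection F f :=
  isBorelSection_of_locally fun x₀ => ⟨(trivializationAt F E x₀).baseSet,
    (trivializationAt F E x₀).open_baseSet, mem_baseSet_trivializationAt F E x₀,
    trivializationAt F E x₀, inferInstance, subset_rfl, fun i => h _ i⟩

theorem IsBorelSection.add {f g : ∀ x, E x} (hf : IsBorelSection F f) (hg : IsBorelSection F g) :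
    IsBorelSection F fun x => f x + g x :=
  isBorelSection_of_coordAt fun T _ i => by
    simp only [map_add, Pi.add_apply]
    exact (hf.measurable_coordAt T i).add (hg.measurable_coordAt T i)

theorem IsBorelSection.smul {f : ∀ x, E x} (hf : IsBorelSection F f) {χ : X → ℂ}
    (hχ : Measurable χ) : IsBorelSection F fun x => χ x • f x :=
  isBorelSection_of_coordAt fun T _ i => by
    simp only [map_smul, Pi.smul_apply, smul_eq_mul]
    exact (hχ.comp measurable_subtype_coe).mul (hf.measurable_coordAt T i)

theorem IsBorelSection.sub {f g : ∀ x, E x} (hf : IsBorelSection F f) (hg : IsBorelSection F g) :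
    IsBorelSection F fun x => f x - g x :=
  isBorelSection_of_coordAt fun T _ i => by
    simp only [map_sub, Pi.sub_apply]
    exact (hf.measurable_coordAt T i).sub (hg.measurable_coordAt T i)

theorem IsBorelSection.sum {ι : Type*} (s : Finset ι) {f : ι → ∀ x, E x}
    (hf : ∀ i ∈ s, IsBorelSection F (f i)) : IsBorelSection F fun x => ∑ i ∈ s, f i x :=
  isBorelSection_of_coordAt fun T _ j => by
    simp only [map_sum, Finset.sum_apply]
    exact Finset.measurable_fun_sum s fun i hi => (hf i hi).measurable_coordAt T j

theorem IsBorelSection.of_eventuallyEq {f : ∀ x, E x}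
    (h : ∀ x₀, ∃ g : ∀ x, E x, IsBorelSection F g ∧ ∀ᶠ x in 𝓝 x₀, f x = g x) :
    IsBorelSection F f := by
  refine isBorelSection_of_locally fun x₀ => ?_
  obtain ⟨g, hg, he⟩ := h x₀
  obtain ⟨W, hWe, hW, hxW⟩ := eventually_nhds_iff.1 he
  set T := trivializationAt F E x₀
  refine ⟨W ∩ T.baseSet, hW.inter T.open_baseSet, ⟨hxW, mem_baseSet_trivializationAt F E x₀⟩, T,
    inferInstance, Set.inter_subset_right, fun i => ?_⟩
  have h1 := (hg.measurable_coordAt T i).comp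
    (measurable_subtype_coe.subtype_mk (h := fun x : ↥(W ∩ T.baseSet) => x.2.2))
  convert h1 using 1
  funext x
  simp only [Function.comp]
  rw [hWe x x.2.1]

theorem SmoothSec.isBorelSection (s : SmoothSec m F E ⊤) : IsBorelSection F (globalSec s) := by
  let : MeasurableSpace (TotalSpace F E) := borel _
  have : BorelSpace (TotalSpace F E) := ⟨rfl⟩
  exact (globalSec_contMDiff s).continuous.measurable

theorem isBorelSection_secOfComp [T2Space X] {T : Trivialization F (π F E)}
    [MemTrivializationAtlas T] {φ : OpenPartialHomeomorph X (EuclideanSpace ℝ (Fin m))}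
    [IsManifold (𝓡 m) ∞ X] [IsSmoothComplexBundle m F E]
    (hT : φ.source ⊆ T.baseSet) {c : Fin (Module.finrank ℂ F) → EuclideanSpace ℝ (Fin m) → ℂ}
    (hc : ∀ i, Measurable (c i)) {K : Set (EuclideanSpace ℝ (Fin m))} (hK : IsCompact K)
    (hKt : K ⊆ φ.target) (h0 : ∀ i y, y ∉ K → c i y = 0) :
    IsBorelSection F (secOfComp T φ c) := by
  refine isBorelSection_of_locally fun x₀ => ?_
  by_cases hx₀ : x₀ ∈ φ.source
  · refine ⟨φ.source, φ.open_source, hx₀, T, inferInstance, hT, fun i => ?_⟩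
    have : (fun x : φ.source => coordAt T (x : X) (secOfComp T φ c x) i) =
        fun x : φ.source => c i (φ x) := funext fun x => coordAt_secOfComp hT x.2 i
    rw [this]
    exact (hc i).comp (continuousOn_iff_continuous_domRestrict.1 φ.continuousOn).measurable
  · have hx₀K : x₀ ∉ φ.symm '' K := fun h => hx₀ (symm_image_subset hKt h)
    set T' := trivializationAt F E x₀
    refine ⟨(φ.symm '' K)ᶜ ∩ T'.baseSet,
      (isCompact_symm_image hK hKt).isClosed.isOpen_compl.inter T'.open_baseSet,
      ⟨hx₀K, mem_baseSet_trivializationAt F E x₀⟩, T', inferInstance, Set.inter_subset_right,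
      fun i => ?_⟩
    have : (fun x : ↥((φ.symm '' K)ᶜ ∩ T'.baseSet) => coordAt T' (x : X) (secOfComp T φ c x) i) =
        fun _ => 0 := funext fun x => by
      rw [secOfComp_eq_zero_of_notMem h0 x.2.1, map_zero]; rfl
    rw [this]
    exact measurable_const

theorem IsBorelSection.aemeasurable_coordAt {f : ∀ x, E x} (hf : IsBorelSection F f)
    (T : Trivialization F (π F E)) [MemTrivializationAtlas T] (i : Fin (Module.finrank ℂ F))
    (μ : Measure X) {S : Set X} (hS : S ⊆ T.baseSet) :
    AEMeasurable (fun x => coordAt T x (f x) i) (μ.restrict S) :=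
  (aemeasurable_restrict_of_measurable_subtype T.open_baseSet.measurableSet
    (hf.measurable_coordAt T i)).mono_measure (Measure.restrict_mono hS le_rfl)

end Borel

/-! ### Hermitian structures -/

section Hermitian

variable {m : ℕ} {X : Type*} [TopologicalSpace X] [ChartedSpace (EuclideanSpace ℝ (Fin m)) X]
variable {F : Type*} [NormedAddCommGroup F] [NormedSpace ℂ F]
variable {E : X → Type*} [∀ x, AddCommGroup (E x)] [∀ x, Module ℂ (E x)]
  [∀ x, TopologicalSpace (E x)] [TopologicalSpace (TotalSpace F E)]
  [FiberBundle F E] [VectorBundle ℂ F E]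

namespace HermitianStructure

variable (h : HermitianStructure m F E) {x : X}

/-- The inner product space structure of a fibre. -/
@[reducible] def core (x : X) : InnerProductSpace.Core ℂ (E x) where
  inner v w := h.inner x v w
  conj_inner_symm v w := h.conj_symm x w v
  re_inner_nonneg v := by
    rcases eq_or_ne v 0 with rfl | hv
    · simp
    · exact (h.pos x v hv).le
  add_left u v w := by simp
  smul_left u v c := by simp
  definite v hv := by
    by_contra hne
    have := h.pos x v hne
    rw [show h.inner x v v = 0 from hv] at this
    simp at this

theorem norm_nonneg (v : E x) : 0 ≤ h.norm x v := Real.sqrt_nonneg _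

/-- `h.norm x` is by definition the norm of the inner product space `h.core x`, so inner product
space theory applies to each fibre. -/
theorem norm_add_le (v w : E x) : h.norm x (v + w) ≤ h.norm x v + h.norm x w := by
  let := (h.core x).toNormedAddCommGroup
  exact _root_.norm_add_le v w

theorem norm_smul (c : ℂ) (v : E x) : h.norm x (c • v) = ‖c‖ * h.norm x v := by
  let := (h.core x).toNormedAddCommGroup
  let := InnerProductSpace.ofCore (h.core x).toCore
  exact _root_.norm_smul c v

theorem norm_inner_le (v w : E x) : ‖h.inner x v w‖ ≤ h.norm x v * h.norm x w := by
  let := (h.core x).toNormedAddCommGroup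
  let := InnerProductSpace.ofCore (h.core x).toCore
  exact _root_.norm_inner_le_norm (𝕜 := ℂ) v w

@[simp] theorem norm_zero : h.norm x 0 = 0 := by simp [norm]

theorem norm_sum_le {ι : Type*} (s : Finset ι) (v : ι → E x) :
    h.norm x (∑ i ∈ s, v i) ≤ ∑ i ∈ s, h.norm x (v i) := by
  let := (h.core x).toNormedAddCommGroup
  exact _root_.norm_sum_le s v

theorem eq_zero_of_inner_self {v : E x} (hv : h.inner x v v = 0) : v = 0 :=
  (h.core x).definite v hv

end HermitianStructure

end Hermitian

/-! ### Gram matrices of local frames -/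

section Gram

variable {m : ℕ} {X : Type*} [TopologicalSpace X] [ChartedSpace (EuclideanSpace ℝ (Fin m)) X]
  [IsManifold (𝓡 m) ∞ X]
variable {F : Type*} [NormedAddCommGroup F] [NormedSpace ℂ F] [FiniteDimensional ℂ F]
variable {E : X → Type*} [∀ x, AddCommGroup (E x)] [∀ x, Module ℂ (E x)]
  [∀ x, TopologicalSpace (E x)] [TopologicalSpace (TotalSpace F E)]
  [FiberBundle F E] [VectorBundle ℂ F E] [IsSmoothComplexBundle m F E]
variable {T : Trivialization F (π F E)} [MemTrivializationAtlas T]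
variable {φ : OpenPartialHomeomorph X (EuclideanSpace ℝ (Fin m))}
variable (h : HermitianStructure m F E)

local notation "𝔼" => EuclideanSpace ℝ (Fin m)

variable (T φ) in
/-- The Gram matrix of the frame defined by a trivialization, written in a chart. -/
def gram (y : 𝔼) : Matrix (Fin (Module.finrank ℂ F)) (Fin (Module.finrank ℂ F)) ℂ :=
  Matrix.of fun i j => h.inner (φ.symm y) (frameAt T _ i) (frameAt T _ j)

theorem inner_eq_sum {x : X} (hx : x ∈ T.baseSet) (v w : E x) :
    h.inner x v w = ∑ i, ∑ j, (starRingEnd ℂ) (coordAt T x v i) * coordAt T x w j *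
      h.inner x (frameAt T x i) (frameAt T x j) := by
  conv_lhs => rw [← sum_coordAt hx v, ← sum_coordAt hx w]
  simp only [map_sum, LinearMap.sum_apply, map_smulₛₗ, LinearMap.smul_apply, smul_eq_mul,
    RingHom.id_apply, Finset.mul_sum, mul_assoc]
  rw [Finset.sum_comm]
  exact Finset.sum_congr rfl fun i _ => Finset.sum_congr rfl fun j _ => by ring

theorem contDiffOn_gram (hφ : φ ∈ IsManifold.maximalAtlas (𝓡 m) ∞ X)
    (hT : φ.source ⊆ T.baseSet) (i j : Fin (Module.finrank ℂ F)) :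
    ContDiffOn ℝ ∞ (fun y => gram T φ h y i j) φ.target := by
  refine contDiffOn_comp_symm hφ (g := fun x => h.inner x (frameAt T x i) (frameAt T x j))
    fun x hx => ?_
  have := h.smooth (chartDom φ) (frameSec T hT i) (frameSec T hT j) ⟨x, hx⟩
  exact (contMDiffAt_subtype_iff (U := chartDom φ) (x := ⟨x, hx⟩)
    (f := fun x => h.inner x (frameAt T x i) (frameAt T x j))).1 this

/-- A kernel vector of the Gram matrix gives a combination of frame vectors orthogonal to every
frame vector, hence to itself, hence zero by positivity. -/
theorem det_gram_ne_zero (hT : φ.source ⊆ T.baseSet) {y : 𝔼} (hy : y ∈ φ.target) :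
    (gram T φ h y).det ≠ 0 := by
  have hx := hT (φ.map_target hy)
  intro h0
  obtain ⟨z, hz, hz0⟩ := Matrix.exists_mulVec_eq_zero_iff.2 h0
  set v : E (φ.symm y) := ∑ i, z i • frameAt T _ i with hv
  have h1 : ∀ i, h.inner (φ.symm y) (frameAt T _ i) v = 0 := by
    intro i
    have := congrFun hz0 i
    simp only [Matrix.mulVec, dotProduct, gram, Matrix.of_apply, Pi.zero_apply] at this
    rw [hv, map_sum, ← this]
    simp only [map_smul, smul_eq_mul, mul_comm]
  have h2 : h.inner (φ.symm y) v v = 0 := by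
    have h4 : ∀ w, h.inner (φ.symm y) (∑ i, z i • frameAt T _ i) w =
        ∑ i, (starRingEnd ℂ) (z i) * h.inner (φ.symm y) (frameAt T _ i) w := fun w => by
      simp only [map_sum, LinearMap.sum_apply, map_smulₛₗ, LinearMap.smul_apply, smul_eq_mul]
    rw [hv, h4, ← hv]
    exact Finset.sum_eq_zero fun i _ => by rw [h1, mul_zero]
  have h3 := h.eq_zero_of_inner_self h2
  apply hz
  rw [← coordAt_sum hx z, ← hv, h3, map_zero]

theorem contDiffOn_det {Ω : Set 𝔼} {n : Type*} [Fintype n] [DecidableEq n]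
    {M : 𝔼 → Matrix n n ℂ} (hM : ∀ i j, ContDiffOn ℝ ∞ (fun y => M y i j) Ω) :
    ContDiffOn ℝ ∞ (fun y => (M y).det) Ω := by
  simp only [Matrix.det_apply]
  exact ContDiffOn.sum fun σ _ => (contDiffOn_prod fun i _ => hM _ _).const_smul _

/-- Cramer's rule: adjugate entries are determinants with smooth entries, divided by a determinant
without zeros. -/
theorem contDiffOn_gram_inv (hφ : φ ∈ IsManifold.maximalAtlas (𝓡 m) ∞ X)
    (hT : φ.source ⊆ T.baseSet) (i j : Fin (Module.finrank ℂ F)) :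
    ContDiffOn ℝ ∞ (fun y => (gram T φ h y)⁻¹ i j) φ.target := by
  have h1 := contDiffOn_det fun i j => contDiffOn_gram h hφ hT i j
  have h2 : ContDiffOn ℝ ∞ (fun y => (gram T φ h y).adjugate i j) φ.target := by
    simp only [Matrix.adjugate_apply]
    refine contDiffOn_det fun k l => ?_
    simp only [Matrix.updateRow_apply]
    split_ifs
    · exact contDiffOn_const
    · exact contDiffOn_gram h hφ hT k l
  simp only [Matrix.inv_def, Matrix.smul_apply, Ring.inverse_eq_inv', smul_eq_mul]
  exact (h1.inv fun y hy => det_gram_ne_zero h hT hy).mul h2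

theorem gram_inv_mul (hT : φ.source ⊆ T.baseSet) {y : 𝔼} (hy : y ∈ φ.target)
    (i l : Fin (Module.finrank ℂ F)) :
    ∑ j, (gram T φ h y)⁻¹ i j * gram T φ h y j l = if i = l then 1 else 0 := by
  have := congrFun (congrFun (Matrix.nonsing_inv_mul (gram T φ h y)
    (isUnit_iff_ne_zero.2 (det_gram_ne_zero h hT hy))) i) l
  rwa [Matrix.mul_apply, Matrix.one_apply] at this

theorem IsTest.conj {Ω : Set 𝔼} {θ : 𝔼 → ℂ} (hθ : IsTest Ω θ) :
    IsTest Ω fun y => (starRingEnd ℂ) (θ y) := by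
  have hs : Function.support (fun y => (starRingEnd ℂ) (θ y)) = Function.support θ := by
    ext y; simp
  refine ⟨Complex.conjCLE.contDiff.comp hθ.smooth, ?_, ?_⟩
  · rw [HasCompactSupport, tsupport, hs]; exact hθ.compact
  · rw [tsupport, hs]; exact hθ.subset

theorem contDiffOn_ofReal {Ω : Set 𝔼} {ρ : 𝔼 → ℝ} (hρ : ContDiffOn ℝ ∞ ρ Ω) :
    ContDiffOn ℝ ∞ (fun y => (ρ y : ℂ)) Ω := Complex.ofRealCLM.contDiff.comp_contDiffOn hρ

/-- The smooth section `η` represents the local functional `v ↦ ∑ᵢ θᵢ vᵢ` on components, with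
respect to the Hermitian structure and the density `ρ`. -/
def Represents (T : Trivialization F (π F E)) [MemTrivializationAtlas T]
    (φ : OpenPartialHomeomorph X 𝔼) (h : HermitianStructure m F E) (ρ : 𝔼 → ℝ)
    (η : SmoothSec m F E ⊤) (θ : Fin (Module.finrank ℂ F) → 𝔼 → ℂ) : Prop :=
  (∀ x, x ∉ φ.source → globalSec η x = 0) ∧ ∀ x ∈ φ.source, ∀ v : E x,
    (ρ (φ x) : ℂ) * h.inner x (globalSec η x) v = ∑ i, θ i (φ x) * coordAt T x v i

/-- A smooth Riesz representation: the components of η solve a linear system whose matrix is ρ times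
the Gram matrix. It turns Euclidean test vectors into test sections and supplies formal adjoints. -/
theorem exists_represents [T2Space X] (hφ : φ ∈ IsManifold.maximalAtlas (𝓡 m) ∞ X)
    (hT : φ.source ⊆ T.baseSet) {ρ : 𝔼 → ℝ} (hρ : ContDiffOn ℝ ∞ ρ φ.target)
    (hρ0 : ∀ y ∈ φ.target, 0 < ρ y) {θ : Fin (Module.finrank ℂ F) → 𝔼 → ℂ}
    (hθ : ∀ i, IsTest φ.target (θ i)) :
    ∃ η : SmoothSec m F E ⊤, HasCompactSupp (globalSec η) ∧ Represents T φ h ρ η θ := by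
  have hρi : ContDiffOn ℝ ∞ (fun y => (ρ y : ℂ)⁻¹) φ.target :=
    (contDiffOn_ofReal hρ).inv fun y hy => by exact_mod_cast (hρ0 y hy).ne'
  -- The conjugation compensates the conjugate linearity of the Hermitian structure in its first
  -- variable.
  set c : Fin (Module.finrank ℂ F) → 𝔼 → ℂ := fun j y =>
    (starRingEnd ℂ) (∑ i, (ρ y : ℂ)⁻¹ * ((gram T φ h y)⁻¹ i j * θ i y)) with hc
  have hct : ∀ j, IsTest φ.target (c j) := fun j => IsTest.conj (IsTest.sum _ fun i _ =>
    ((hθ i).mul φ.open_target (contDiffOn_gram_inv h hφ hT i j)).mul φ.open_target hρi)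
  obtain ⟨K, hK, hKt, hK0⟩ := exists_compact_of_isTest hct
  refine ⟨secOfSmooth (secOfComp T φ c) (contMDiff_secOfComp hφ hT hct),
    ⟨φ.symm '' K, isCompact_symm_image hK hKt, fun x hx => secOfComp_eq_zero_of_notMem hK0 hx⟩,
    fun x hx => secOfComp_of_notMem hx, fun x hx v => ?_⟩
  have hy := φ.map_source hx
  change (ρ (φ x) : ℂ) * h.inner x (secOfComp T φ c x) v = _
  have hρx : (ρ (φ x) : ℂ) ≠ 0 := by exact_mod_cast (hρ0 _ hy).ne'
  rw [inner_eq_sum h (hT hx), Finset.sum_comm, Finset.mul_sum]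
  refine Finset.sum_congr rfl fun l _ => ?_
  have e1 : ∀ j, (starRingEnd ℂ) (coordAt T x (secOfComp T φ c x) j) =
      ∑ i, (ρ (φ x) : ℂ)⁻¹ * ((gram T φ h (φ x))⁻¹ i j * θ i (φ x)) := fun j => by
    rw [coordAt_secOfComp hT hx, hc, Complex.conj_conj]
  have e2 : ∀ j, h.inner x (frameAt T x j) (frameAt T x l) = gram T φ h (φ x) j l := fun j => by
    simp only [gram, Matrix.of_apply]
    rw [φ.left_inv hx]
  simp only [e1, e2]
  calc (ρ (φ x) : ℂ) * ∑ j, (∑ i, (ρ (φ x) : ℂ)⁻¹ * ((gram T φ h (φ x))⁻¹ i j * θ i (φ x))) *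
        coordAt T x v l * gram T φ h (φ x) j l
      = ∑ i, θ i (φ x) * coordAt T x v l *
          ∑ j, (gram T φ h (φ x))⁻¹ i j * gram T φ h (φ x) j l := by
        simp only [Finset.mul_sum, Finset.sum_mul]
        rw [Finset.sum_comm]
        refine Finset.sum_congr rfl fun i _ => Finset.sum_congr rfl fun j _ => ?_
        field_simp
    _ = θ l (φ x) * coordAt T x v l := by
        simp only [gram_inv_mul h hT hy, mul_ite, mul_one, mul_zero, Finset.sum_ite_eq',
          Finset.mem_univ, if_true]

theorem exists_represented (hφ : φ ∈ IsManifold.maximalAtlas (𝓡 m) ∞ X)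
    (hT : φ.source ⊆ T.baseSet) {ρ : 𝔼 → ℝ} (hρ : ContDiffOn ℝ ∞ ρ φ.target)
    {ψ : SmoothSec m F E ⊤} {K : Set 𝔼} (hK : IsCompact K) (hKt : K ⊆ φ.target)
    (hψ : ∀ x, x ∉ φ.symm '' K → globalSec ψ x = 0) :
    ∃ θ : Fin (Module.finrank ℂ F) → 𝔼 → ℂ, (∀ i, IsTest φ.target (θ i)) ∧
      Represents T φ h ρ ψ θ := by
  -- The functional of ψ has coefficients controlled only on the chart target; κ, equal to 1 near
  -- the support of ψ, makes them test functions.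
  obtain ⟨κ, hκ, W, -, hKW, hκ1⟩ := exists_isTest_eq_one φ.open_target hK hKt
  refine ⟨fun i y => (∑ l, (ρ y : ℂ) * ((starRingEnd ℂ) (comp T φ (globalSec ψ) l y) *
    gram T φ h y l i)) * κ y, fun i => hκ.mul φ.open_target (ContDiffOn.sum fun l _ =>
      (contDiffOn_ofReal hρ).mul ((Complex.conjCLE.contDiff.comp_contDiffOn
        (contDiffOn_comp hφ hT ψ l)).mul (contDiffOn_gram h hφ hT l i))),
    fun x hx => hψ x fun h => hx (symm_image_subset hKt h), fun x hx v => ?_⟩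
  by_cases hxK : x ∈ φ.symm '' K
  · have hκx : κ (φ x) = 1 := by
      obtain ⟨y, hy, rfl⟩ := hxK
      rw [φ.right_inv (hKt hy)]
      exact hκ1 y (hKW hy)
    rw [inner_eq_sum h (hT hx), Finset.sum_comm, Finset.mul_sum]
    refine Finset.sum_congr rfl fun i _ => ?_
    have e2 : ∀ j, h.inner x (frameAt T x j) (frameAt T x i) = gram T φ h (φ x) j i := fun j => by
      simp only [gram, Matrix.of_apply]
      rw [φ.left_inv hx]
    have e3 : ∀ l, comp T φ (globalSec ψ) l (φ x) = coordAt T x (globalSec ψ x) l := fun l => by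
      simp only [comp]
      rw [φ.left_inv hx]
    simp only [hκx, mul_one, e2, e3, Finset.mul_sum, Finset.sum_mul]
    exact Finset.sum_congr rfl fun l _ => by ring
  · have e3 : ∀ l, comp T φ (globalSec ψ) l (φ x) = 0 := fun l => by
      simp only [comp]
      rw [φ.left_inv hx, hψ x hxK, map_zero]; rfl
    simp [hψ x hxK, e3]

theorem exists_bound_of_continuousOn {ι : Type*} [Finite ι] {K : Set 𝔼} (hK : IsCompact K)
    {g : ι → 𝔼 → ℂ} (hg : ∀ i, ContinuousOn (g i) K) :
    ∃ C : ℝ, 0 ≤ C ∧ ∀ i, ∀ y ∈ K, ‖g i y‖ ≤ C := by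
  cases nonempty_fintype ι
  choose C hC using fun i => hK.exists_bound_of_continuousOn (hg i)
  refine ⟨∑ i, |C i|, Finset.sum_nonneg fun i _ => abs_nonneg _, fun i y hy => ?_⟩
  exact (hC i y hy).trans ((le_abs_self _).trans
    (Finset.single_le_sum (f := fun i => |C i|) (fun i _ => abs_nonneg _) (Finset.mem_univ i)))

/-- On compact subsets of a chart domain, the fibre norms are equivalent to the norms of the
components. -/
theorem exists_norm_equiv (hφ : φ ∈ IsManifold.maximalAtlas (𝓡 m) ∞ X)
    (hT : φ.source ⊆ T.baseSet) {K : Set 𝔼} (hK : IsCompact K) (hKt : K ⊆ φ.target) :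
    ∃ C : ℝ, 0 ≤ C ∧ ∀ y ∈ K, ∀ v : E (φ.symm y),
      (∀ i, ‖coordAt T (φ.symm y) v i‖ ≤ C * h.norm _ v) ∧
      h.norm _ v ≤ C * ∑ i, ‖coordAt T (φ.symm y) v i‖ := by
  obtain ⟨C₁, hC₁0, hC₁⟩ := exists_bound_of_continuousOn hK fun i =>
    ((contDiffOn_gram h hφ hT i i).continuousOn.mono hKt)
  obtain ⟨C₂, hC₂0, hC₂⟩ := exists_bound_of_continuousOn hK
    (ι := Fin (Module.finrank ℂ F) × Fin (Module.finrank ℂ F))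
    (g := fun ij y => (gram T φ h y)⁻¹ ij.1 ij.2) fun ij =>
    ((contDiffOn_gram_inv h hφ hT ij.1 ij.2).continuousOn.mono hKt)
  have hframe : ∀ y ∈ K, ∀ i, h.norm (φ.symm y) (frameAt T _ i) ≤ √C₁ := fun y hy i =>
    Real.sqrt_le_sqrt ((Complex.re_le_norm _).trans (hC₁ i y hy))
  -- Coordinates are recovered from the products ⟨e_j, v⟩ by the inverse Gram matrix: its entries
  -- are at most `C₂`, and by Cauchy–Schwarz each product is at most `√C₁` times the norm of v.
  set D := ∑ _j : Fin (Module.finrank ℂ F), C₂ * √C₁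
  have hD : 0 ≤ D := Finset.sum_nonneg fun _ _ => by positivity
  refine ⟨max D √C₁, le_max_of_le_left hD, fun y hy v => ⟨fun i => ?_, ?_⟩⟩
  · have hx := hT (φ.map_target (hKt hy))
    have e : coordAt T (φ.symm y) v i =
        ∑ j, (gram T φ h y)⁻¹ i j * h.inner (φ.symm y) (frameAt T _ j) v := by
      have e1 : ∀ j, h.inner (φ.symm y) (frameAt T _ j) v =
          ∑ l, gram T φ h y j l * coordAt T (φ.symm y) v l := fun j => by
        conv_lhs => rw [← sum_coordAt hx v, map_sum]
        simp only [map_smul, smul_eq_mul, gram, Matrix.of_apply, mul_comm]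
      simp only [e1, Finset.mul_sum, ← mul_assoc]
      rw [Finset.sum_comm]
      simp only [← Finset.sum_mul, gram_inv_mul h hT (hKt hy), ite_mul, one_mul, zero_mul,
        Finset.sum_ite_eq, Finset.mem_univ, if_true]
    rw [e]
    calc ‖∑ j, (gram T φ h y)⁻¹ i j * h.inner (φ.symm y) (frameAt T _ j) v‖
        ≤ ∑ _j : Fin (Module.finrank ℂ F), C₂ * √C₁ * h.norm _ v := by
          refine (norm_sum_le _ _).trans (Finset.sum_le_sum fun j _ => ?_)
          rw [norm_mul, mul_assoc]
          refine mul_le_mul (hC₂ (i, j) y hy) ((h.norm_inner_le _ _).trans ?_) (norm_nonneg _) hC₂0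
          exact mul_le_mul_of_nonneg_right (hframe y hy j) (h.norm_nonneg _)
      _ = D * h.norm _ v := by rw [← Finset.sum_mul]
      _ ≤ _ := mul_le_mul_of_nonneg_right (le_max_left _ _) (h.norm_nonneg _)
  · have hx := hT (φ.map_target (hKt hy))
    conv_lhs => rw [← sum_coordAt hx v]
    refine (h.norm_sum_le _ _).trans ?_
    rw [Finset.mul_sum]
    refine Finset.sum_le_sum fun i _ => ?_
    rw [h.norm_smul, mul_comm]
    exact mul_le_mul_of_nonneg_right ((hframe y hy i).trans (le_max_right _ _)) (norm_nonneg _)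

end Gram

/-! ### Smooth measures in charts -/

section SmoothMeasure

variable {m : ℕ} {X : Type*} [TopologicalSpace X] [ChartedSpace (EuclideanSpace ℝ (Fin m)) X]
  [IsManifold (𝓡 m) ∞ X] [MeasurableSpace X] [BorelSpace X]
variable {μ : Measure X} {φ : OpenPartialHomeomorph X (EuclideanSpace ℝ (Fin m))}
variable {ρ : EuclideanSpace ℝ (Fin m) → ℝ}

local notation "𝔼" => EuclideanSpace ℝ (Fin m)

/-- `ρ` is the smooth density of `μ` in the chart `φ`. -/
structure IsDensity (μ : Measure X) (φ : OpenPartialHomeomorph X 𝔼) (ρ : 𝔼 → ℝ) : Prop where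
  smooth : ContDiffOn ℝ ∞ ρ φ.target
  pos : ∀ y ∈ φ.target, 0 < ρ y
  apply : ∀ A : Set X, MeasurableSet A → A ⊆ φ.source →
    μ A = ∫⁻ y in φ '' A, ENNReal.ofReal (ρ y)

theorem IsSmoothMeasure.exists_isDensity (hμ : IsSmoothMeasure (m := m) μ)
    (hφ : φ ∈ IsManifold.maximalAtlas (𝓡 m) ∞ X) : ∃ ρ, IsDensity μ φ ρ := by
  obtain ⟨ρ, h1, h2, h3⟩ := hμ φ hφ
  exact ⟨ρ, h1, h2, h3⟩

namespace IsDensity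

theorem aemeasurable_symm {S : Set 𝔼} (hSm : MeasurableSet S) (hS : S ⊆ φ.target)
    (ρ : 𝔼 → ℝ) :
    AEMeasurable φ.symm ((volume.restrict S).withDensity fun y => ENNReal.ofReal (ρ y)) :=
  ((φ.continuousOn_symm.mono hS).aemeasurable hSm).mono_ac (withDensity_absolutelyContinuous _ _)

theorem restrict_symm_image (h : IsDensity μ φ ρ) {S : Set 𝔼} (hSm : MeasurableSet S)
    (hS : S ⊆ φ.target) (hS' : MeasurableSet (φ.symm '' S)) :
    μ.restrict (φ.symm '' S) =
      ((volume.restrict S).withDensity fun y => ENNReal.ofReal (ρ y)).map φ.symm := by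
  ext A hA
  rw [Measure.restrict_apply hA, Measure.map_apply_of_aemeasurable (aemeasurable_symm hSm hS ρ) hA,
    withDensity_apply', Measure.restrict_restrict' hSm, h.apply _ (hA.inter hS')
      (Set.inter_subset_right.trans (symm_image_subset hS))]
  congr 2
  ext y
  constructor
  · rintro ⟨_, ⟨hxA, z, hz, rfl⟩, rfl⟩
    rw [φ.right_inv (hS hz)]
    exact ⟨hxA, hz⟩
  · rintro ⟨hyA, hy⟩
    exact ⟨φ.symm y, ⟨hyA, y, hy, rfl⟩, φ.right_inv (hS hy)⟩

theorem restrict_source (h : IsDensity μ φ ρ) :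
    μ.restrict φ.source =
      ((volume.restrict φ.target).withDensity fun y => ENNReal.ofReal (ρ y)).map φ.symm := by
  have e : φ.symm '' φ.target = φ.source := φ.symm.image_source_eq_target
  have := h.restrict_symm_image φ.open_target.measurableSet subset_rfl
    (e ▸ φ.open_source.measurableSet)
  rwa [e] at this

theorem aestronglyMeasurable_ofReal (h : IsDensity μ φ ρ) :
    AEMeasurable (fun y => Real.toNNReal (ρ y)) (volume.restrict φ.target) :=
  (h.smooth.continuousOn.aemeasurable φ.open_target.measurableSet).real_toNNReal

theorem integral_eq (h : IsDensity μ φ ρ) {Φ : X → ℂ}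
    (hΦ : AEStronglyMeasurable Φ (μ.restrict φ.source)) (hΦ0 : ∀ x ∉ φ.source, Φ x = 0)
    {Ψ : 𝔼 → ℂ} (hΨ : ∀ y ∈ φ.target, (ρ y : ℂ) * Φ (φ.symm y) = Ψ y)
    (hΨ0 : ∀ y ∉ φ.target, Ψ y = 0) : ∫ x, Φ x ∂μ = ∫ y, Ψ y := by
  rw [← setIntegral_eq_integral_of_forall_compl_eq_zero hΦ0,
    ← setIntegral_eq_integral_of_forall_compl_eq_zero hΨ0, h.restrict_source,
    integral_map (aemeasurable_symm φ.open_target.measurableSet subset_rfl ρ)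
      (h.restrict_source ▸ hΦ)]
  have := integral_withDensity_eq_integral_smul₀ h.aestronglyMeasurable_ofReal
    (fun y => Φ (φ.symm y))
  refine this.trans (setIntegral_congr_fun φ.open_target.measurableSet fun y hy => ?_)
  rw [← hΨ y hy, NNReal.smul_def, Real.coe_toNNReal _ (h.pos y hy).le]
  exact Complex.real_smul

/-- A continuous positive density is bounded above and away from zero on a compact set. -/
theorem exists_measure_equiv (h : IsDensity μ φ ρ) {K : Set 𝔼} (hK : IsCompact K)
    (hKt : K ⊆ φ.target) :
    ∃ C : ℝ≥0∞, C ≠ ⊤ ∧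
      (volume.restrict K).withDensity (fun y => ENNReal.ofReal (ρ y)) ≤ C • volume.restrict K ∧
      volume.restrict K ≤ C • (volume.restrict K).withDensity (fun y => ENNReal.ofReal (ρ y)) := by
  have hc := h.smooth.continuousOn.mono hKt
  obtain ⟨C₁, hC₁⟩ := hK.exists_bound_of_continuousOn hc
  obtain ⟨C₂, hC₂⟩ := hK.exists_bound_of_continuousOn (hc.inv₀ fun y hy => (h.pos y (hKt hy)).ne')
  refine ⟨max (ENNReal.ofReal C₁) (ENNReal.ofReal C₂), by simp, ?_, ?_⟩
  · rw [← withDensity_const]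
    refine withDensity_mono ((ae_restrict_iff' hK.measurableSet).2 (ae_of_all _ fun y hy => ?_))
    exact le_max_of_le_left (ENNReal.ofReal_le_ofReal ((Real.le_norm_self _).trans (hC₁ y hy)))
  · have hm : AEMeasurable (fun y => ENNReal.ofReal (ρ y)) (volume.restrict K) :=
      (hc.aemeasurable hK.measurableSet).ennreal_ofReal
    rw [← withDensity_smul' _ _ (by simp)]
    conv_lhs => rw [← withDensity_one (μ := volume.restrict K)]
    refine withDensity_mono ((ae_restrict_iff' hK.measurableSet).2 (ae_of_all _ fun y hy => ?_))
    have hy0 := h.pos y (hKt hy)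
    calc (1 : ℝ≥0∞) = ENNReal.ofReal ((ρ y)⁻¹ * ρ y) := by
          rw [inv_mul_cancel₀ hy0.ne', ENNReal.ofReal_one]
      _ = ENNReal.ofReal (ρ y)⁻¹ * ENNReal.ofReal (ρ y) :=
          ENNReal.ofReal_mul (inv_nonneg.2 hy0.le)
      _ ≤ _ := mul_le_mul_left ((ENNReal.ofReal_le_ofReal
          ((Real.le_norm_self _).trans (hC₂ y hy))).trans (le_max_right _ _)) _

theorem exists_eLpNorm_equiv [T2Space X] (h : IsDensity μ φ ρ) {p : ℝ≥0∞} (hp1 : 1 ≤ p)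
    (hp : p ≠ ⊤) {K : Set 𝔼}
    (hK : IsCompact K) (hKt : K ⊆ φ.target) :
    ∃ C : ℝ≥0∞, C ≠ ⊤ ∧ ∀ N : X → ℝ, AEStronglyMeasurable N (μ.restrict (φ.symm '' K)) →
      eLpNorm N p (μ.restrict (φ.symm '' K)) ≤
        C * eLpNorm (fun y => N (φ.symm y)) p (volume.restrict K) ∧
      eLpNorm (fun y => N (φ.symm y)) p (volume.restrict K) ≤
        C * eLpNorm N p (μ.restrict (φ.symm '' K)) := by
  obtain ⟨C, hC, h1, h2⟩ := h.exists_measure_equiv hK hKt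
  have hp0 : p ≠ 0 := (zero_lt_one.trans_le hp1).ne'
  have hres := h.restrict_symm_image hK.measurableSet hKt
    (isCompact_symm_image hK hKt).measurableSet
  refine ⟨C ^ (1 / p).toReal, ENNReal.rpow_ne_top_of_nonneg (by positivity) hC, fun N hN => ?_⟩
  rw [hres] at hN ⊢
  rw [eLpNorm_map_measure hN (aemeasurable_symm hK.measurableSet hKt ρ)]
  constructor
  · refine (eLpNorm_mono_measure _ h1).trans ?_
    rw [eLpNorm_smul_measure_of_ne_top hp, smul_eq_mul]
    rfl
  · refine (eLpNorm_mono_measure _ h2).trans ?_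
    rw [eLpNorm_smul_measure_of_ne_top hp, smul_eq_mul]
    rfl

end IsDensity

theorem IsSmoothMeasure.isLocallyFiniteMeasure [T2Space X]
    (hμ : IsSmoothMeasure (m := m) μ) :
    IsLocallyFiniteMeasure μ := by
  refine ⟨fun x => ?_⟩
  set φ := chartAt 𝔼 x
  obtain ⟨ρ, hρ⟩ := hμ.exists_isDensity (IsManifold.chart_mem_maximalAtlas (I := 𝓡 m) (n := ∞) x)
  have hx : x ∈ φ.source := mem_chart_source _ x
  obtain ⟨K, hK, hxK, hKt⟩ := exists_compact_subset φ.open_target (φ.map_source hx)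
  refine ⟨φ.symm '' K, ?_, ?_⟩
  · have : φ.source ∩ φ ⁻¹' K ∈ 𝓝 x := inter_mem (φ.open_source.mem_nhds hx)
      ((φ.continuousAt hx).preimage_mem_nhds (mem_interior_iff_mem_nhds.1 hxK))
    refine mem_of_superset this ?_
    rintro z ⟨hz, hzK⟩
    exact ⟨φ z, hzK, φ.left_inv hz⟩
  · obtain ⟨C, hC, h1, -⟩ := hρ.exists_measure_equiv hK hKt
    have hm := (isCompact_symm_image hK hKt).measurableSet
    rw [← Measure.restrict_apply_self, hρ.restrict_symm_image hK.measurableSet hKt hm,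
      Measure.map_apply_of_aemeasurable (IsDensity.aemeasurable_symm hK.measurableSet hKt ρ) hm]
    refine (h1 _).trans_lt ?_
    rw [Measure.smul_apply, smul_eq_mul]
    refine ENNReal.mul_lt_top hC.lt_top ((measure_mono (Set.subset_univ _)).trans_lt ?_)
    rw [Measure.restrict_apply_univ]
    exact hK.measure_lt_top

end SmoothMeasure

/-! ### Integrals and norms of sections -/

section SectionIntegrals

variable {m : ℕ} {X : Type*} [TopologicalSpace X] [T2Space X] [SecondCountableTopology X]
  [ChartedSpace (EuclideanSpace ℝ (Fin m)) X] [IsManifold (𝓡 m) ∞ X]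
  [MeasurableSpace X] [BorelSpace X] {μ : Measure X}
variable {F : Type*} [NormedAddCommGroup F] [NormedSpace ℂ F] [FiniteDimensional ℂ F]
variable {E : X → Type*} [∀ x, AddCommGroup (E x)] [∀ x, Module ℂ (E x)]
  [∀ x, TopologicalSpace (E x)] [TopologicalSpace (TotalSpace F E)]
  [FiberBundle F E] [VectorBundle ℂ F E] [IsSmoothComplexBundle m F E]
variable {T : Trivialization F (π F E)} [MemTrivializationAtlas T]
variable {φ : OpenPartialHomeomorph X (EuclideanSpace ℝ (Fin m))}
variable {ρ : EuclideanSpace ℝ (Fin m) → ℝ}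

local notation "𝔼" => EuclideanSpace ℝ (Fin m)

theorem exists_countable_charts {N : X → Set X} (hN : ∀ x, N x ∈ 𝓝 x) :
    ∃ s : Set X, s.Countable ∧ ∃ φ : X → OpenPartialHomeomorph X 𝔼,
      (∀ x, φ x ∈ IsManifold.maximalAtlas (𝓡 m) ∞ X) ∧ (∀ x, (φ x).source ⊆ N x) ∧
      ⋃ x ∈ s, (φ x).source = Set.univ := by
  choose φ hφ hx hs using fun x => exists_chart_subset (m := m) (hN x)
  obtain ⟨s, hs1, hs2⟩ := TopologicalSpace.countable_cover_nhds
    fun x => (φ x).open_source.mem_nhds (hx x)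
  exact ⟨s, hs1, φ, hφ, hs, hs2⟩

theorem IsBorelSection.aemeasurable_comp {f : ∀ x, E x} (hf : IsBorelSection F f)
    (hT : φ.source ⊆ T.baseSet) (i : Fin (Module.finrank ℂ F)) :
    AEMeasurable (comp T φ f i) (volume.restrict φ.target) := by
  refine aemeasurable_restrict_of_measurable_subtype φ.open_target.measurableSet ?_
  have hc : Continuous fun y : φ.target =>
      (⟨φ.symm y, hT (φ.map_target y.2)⟩ : T.baseSet) :=
    (continuousOn_iff_continuous_domRestrict.1 φ.continuousOn_symm).subtype_mk _
  have hm : Measurable ((fun x : T.baseSet => coordAt T (x : X) (f x) i) ∘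
      fun y : φ.target => (⟨φ.symm y, hT (φ.map_target y.2)⟩ : T.baseSet)) :=
    Measurable.comp (hf.measurable_coordAt T i) hc.measurable
  exact hm

namespace HermitianStructure

variable (h : HermitianStructure m F E)

/-- On each of countably many charts with a frame, the product is a finite sum of measurable
coordinates times continuous Gram entries. -/
theorem aemeasurable_inner {f g : ∀ x, E x} (hf : IsBorelSection F f) (hg : IsBorelSection F g)
    (μ : Measure X) : AEMeasurable (fun x => h.inner x (f x) (g x)) μ := by
  obtain ⟨s, hs, φ, hφ, hφs, hcov⟩ := exists_countable_charts (m := m) fun x : X =>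
    (trivializationAt F E x).open_baseSet.mem_nhds (mem_baseSet_trivializationAt F E x)
  have := hs.to_subtype
  rw [← Measure.restrict_univ (μ := μ), ← hcov, Set.biUnion_eq_iUnion, aemeasurable_iUnion_iff]
  rintro ⟨x₀, -⟩
  change AEMeasurable _ (μ.restrict (φ x₀).source)
  have hT := hφs x₀
  have h1 : AEMeasurable (fun x => ∑ i, ∑ j,
      (starRingEnd ℂ) (coordAt (trivializationAt F E x₀) x (f x) i) *
      coordAt (trivializationAt F E x₀) x (g x) j *
      h.inner x (frameAt (trivializationAt F E x₀) x i) (frameAt (trivializationAt F E x₀) x j))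
      (μ.restrict (φ x₀).source) := by
    refine Finset.aemeasurable_fun_sum _ fun i _ => Finset.aemeasurable_fun_sum _ fun j _ => ?_
    refine ((Complex.continuous_conj.measurable.comp_aemeasurable
      (hf.aemeasurable_coordAt _ i μ hT)).mul (hg.aemeasurable_coordAt _ j μ hT)).mul ?_
    refine ContinuousOn.aemeasurable (fun x hx => ContinuousAt.continuousWithinAt ?_)
      (φ x₀).open_source.measurableSet
    have := h.smooth (chartDom (φ x₀)) (frameSec _ hT i) (frameSec _ hT j) ⟨x, hx⟩
    exact ((contMDiffAt_subtype_iff (U := chartDom (φ x₀)) (x := ⟨x, hx⟩)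
      (f := fun x => h.inner x (frameAt _ x i) (frameAt _ x j))).1 this).continuousAt
  refine h1.congr ((ae_restrict_iff' (φ x₀).open_source.measurableSet).2
    (ae_of_all _ fun x hx => (inner_eq_sum h (hT hx) _ _).symm))

theorem aemeasurable_norm {f : ∀ x, E x} (hf : IsBorelSection F f) (μ : Measure X) :
    AEMeasurable (fun x => h.norm x (f x)) μ :=
  (Complex.measurable_re.comp_aemeasurable (h.aemeasurable_inner hf hf μ)).sqrt

theorem memLp_norm {p : ℝ≥0∞} {f : ∀ x, E x} (hf : h.MemLpSection p μ f) :
    MemLp (fun x => h.norm x (f x)) p μ :=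
  ⟨(h.aemeasurable_norm hf.1 μ).aestronglyMeasurable, hf.2⟩

theorem continuous_norm (s : SmoothSec m F E ⊤) : Continuous fun x => h.norm x (globalSec s x) := by
  have h1 : Continuous fun x => h.inner x (globalSec s x) (globalSec s x) := by
    refine continuous_iff_continuousAt.2 fun x => ?_
    exact ((contMDiffAt_subtype_iff (U := (⊤ : Opens X)) (x := ⟨x, trivial⟩)
      (f := fun x => h.inner x (globalSec s x) (globalSec s x))).1
        (h.smooth ⊤ s s ⟨x, trivial⟩)).continuousAt
  exact (Complex.continuous_re.comp h1).sqrt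

theorem lpNorm_add_le {p : ℝ≥0∞} (hp1 : 1 ≤ p) {f g : ∀ x, E x} (hf : IsBorelSection F f)
    (hg : IsBorelSection F g) :
    h.lpNorm p μ (fun x => f x + g x) ≤ h.lpNorm p μ f + h.lpNorm p μ g := by
  have h1 := eLpNorm_add_le (h.aemeasurable_norm hf μ).aestronglyMeasurable
    (h.aemeasurable_norm hg μ).aestronglyMeasurable hp1
  refine le_trans (eLpNorm_mono fun x => ?_) h1
  rw [Real.norm_of_nonneg (h.norm_nonneg _), Pi.add_apply, Real.norm_of_nonneg
    (add_nonneg (h.norm_nonneg _) (h.norm_nonneg _))]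
  exact h.norm_add_le _ _

theorem lpNorm_congr_ae {p : ℝ≥0∞} {f g : ∀ x, E x} (hfg : ∀ᵐ x ∂μ, f x = g x) :
    h.lpNorm p μ f = h.lpNorm p μ g :=
  eLpNorm_congr_ae (by filter_upwards [hfg] with x hx; rw [hx])

theorem MemLpSection.add {h : HermitianStructure m F E} {p : ℝ≥0∞} (hp1 : 1 ≤ p) {f g : ∀ x, E x}
    (hf : h.MemLpSection p μ f) (hg : h.MemLpSection p μ g) :
    h.MemLpSection p μ fun x => f x + g x :=
  ⟨hf.1.add hg.1, (h.lpNorm_add_le hp1 hf.1 hg.1).trans_lt (ENNReal.add_lt_top.2 ⟨hf.2, hg.2⟩)⟩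

/-- By Cauchy–Schwarz the integrand is dominated by a constant times the norm of f on a compact set
of finite measure, where L^p embeds in L^1. -/
theorem integrable_inner [IsLocallyFiniteMeasure μ] {p : ℝ≥0∞} (hp1 : 1 ≤ p)
    {s : SmoothSec m F E ⊤} (hs : HasCompactSupp (globalSec s))
    {f : ∀ x, E x} (hf : h.MemLpSection p μ f) :
    Integrable (fun x => h.inner x (globalSec s x) (f x)) μ := by
  obtain ⟨K, hK, hK0⟩ := hs
  obtain ⟨C, hC⟩ := hK.exists_bound_of_continuousOn (h.continuous_norm s).continuousOn
  have hsupp : Function.support (fun x => h.inner x (globalSec s x) (f x)) ⊆ K := fun x hx => by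
    by_contra hxK
    exact hx (by simp [hK0 x hxK])
  rw [← integrableOn_iff_integrable_of_support_subset hsupp]
  have : IsFiniteMeasure (μ.restrict K) := ⟨by
    rw [Measure.restrict_apply_univ]; exact hK.measure_lt_top⟩
  have h1 : Integrable (fun x => h.norm x (f x)) (μ.restrict K) :=
    ((h.memLp_norm hf).restrict K).integrable hp1
  refine (h1.const_mul C).mono' ((h.aemeasurable_inner (SmoothSec.isBorelSection s) hf.1 _).aestronglyMeasurable)
    ((ae_restrict_iff' hK.measurableSet).2 (ae_of_all _ fun x hx => ?_))
  refine (h.norm_inner_le _ _).trans (mul_le_mul_of_nonneg_right ?_ (h.norm_nonneg _))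
  exact (Real.le_norm_self _).trans (hC x hx)

/-- Integrals against sections which represent functionals on components. -/
theorem integral_inner_eq (hρ : IsDensity μ φ ρ) {s : SmoothSec m F E ⊤}
    {θ : Fin (Module.finrank ℂ F) → 𝔼 → ℂ} (hθ : ∀ i, IsTest φ.target (θ i))
    (hs : Represents T φ h ρ s θ) {f : ∀ x, E x} (hf : IsBorelSection F f) :
    ∫ x, h.inner x (globalSec s x) (f x) ∂μ = ∫ y, ∑ i, θ i y * comp T φ f i y := by
  refine hρ.integral_eq (h.aemeasurable_inner (SmoothSec.isBorelSection s) hf _).aestronglyMeasurable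
    (fun x hx => by simp [hs.1 x hx]) (fun y hy => ?_) fun y hy =>
      Finset.sum_eq_zero fun i _ => by rw [(hθ i).eq_zero hy, zero_mul]
  have := hs.2 _ (φ.map_target hy) (f (φ.symm y))
  rw [φ.right_inv hy] at this
  exact this

theorem MemLpSection.memLpLoc_comp {h : HermitianStructure m F E} {p : ℝ≥0∞} (hp1 : 1 ≤ p)
    (hp : p ≠ ⊤) (hφ : φ ∈ IsManifold.maximalAtlas (𝓡 m) ∞ X) (hT : φ.source ⊆ T.baseSet)
    (hρ : IsDensity μ φ ρ) {f : ∀ x, E x} (hf : h.MemLpSection p μ f)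
    (i : Fin (Module.finrank ℂ F)) : MemLpLoc p φ.target (comp T φ f i) := by
  intro K hK hKt
  have hm : AEStronglyMeasurable (comp T φ f i) (volume.restrict K) :=
    ((hf.1.aemeasurable_comp hT i).mono_measure
      (Measure.restrict_mono hKt le_rfl)).aestronglyMeasurable
  obtain ⟨C, hC, hC'⟩ := hρ.exists_eLpNorm_equiv hp1 hp hK hKt
  obtain ⟨D, hD0, hD⟩ := exists_norm_equiv h hφ hT hK hKt
  refine ⟨hm, ?_⟩
  refine (eLpNorm_le_mul_eLpNorm_of_ae_le_mul (c := D) (g := fun y => h.norm _ (f (φ.symm y)))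
    ((ae_restrict_iff' hK.measurableSet).2 (ae_of_all _ fun y hy => ?_)) p).trans_lt ?_
  · rw [Real.norm_of_nonneg (h.norm_nonneg _)]
    exact (hD y hy _).1 i
  · refine ENNReal.mul_lt_top ENNReal.ofReal_lt_top
      (((hC' _ (h.aemeasurable_norm hf.1 _).aestronglyMeasurable).2).trans_lt
        (ENNReal.mul_lt_top hC.lt_top ?_))
    exact ((h.memLp_norm hf).restrict _).2

theorem exists_lpNorm_le (h : HermitianStructure m F E) {p : ℝ≥0∞} (hp1 : 1 ≤ p)
    (hp : p ≠ ⊤) (hφ : φ ∈ IsManifold.maximalAtlas (𝓡 m) ∞ X) (hT : φ.source ⊆ T.baseSet)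
    (hρ : IsDensity μ φ ρ) {K : Set 𝔼} (hK : IsCompact K) (hKt : K ⊆ φ.target) :
    ∃ C : ℝ≥0∞, C ≠ ⊤ ∧ ∀ f : ∀ x, E x, IsBorelSection F f → (∀ x ∉ φ.symm '' K, f x = 0) →
      h.lpNorm p μ f ≤ C * ∑ i, eLpNorm (comp T φ f i) p (volume.restrict K) := by
  obtain ⟨C, hC, hC'⟩ := hρ.exists_eLpNorm_equiv hp1 hp hK hKt
  obtain ⟨D, hD0, hD⟩ := exists_norm_equiv h hφ hT hK hKt
  refine ⟨C * ENNReal.ofReal D, ENNReal.mul_ne_top hC ENNReal.ofReal_ne_top, fun f hf hf0 => ?_⟩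
  have hm : ∀ i, AEStronglyMeasurable (comp T φ f i) (volume.restrict K) := fun i =>
    ((hf.aemeasurable_comp hT i).mono_measure
      (Measure.restrict_mono hKt le_rfl)).aestronglyMeasurable
  have h1 : h.lpNorm p μ f = eLpNorm (fun x => h.norm x (f x)) p (μ.restrict (φ.symm '' K)) := by
    refine (eLpNorm_restrict_eq_of_support_subset fun x hx => ?_).symm
    by_contra hxK
    exact hx (by simp [hf0 x hxK])
  rw [h1, mul_assoc]
  refine ((hC' _ (h.aemeasurable_norm hf _).aestronglyMeasurable).1).trans (mul_le_mul_right ?_ _)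
  refine (eLpNorm_le_mul_eLpNorm_of_ae_le_mul (c := D)
    (g := fun y => ∑ i, ‖comp T φ f i y‖)
    ((ae_restrict_iff' hK.measurableSet).2 (ae_of_all _ fun y hy => ?_)) p).trans
      (mul_le_mul_right ?_ _)
  · rw [Real.norm_of_nonneg (h.norm_nonneg _), Real.norm_of_nonneg
      (Finset.sum_nonneg fun _ _ => _root_.norm_nonneg _)]
    exact (hD y hy _).2
  · refine (le_of_eq ?_).trans ((eLpNorm_sum_le (s := Finset.univ)
      (fun i _ => (hm i).norm) hp1).trans (le_of_eq ?_))
    · congr 1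
      ext y
      rw [Finset.sum_apply]
    · simp only [eLpNorm_norm]

end HermitianStructure

end SectionIntegrals

/-! ### Formal adjoints in Euclidean space -/

section Adjoint

variable {m d d' k : ℕ} {p : ℝ≥0∞} {Ω : Set (EuclideanSpace ℝ (Fin m))}

local notation "𝔼" => EuclideanSpace ℝ (Fin m)

/-- The formal transpose of a matrix differential operator. -/
def adjExpr (k : ℕ) (b : (Fin m → ℕ) → Fin d → Fin d' → 𝔼 → ℂ) (θ : Fin d' → 𝔼 → ℂ)
    (i : Fin d) : 𝔼 → ℂ := fun y =>
  ∑ j, ∑ α ∈ multiIndices m k, (-1 : ℂ) ^ (∑ l, α l) * multiD α (fun y => b α i j y * θ j y) y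

variable {b : (Fin m → ℕ) → Fin d → Fin d' → EuclideanSpace ℝ (Fin m) → ℂ}

theorem isTest_adjExpr (hΩ : IsOpen Ω) (hb : ∀ α i j, ContDiffOn ℝ ∞ (b α i j) Ω)
    {θ : Fin d' → 𝔼 → ℂ} (hθ : ∀ j, IsTest Ω (θ j)) (i : Fin d) : IsTest Ω (adjExpr k b θ i) :=
  IsTest.sum _ fun j _ => IsTest.sum _ fun α _ =>
    (((hθ j).mul hΩ (hb α i j)).multiD α).mul_smooth contDiff_const

theorem integral_adjExpr_mul (hp1 : 1 ≤ p) (hΩ : IsOpen Ω)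
    (hb : ∀ α i j, ContDiffOn ℝ ∞ (b α i j) Ω) {θ : Fin d' → 𝔼 → ℂ} (hθ : ∀ j, IsTest Ω (θ j))
    {u : Fin d → 𝔼 → ℂ} (hu : ∀ i, MemLpLoc p Ω (u i)) :
    ∫ y, ∑ i, adjExpr k b θ i y * u i y = ∑ j, ∑ i, ∑ α ∈ multiIndices m k,
      (-1 : ℂ) ^ (∑ l, α l) * ∫ y, u i y * multiD α (fun y => b α i j y * θ j y) y := by
  have hi : ∀ i j α, Integrable fun y => (-1 : ℂ) ^ (∑ l, α l) *
      (u i y * multiD α (fun y => b α i j y * θ j y) y) := fun i j α =>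
    ((hu i).integrable_test hp1 (((hθ j).mul hΩ (hb α i j)).multiD α)).const_mul _
  have e : ∀ y, ∑ i, adjExpr k b θ i y * u i y = ∑ j, ∑ i, ∑ α ∈ multiIndices m k,
      (-1 : ℂ) ^ (∑ l, α l) * (u i y * multiD α (fun y => b α i j y * θ j y) y) := fun y => by
    rw [Finset.sum_comm]
    refine Finset.sum_congr rfl fun i _ => ?_
    simp only [adjExpr, Finset.sum_mul]
    exact Finset.sum_congr rfl fun j _ => Finset.sum_congr rfl fun α _ => by ring
  simp only [e]
  rw [integral_finsetSum _ fun j _ => integrable_finsetSum _ fun i _ =>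
    integrable_finsetSum _ fun α _ => hi i j α]
  refine Finset.sum_congr rfl fun j _ => ?_
  rw [integral_finsetSum _ fun i _ => integrable_finsetSum _ fun α _ => hi i j α]
  refine Finset.sum_congr rfl fun i _ => ?_
  rw [integral_finsetSum _ fun α _ => hi i j α]
  exact Finset.sum_congr rfl fun α _ => integral_const_mul _ _

theorem multiD_zero (α : Fin m → ℕ) : multiD α (fun _ : 𝔼 => (0 : ℂ)) = fun _ => 0 := by
  funext y
  have h : IsTest ∅ (fun _ : 𝔼 => (0 : ℂ)) := isTest_zero
  exact (h.multiD α).eq_zero (Set.notMem_empty y)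

/-- Transposition of the system. Vector-valued test functions are what a test section provides in a
chart; conversely, test vectors with one nonzero entry recover the scalar equations. -/
theorem weakEq_iff_adjExpr (hp1 : 1 ≤ p) (hΩ : IsOpen Ω)
    (hb : ∀ α i j, ContDiffOn ℝ ∞ (b α i j) Ω)
    {u : Fin d → 𝔼 → ℂ} (hu : ∀ i, MemLpLoc p Ω (u i)) {g : Fin d' → 𝔼 → ℂ}
    (hg : ∀ j, MemLpLoc p Ω (g j)) :
    (∀ j, WeakEq Ω k (fun α i => b α i j) u (g j)) ↔ ∀ θ : Fin d' → 𝔼 → ℂ,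
      (∀ j, IsTest Ω (θ j)) →
        ∫ y, ∑ i, adjExpr k b θ i y * u i y = ∫ y, ∑ j, θ j y * g j y := by
  classical
  have hgi : ∀ θ : Fin d' → 𝔼 → ℂ, (∀ j, IsTest Ω (θ j)) →
      ∫ y, ∑ j, θ j y * g j y = ∑ j, ∫ y, g j y * θ j y := fun θ hθ => by
    rw [integral_finsetSum]
    · simp only [mul_comm]
    · intro j _
      simpa only [mul_comm] using (hg j).integrable_test hp1 (hθ j)
  constructor
  · intro h θ hθ
    rw [integral_adjExpr_mul hp1 hΩ hb hθ hu, hgi θ hθ]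
    exact Finset.sum_congr rfl fun j _ => h j _ (hθ j)
  · intro h j θ hθ
    have hΘ : ∀ j', IsTest Ω (fun y => if j' = j then θ y else 0) := fun j' => by
      split_ifs
      · exact hθ
      · exact isTest_zero
    have := h (fun j' y => if j' = j then θ y else 0) hΘ
    rw [integral_adjExpr_mul hp1 hΩ hb hΘ hu, hgi _ hΘ, Finset.sum_eq_single j, Finset.sum_eq_single j]
      at this
    · simpa using this
    · intro j' _ hj'; simp [hj']
    · simp
    · intro j' _ hj'; simp [hj', multiD_zero]
    · simp

theorem ContinuousOn.memLpLoc {u : 𝔼 → ℂ} (hu : ContinuousOn u Ω) : MemLpLoc p Ω u := by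
  have h1 : MemLpLoc p Ω fun _ : 𝔼 => (1 : ℂ) := fun K hK _ => by
    have : IsFiniteMeasure (volume.restrict K) := ⟨by
      rw [Measure.restrict_apply_univ]; exact hK.measure_lt_top⟩
    exact memLp_const 1
  simpa using h1.mul hu

/-- The fundamental lemma of the calculus of variations; real test functions already suffice. -/
theorem ae_eq_of_integral_mul_test (hΩ : IsOpen Ω) (hp1 : 1 ≤ p) {u v : 𝔼 → ℂ}
    (hu : MemLpLoc p Ω u) (hv : MemLpLoc p Ω v)
    (h : ∀ θ, IsTest Ω θ → ∫ y, u y * θ y = ∫ y, v y * θ y) : ∀ᵐ y, y ∈ Ω → u y = v y := by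
  have hli : LocallyIntegrableOn (fun y => u y - v y) Ω := by
    rw [locallyIntegrableOn_iff hΩ.isLocallyClosed]
    intro K hKΩ hK
    have : IsFiniteMeasure (volume.restrict K) := ⟨by
      rw [Measure.restrict_apply_univ]; exact hK.measure_lt_top⟩
    exact ((hu K hK hKΩ).sub (hv K hK hKΩ)).integrable hp1
  suffices h0 : ∀ᵐ y, y ∈ Ω → u y - v y = 0 by
    filter_upwards [h0] with y hy hyΩ using sub_eq_zero.1 (hy hyΩ)
  refine hΩ.ae_eq_zero_of_integral_contDiff_smul_eq_zero hli fun g hg hgc hgs => ?_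
  have ht : IsTest Ω fun y => (g y : ℂ) := by
    have hs : Function.support (fun y => (g y : ℂ)) = Function.support g := by ext y; simp
    refine ⟨Complex.ofRealCLM.contDiff.comp hg, ?_, ?_⟩
    · rw [HasCompactSupport, tsupport, hs]; exact hgc
    · rw [tsupport, hs]; exact hgs
  have e : ∀ y, g y • (u y - v y) = u y * (g y : ℂ) - v y * (g y : ℂ) := fun y => by
    rw [Complex.real_smul]; ring
  simp only [e]
  rw [integral_sub (hu.integrable_test hp1 ht) (hv.integrable_test hp1 ht), h _ ht, sub_self]

end Adjoint

/-! ### Differential operators in charts -/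

section Operators

variable {m : ℕ} {X : Type*} [TopologicalSpace X] [T2Space X] [SecondCountableTopology X]
  [ChartedSpace (EuclideanSpace ℝ (Fin m)) X] [IsManifold (𝓡 m) ∞ X]
  [MeasurableSpace X] [BorelSpace X] {μ : Measure X}
variable {F : Type*} [NormedAddCommGroup F] [NormedSpace ℂ F] [FiniteDimensional ℂ F]
variable {E : X → Type*} [∀ x, AddCommGroup (E x)] [∀ x, Module ℂ (E x)]
  [∀ x, TopologicalSpace (E x)] [TopologicalSpace (TotalSpace F E)]
  [FiberBundle F E] [VectorBundle ℂ F E] [IsSmoothComplexBundle m F E]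
variable {G : Type*} [NormedAddCommGroup G] [NormedSpace ℂ G] [FiniteDimensional ℂ G]
variable {V : X → Type*} [∀ x, AddCommGroup (V x)] [∀ x, Module ℂ (V x)]
  [∀ x, TopologicalSpace (V x)] [TopologicalSpace (TotalSpace G V)]
  [FiberBundle G V] [VectorBundle ℂ G V] [IsSmoothComplexBundle m G V]
variable {T : Trivialization F (π F E)} [MemTrivializationAtlas T]
variable {T' : Trivialization G (π G V)} [MemTrivializationAtlas T']
variable {φ : OpenPartialHomeomorph X (EuclideanSpace ℝ (Fin m))}
variable {ρ : EuclideanSpace ℝ (Fin m) → ℝ} {k : ℕ} {p : ℝ≥0∞}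
variable {hE : HermitianStructure m F E} {hV : HermitianStructure m G V}
variable {P : SheafMorphism m F E G V}
variable {b : (Fin m → ℕ) → Fin (Module.finrank ℂ F) → Fin (Module.finrank ℂ G) →
  EuclideanSpace ℝ (Fin m) → ℂ}

local notation "𝔼" => EuclideanSpace ℝ (Fin m)

/-- In the chart `φ` and the trivializations `T`, `T'`, the operator `P` has the coefficients `b`. -/
structure IsLocalExpr (P : SheafMorphism m F E G V) (T : Trivialization F (π F E))
    [MemTrivializationAtlas T] (T' : Trivialization G (π G V)) [MemTrivializationAtlas T']
    (φ : OpenPartialHomeomorph X 𝔼) (k : ℕ)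
    (b : (Fin m → ℕ) → Fin (Module.finrank ℂ F) → Fin (Module.finrank ℂ G) → 𝔼 → ℂ) : Prop where
  smooth : ∀ α i j, ContDiffOn ℝ ∞ (b α i j) φ.target
  comp_app : ∀ (s : SmoothSec m F E ⊤) (j : Fin (Module.finrank ℂ G)), ∀ y ∈ φ.target,
    comp T' φ (globalSec (P.app ⊤ s)) j y =
      diffExpr k (fun α i => b α i j) (comp T φ (globalSec s)) y

theorem SheafMorphism.IsDiffOp.exists_isLocalExpr (hP : P.IsDiffOp k)
    (hφ : φ ∈ IsManifold.maximalAtlas (𝓡 m) ∞ X) (hT : φ.source ⊆ T.baseSet)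
    (hT' : φ.source ⊆ T'.baseSet) : ∃ b, IsLocalExpr P T T' φ k b := by
  obtain ⟨b, hb, h⟩ := hP φ hφ (frameSec T hT) (isFrame_frameSec hT) (frameSec T' hT')
    (isFrame_frameSec hT')
  refine ⟨b, hb, fun s j y hy => ?_⟩
  have h1 := h (comp T φ (globalSec s)) (contDiffOn_comp hφ hT s)
    -- The local formula concerns sections over the chart domain; compatibility of P with
    -- restriction transfers it to global sections.
    (restrictSec (W := chartDom φ) le_top s) (fun x => by
      have := secOfComp_comp (T := T) hT (f := globalSec s) x.2
      rw [secOfComp, if_pos (show (x : X) ∈ φ.source from x.2)] at this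
      exact this.symm) ⟨φ.symm y, φ.map_target hy⟩
  rw [P.app_restrict] at h1
  have h2 : globalSec (P.app ⊤ s) (φ.symm y) = ∑ j, (∑ i, ∑ α ∈ multiIndices m k,
      b α i j y * multiD α (comp T φ (globalSec s) i) y) • frameAt T' (φ.symm y) j := by
    refine h1.trans ?_
    simp only [φ.right_inv hy, Finset.sum_smul]
    rfl
  rw [comp, h2, coordAt_sum (hT' (φ.map_target hy))]
  rfl

/-- Sheaf morphisms are local. -/
theorem SheafMorphism.app_eq_zero (P : SheafMorphism m F E G V) {s : SmoothSec m F E ⊤} {U : Set X}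
    (hU : IsOpen U) (hs : ∀ x ∈ U, globalSec s x = 0) {x : X} (hx : x ∈ U) :
    globalSec (P.app ⊤ s) x = 0 := by
  have h0 : restrictSec (W := ⟨U, hU⟩) le_top s = 0 := Subtype.ext (funext fun x => hs x x.2)
  have h1 := P.app_restrict (W := ⟨U, hU⟩) le_top s
  rw [h0, map_zero] at h1
  exact (congrFun (congrArg Subtype.val h1) ⟨x, hx⟩).symm

/-- If ψ represents the test vector θ in the chart, a section representing the transposed expression
of θ is a formal adjoint image of ψ, by integration by parts against smooth components. -/
theorem IsLocalExpr.exists_isFormalAdjointOf (hb : IsLocalExpr P T T' φ k b)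
    (hφ : φ ∈ IsManifold.maximalAtlas (𝓡 m) ∞ X) (hT : φ.source ⊆ T.baseSet)
    (hρ : IsDensity μ φ ρ) {ψ : SmoothSec m G V ⊤}
    {θ : Fin (Module.finrank ℂ G) → 𝔼 → ℂ} (hθ : ∀ j, IsTest φ.target (θ j))
    (hψ : Represents T' φ hV ρ ψ θ) :
    ∃ η : SmoothSec m F E ⊤, IsFormalAdjointOf μ hE hV P ψ η ∧
      Represents T φ hE ρ η (adjExpr k b θ) := by
  have hadj := isTest_adjExpr (k := k) φ.open_target hb.smooth hθ
  obtain ⟨η, hη, hηr⟩ := exists_represents hE hφ hT hρ.smooth hρ.pos hadj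
  refine ⟨η, ⟨hη, fun s => ?_⟩, hηr⟩
  rw [hE.integral_inner_eq hρ hadj hηr (SmoothSec.isBorelSection s),
    hV.integral_inner_eq hρ hθ hψ (SmoothSec.isBorelSection (P.app ⊤ s))]
  have hs := contDiffOn_comp hφ hT s
  have hd : ∀ j, ContDiffOn ℝ ∞
      (diffExpr k (fun α i => b α i j) (comp T φ (globalSec s))) φ.target := fun j =>
    ContDiffOn.sum fun i _ => ContDiffOn.sum fun α _ => (hb.smooth α i j).mul (by
      rw [multiD_eq_wordD]; exact contDiffOn_wordD φ.open_target (hs i) _)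
  -- Both sides have components continuous on the chart target, so any exponent would do; p = 1 is
  -- chosen.
  rw [(weakEq_iff_adjExpr (p := 1) (k := k) le_rfl φ.open_target hb.smooth
    (fun i => ContinuousOn.memLpLoc (hs i).continuousOn)
    (fun j => ContinuousOn.memLpLoc (hd j).continuousOn)).1
    (fun j => weakEq_diffExpr φ.open_target (fun α i => hb.smooth α i j) hs) θ hθ]
  refine integral_congr_ae (ae_of_all _ fun y => Finset.sum_congr rfl fun j _ => ?_)
  by_cases hy : y ∈ φ.target
  · simp only [hb.comp_app s j y hy]
  · simp only [(hθ j).eq_zero hy, zero_mul]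

/-- Every test vector on the chart target is represented by a global test section with an explicit
adjoint, so the global definition can be tested with it. -/
theorem IsDistribImage.weakEq (hp1 : 1 ≤ p) (hp : p ≠ ⊤) (hb : IsLocalExpr P T T' φ k b)
    (hφ : φ ∈ IsManifold.maximalAtlas (𝓡 m) ∞ X) (hT : φ.source ⊆ T.baseSet)
    (hT' : φ.source ⊆ T'.baseSet) (hρ : IsDensity μ φ ρ) {f : ∀ x, E x} {g : ∀ x, V x}
    (hf : hE.MemLpSection p μ f) (hg : hV.MemLpSection p μ g)
    (h : IsDistribImage μ hE hV P f g) (j : Fin (Module.finrank ℂ G)) :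
    WeakEq φ.target k (fun α i => b α i j) (comp T φ f) (comp T' φ g j) := by
  revert j
  refine (weakEq_iff_adjExpr hp1 φ.open_target hb.smooth (hf.memLpLoc_comp hp1 hp hφ hT hρ)
    (hg.memLpLoc_comp hp1 hp hφ hT' hρ)).2 fun θ hθ => ?_
  obtain ⟨ψ, hψ, hψr⟩ := exists_represents hV hφ hT' hρ.smooth hρ.pos hθ
  obtain ⟨η, hη, hηr⟩ := hb.exists_isFormalAdjointOf (hE := hE) hφ hT hρ hθ hψr
  have := h ψ hψ η hη
  rwa [hE.integral_inner_eq hρ (isTest_adjExpr φ.open_target hb.smooth hθ) hηr hf.1,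
    hV.integral_inner_eq hρ hθ hψr hg.1] at this

end Operators

/-! ### Distributional images -/

section DistribImage

variable {m : ℕ} {X : Type*} [TopologicalSpace X] [T2Space X] [SecondCountableTopology X]
  [ChartedSpace (EuclideanSpace ℝ (Fin m)) X] [IsManifold (𝓡 m) ∞ X]
  [MeasurableSpace X] [BorelSpace X] {μ : Measure X}
variable {F : Type*} [NormedAddCommGroup F] [NormedSpace ℂ F] [FiniteDimensional ℂ F]
variable {E : X → Type*} [∀ x, AddCommGroup (E x)] [∀ x, Module ℂ (E x)]
  [∀ x, TopologicalSpace (E x)] [TopologicalSpace (TotalSpace F E)]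
  [FiberBundle F E] [VectorBundle ℂ F E] [IsSmoothComplexBundle m F E]
variable {G : Type*} [NormedAddCommGroup G] [NormedSpace ℂ G] [FiniteDimensional ℂ G]
variable {V : X → Type*} [∀ x, AddCommGroup (V x)] [∀ x, Module ℂ (V x)]
  [∀ x, TopologicalSpace (V x)] [TopologicalSpace (TotalSpace G V)]
  [FiberBundle G V] [VectorBundle ℂ G V] [IsSmoothComplexBundle m G V]
variable {T : Trivialization F (π F E)} [MemTrivializationAtlas T]
variable {T' : Trivialization G (π G V)} [MemTrivializationAtlas T']
variable {φ : OpenPartialHomeomorph X (EuclideanSpace ℝ (Fin m))}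
variable {ρ : EuclideanSpace ℝ (Fin m) → ℝ} {k : ℕ} {p : ℝ≥0∞}
variable {hE : HermitianStructure m F E} {hV : HermitianStructure m G V}
variable {P : SheafMorphism m F E G V}
variable {b : (Fin m → ℕ) → Fin (Module.finrank ℂ F) → Fin (Module.finrank ℂ G) →
  EuclideanSpace ℝ (Fin m) → ℂ}

local notation "𝔼" => EuclideanSpace ℝ (Fin m)

theorem globalSec_sub (s t : SmoothSec m F E ⊤) (x : X) :
    globalSec (s - t) x = globalSec s x - globalSec t x := rfl

theorem HasCompactSupp.sub {f g : ∀ x, E x} (hf : HasCompactSupp f) (hg : HasCompactSupp g) :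
    HasCompactSupp fun x => f x - g x := by
  obtain ⟨K, hK, hK0⟩ := hf
  obtain ⟨L, hL, hL0⟩ := hg
  refine ⟨K ∪ L, hK.union hL, fun x hx => ?_⟩
  change f x - g x = 0
  rw [hK0 x fun h => hx (Or.inl h), hL0 x fun h => hx (Or.inr h), sub_zero]

theorem HermitianStructure.memLpSection_of_smooth [IsLocallyFiniteMeasure μ]
    (h : HermitianStructure m F E) (p : ℝ≥0∞) {s : SmoothSec m F E ⊤}
    (hs : HasCompactSupp (globalSec s)) : h.MemLpSection p μ (globalSec s) := by
  obtain ⟨K, hK, hK0⟩ := hs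
  have hc : HasCompactSupport fun x => h.norm x (globalSec s x) :=
    HasCompactSupport.intro hK fun x hx => by rw [hK0 x hx, h.norm_zero]
  have : IsFiniteMeasureOnCompacts μ := inferInstance
  exact ⟨SmoothSec.isBorelSection s,
    ((h.continuous_norm s).memLp_of_hasCompactSupport hc (μ := μ) (p := p)).2⟩

theorem exists_globalSec_eq_secOfComp (hφ : φ ∈ IsManifold.maximalAtlas (𝓡 m) ∞ X)
    (hT : φ.source ⊆ T.baseSet) {c : Fin (Module.finrank ℂ F) → 𝔼 → ℂ}
    (hc : ∀ i, IsTest φ.target (c i)) :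
    ∃ s : SmoothSec m F E ⊤, ∀ x, globalSec s x = secOfComp T φ c x :=
  ⟨secOfSmooth _ (contMDiff_secOfComp hφ hT hc), fun _ => rfl⟩

/-- The density formula is available for measurable sets, so the exceptional set is first enlarged
to a measurable null set. -/
theorem IsDensity.ae_of_ae (hρ : IsDensity μ φ ρ) {q : X → Prop}
    (h : ∀ᵐ y : 𝔼, y ∈ φ.target → q (φ.symm y)) : ∀ᵐ x ∂μ, x ∈ φ.source → q x := by
  obtain ⟨N, hN, hNm, hN0⟩ := exists_measurable_superset_of_null (ae_iff.1 h)
  have hm : MeasurableSet (φ.source ∩ φ ⁻¹' N) := by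
    have h1 : Continuous (φ.source.domRestrict φ) :=
      continuousOn_iff_continuous_domRestrict.1 φ.continuousOn
    have h2 := φ.open_source.measurableSet.subtype_image (h1.measurable hNm)
    convert h2 using 1
    ext x
    simp [Set.domRestrict, and_comm]
  have h0 : μ (φ.source ∩ φ ⁻¹' N) = 0 := by
    rw [hρ.apply _ hm Set.inter_subset_left]
    refine setLIntegral_measure_zero _ _ (measure_mono_null ?_ hN0)
    rintro _ ⟨x, hx, rfl⟩
    exact hx.2
  refine measure_mono_null (fun x hx => ?_) h0
  simp only [Set.mem_compl_iff, Set.mem_ofPred_eq, Classical.not_imp] at hx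
  refine ⟨hx.1, hN ?_⟩
  simp only [Set.mem_ofPred_eq, Classical.not_imp]
  exact ⟨φ.map_source hx.1, by rw [φ.left_inv hx.1]; exact hx.2⟩

theorem IsDistribImage.add [IsLocallyFiniteMeasure μ] (hp1 : 1 ≤ p) {f f' : ∀ x, E x}
    {g g' : ∀ x, V x} (hf : hE.MemLpSection p μ f) (hf' : hE.MemLpSection p μ f')
    (hg : hV.MemLpSection p μ g) (hg' : hV.MemLpSection p μ g')
    (h : IsDistribImage μ hE hV P f g) (h' : IsDistribImage μ hE hV P f' g') :
    IsDistribImage μ hE hV P (fun x => f x + f' x) fun x => g x + g' x := by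
  intro ψ hψ η hη
  simp only [map_add]
  rw [integral_add (hE.integrable_inner hp1 hη.1 hf) (hE.integrable_inner hp1 hη.1 hf'),
    integral_add (hV.integrable_inner hp1 hψ hg) (hV.integrable_inner hp1 hψ hg'),
    h ψ hψ η hη, h' ψ hψ η hη]

/-- The distributional image is unique up to null sets. -/
theorem IsDistribImage.ae_eq (hμ : IsSmoothMeasure (m := m) μ) (hp1 : 1 ≤ p) (hp : p ≠ ⊤)
    (hP : P.IsDiffOp k) {f : ∀ x, E x} {g g' : ∀ x, V x} (hf : hE.MemLpSection p μ f)
    (hg : hV.MemLpSection p μ g) (hg' : hV.MemLpSection p μ g')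
    (h : IsDistribImage μ hE hV P f g) (h' : IsDistribImage μ hE hV P f g') :
    ∀ᵐ x ∂μ, g x = g' x := by
  obtain ⟨s, hs, φ, hφ, hφs, hcov⟩ := exists_countable_charts (m := m) fun x : X =>
    inter_mem ((trivializationAt F E x).open_baseSet.mem_nhds (mem_baseSet_trivializationAt F E x))
      ((trivializationAt G V x).open_baseSet.mem_nhds (mem_baseSet_trivializationAt G V x))
  have key : ∀ x₀, ∀ᵐ x ∂μ, x ∈ (φ x₀).source → g x = g' x := by
    intro x₀
    have hT := (hφs x₀).trans Set.inter_subset_left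
    have hT' := (hφs x₀).trans Set.inter_subset_right
    obtain ⟨ρ, hρ⟩ := hμ.exists_isDensity (hφ x₀)
    obtain ⟨b, hb⟩ := hP.exists_isLocalExpr (hφ x₀) hT hT'
    refine hρ.ae_of_ae ?_
    -- Both right-hand sides give the same value on each test function, namely the left-hand side of
    -- the local weak equation for f.
    have h1 : ∀ j, ∀ᵐ y, y ∈ (φ x₀).target →
        comp (trivializationAt G V x₀) (φ x₀) g j y = comp (trivializationAt G V x₀) (φ x₀) g' j y :=
      fun j => ae_eq_of_integral_mul_test (φ x₀).open_target hp1
        (hg.memLpLoc_comp hp1 hp (hφ x₀) hT' hρ j) (hg'.memLpLoc_comp hp1 hp (hφ x₀) hT' hρ j)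
        fun θ hθ => (h.weakEq hp1 hp hb (hφ x₀) hT hT' hρ hf hg j θ hθ).symm.trans
          (h'.weakEq hp1 hp hb (hφ x₀) hT hT' hρ hf hg' j θ hθ)
    filter_upwards [ae_all_iff.2 h1] with y hy hyt
    exact coordAt_injective (hT' ((φ x₀).map_target hyt)) (funext fun j => hy j hyt)
  filter_upwards [(ae_ball_iff hs).2 fun x₀ _ => key x₀] with x hx
  obtain ⟨x₀, hx₀, hxs⟩ := Set.mem_iUnion₂.1 (hcov ▸ Set.mem_univ x)
  exact hx x₀ hx₀ hxs

/-- Testing against sections supported in an open set detects a smooth section there. -/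
theorem ae_eq_of_integral_inner [IsLocallyFiniteMeasure μ]
    (hφ : φ ∈ IsManifold.maximalAtlas (𝓡 m) ∞ X) (hT : φ.source ⊆ T.baseSet)
    {η η' : SmoothSec m F E ⊤} (hη : HasCompactSupp (globalSec η))
    (hη' : HasCompactSupp (globalSec η')) {W K : Set 𝔼} (hW : IsOpen W) (hWt : W ⊆ φ.target)
    (hK : IsCompact K) (hKW : K ⊆ W)
    (h : ∀ s : SmoothSec m F E ⊤, (∃ L, IsCompact L ∧ L ⊆ W ∧ ∀ x ∉ φ.symm '' L, globalSec s x = 0) →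
      ∫ x, hE.inner x (globalSec η x) (globalSec s x) ∂μ =
        ∫ x, hE.inner x (globalSec η' x) (globalSec s x) ∂μ) :
    ∀ᵐ x ∂μ, x ∈ φ.symm '' K → globalSec η x = globalSec η' x := by
  obtain ⟨κ, hκ, W', -, hKW', hκ1⟩ := exists_isTest_eq_one hW hK hKW
  set d := η - η' with hd
  have hdc : HasCompactSupp (globalSec d) := hη.sub hη'
  -- The test section is |κ|² times the difference d. Its product with d is |κ|² |d|² ≥ 0 and
  -- integrates to zero, so d vanishes almost everywhere where κ = 1. The factor conj(κ) κ is used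
  -- because κ is complex valued.
  have hc : ∀ i, IsTest W fun y => comp T φ (globalSec d) i y * ((starRingEnd ℂ) (κ y) * κ y) :=
    fun i => (hκ.mul hW (hκ.conj.smooth.contDiffOn)).mul hW ((contDiffOn_comp hφ hT d i).mono hWt)
  obtain ⟨L, hL, hLW, hL0⟩ := exists_compact_of_isTest hc
  obtain ⟨s, hs⟩ := exists_globalSec_eq_secOfComp (T := T) hφ hT fun i => (hc i).mono hWt
  have hs0 : ∀ x ∉ φ.symm '' L, globalSec s x = 0 := fun x hx =>
    (hs x).trans (secOfComp_eq_zero_of_notMem hL0 hx)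
  have hsc : HasCompactSupp (globalSec s) :=
    ⟨φ.symm '' L, isCompact_symm_image hL (hLW.trans hWt), hs0⟩
  have hsv : ∀ x ∈ φ.source, globalSec s x = ((‖κ (φ x)‖ ^ 2 : ℝ) : ℂ) • globalSec d x := by
    intro x hx
    refine coordAt_injective (hT hx) (funext fun i => ?_)
    rw [map_smul, Pi.smul_apply, hs, coordAt_secOfComp hT hx, comp, φ.left_inv hx, Complex.conj_mul', smul_eq_mul, mul_comm]
    push_cast
    rfl
  have hi : Integrable (fun x => hE.inner x (globalSec d x) (globalSec s x)) μ :=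
    hE.integrable_inner le_rfl hdc (hE.memLpSection_of_smooth 1 hsc)
  have h0 : ∫ x, hE.inner x (globalSec d x) (globalSec s x) ∂μ = 0 := by
    have e : ∀ x, hE.inner x (globalSec d x) (globalSec s x) =
        hE.inner x (globalSec η x) (globalSec s x) - hE.inner x (globalSec η' x) (globalSec s x) :=
      fun x => by rw [hd, globalSec_sub, map_sub, LinearMap.sub_apply]
    simp only [e]
    rw [integral_sub (hE.integrable_inner le_rfl hη (hE.memLpSection_of_smooth 1 hsc))
      (hE.integrable_inner le_rfl hη' (hE.memLpSection_of_smooth 1 hsc)),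
      h s ⟨L, hL, hLW, hs0⟩, sub_self]
  have hre : ∀ x, 0 ≤ (hE.inner x (globalSec d x) (globalSec s x)).re := by
    intro x
    by_cases hx : x ∈ φ.source
    · rw [hsv x hx, map_smul, smul_eq_mul, Complex.re_ofReal_mul]
      refine mul_nonneg (sq_nonneg _) ?_
      by_cases hdx : globalSec d x = 0
      · simp [hdx]
      · exact (hE.pos x _ hdx).le
    · rw [hs0 x fun h => hx (symm_image_subset (hLW.trans hWt) h), map_zero]
      simp
  have h1 : ∫ x, (hE.inner x (globalSec d x) (globalSec s x)).re ∂μ = 0 := by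
    have := integral_re hi
    simp only [RCLike.re_eq_complex_re] at this
    rw [this, h0, Complex.zero_re]
  have h2 := (integral_eq_zero_iff_of_nonneg hre hi.re).1 h1
  filter_upwards [h2] with x hx hxK
  obtain ⟨y, hy, rfl⟩ := hxK
  have hyt := hWt (hKW hy)
  have hκy : κ (φ (φ.symm y)) = 1 := by rw [φ.right_inv hyt]; exact hκ1 y (hKW' hy)
  simp only [Pi.zero_apply, hsv _ (φ.map_target hyt), hκy, norm_one, one_pow, Complex.ofReal_one,
    one_smul] at hx
  by_contra hne
  have hdx : globalSec d (φ.symm y) ≠ 0 := by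
    rw [hd, globalSec_sub]; exact sub_ne_zero.2 hne
  exact (hE.pos _ _ hdx).ne' hx

/-- Local weak equations for sections supported in a chart give distributional images. -/
theorem isDistribImage_of_weakEq [IsLocallyFiniteMeasure μ] (hp1 : 1 ≤ p) (hp : p ≠ ⊤)
    (hb : IsLocalExpr P T T' φ k b)
    (hφ : φ ∈ IsManifold.maximalAtlas (𝓡 m) ∞ X) (hT : φ.source ⊆ T.baseSet)
    (hT' : φ.source ⊆ T'.baseSet) (hρ : IsDensity μ φ ρ) {w : ∀ x, E x} {g : ∀ x, V x}
    (hw : hE.MemLpSection p μ w) (hg : hV.MemLpSection p μ g) {K : Set 𝔼} (hK : IsCompact K)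
    (hKt : K ⊆ φ.target) (hw0 : ∀ x ∉ φ.symm '' K, w x = 0) (hg0 : ∀ x ∉ φ.symm '' K, g x = 0)
    (h : ∀ j, WeakEq φ.target k (fun α i => b α i j) (comp T φ w) (comp T' φ g j)) :
    IsDistribImage μ hE hV P w g := by
  intro ψ hψ η hη
  obtain ⟨κ, hκ, W, hW, hKW, hκ1⟩ := exists_isTest_eq_one φ.open_target hK hKt
  -- An arbitrary ψ is replaced by a section ψ' supported in the chart and equal to ψ near the
  -- supports of w and g.
  have hc : ∀ j, IsTest φ.target fun y => comp T' φ (globalSec ψ) j y * κ y := fun j =>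
    hκ.mul φ.open_target (contDiffOn_comp hφ hT' ψ j)
  obtain ⟨L, hL, hLt, hL0⟩ := exists_compact_of_isTest hc
  obtain ⟨ψ', hψ'⟩ := exists_globalSec_eq_secOfComp (T := T') hφ hT' hc
  have hψ'0 : ∀ x ∉ φ.symm '' L, globalSec ψ' x = 0 := fun x hx =>
    (hψ' x).trans (secOfComp_eq_zero_of_notMem hL0 hx)
  have hψψ' : ∀ y ∈ W ∩ φ.target, globalSec ψ' (φ.symm y) = globalSec ψ (φ.symm y) := by
    rintro y ⟨hyW, hyt⟩
    refine coordAt_injective (hT' (φ.map_target hyt)) (funext fun j => ?_)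
    rw [hψ', coordAt_secOfComp hT' (φ.map_target hyt), φ.right_inv hyt, hκ1 y hyW, mul_one]
    rfl
  obtain ⟨θ, hθ, hθr⟩ := exists_represented hV hφ hT' hρ.smooth hL hLt hψ'0
  obtain ⟨η', hη', hη'r⟩ := hb.exists_isFormalAdjointOf (hE := hE) hφ hT hρ hθ hθr
  -- The given adjoint η of ψ and the constructed adjoint η' of ψ' agree on the image of K: for s
  -- supported in W, P s is supported there too, where ψ = ψ'. So η may be replaced by η' against w.
  have hae := ae_eq_of_integral_inner (hE := hE) (μ := μ) hφ hT hη.1 hη'.1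
    (hW.inter φ.open_target) Set.inter_subset_right hK (Set.subset_inter hKW hKt) (by
      rintro s ⟨C, hC, hCW, hs⟩
      rw [hη.2 s, hη'.2 s]
      refine integral_congr_ae (ae_of_all _ fun x => ?_)
      by_cases hx : x ∈ φ.symm '' C
      · obtain ⟨y, hy, rfl⟩ := hx
        simp only [hψψ' y (hCW hy)]
      · have := P.app_eq_zero (s := s) ((isCompact_symm_image hC
          (hCW.trans Set.inter_subset_right)).isClosed.isOpen_compl) (fun x hx => hs x hx) hx
        simp only [this, map_zero])
  have e1 : ∫ x, hE.inner x (globalSec η x) (w x) ∂μ = ∫ x, hE.inner x (globalSec η' x) (w x) ∂μ := by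
    refine integral_congr_ae ?_
    filter_upwards [hae] with x hx
    by_cases hxK : x ∈ φ.symm '' K
    · rw [hx hxK]
    · rw [hw0 x hxK, map_zero, map_zero]
  have e2 : ∫ x, hV.inner x (globalSec ψ x) (g x) ∂μ = ∫ x, hV.inner x (globalSec ψ' x) (g x) ∂μ := by
    refine integral_congr_ae (ae_of_all _ fun x => ?_)
    by_cases hxK : x ∈ φ.symm '' K
    · obtain ⟨y, hy, rfl⟩ := hxK
      simp only [hψψ' y ⟨hKW hy, hKt hy⟩]
    · simp only [hg0 x hxK, map_zero]
  rw [e1, e2, hE.integral_inner_eq hρ (isTest_adjExpr φ.open_target hb.smooth hθ) hη'r hw.1,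
    hV.integral_inner_eq hρ hθ hθr hg.1]
  exact (weakEq_iff_adjExpr hp1 φ.open_target hb.smooth (hw.memLpLoc_comp hp1 hp hφ hT hρ)
    (hg.memLpLoc_comp hp1 hp hφ hT' hρ)).1 h θ hθ

end DistribImage

/-! ### Approximation in a chart -/

section EuclideanLocality

variable {m d k r : ℕ} {p : ℝ≥0∞} {Ω Ω' : Set (EuclideanSpace ℝ (Fin m))}
variable {a : (Fin m → ℕ) → Fin d → EuclideanSpace ℝ (Fin m) → ℂ}

local notation "𝔼" => EuclideanSpace ℝ (Fin m)

theorem MemLpLoc.mono {u : 𝔼 → ℂ} (hu : MemLpLoc p Ω u) (h : Ω' ⊆ Ω) : MemLpLoc p Ω' u :=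
  fun K hK hKΩ => hu K hK (hKΩ.trans h)

theorem MemSobolevLoc.mono {u : 𝔼 → ℂ} (hu : MemSobolevLoc r p Ω u) (h : Ω' ⊆ Ω) :
    MemSobolevLoc r p Ω' u := by
  refine ⟨hu.1.mono h, fun α hα => ?_⟩
  obtain ⟨v, hv, hw⟩ := hu.2 α hα
  exact ⟨v, hv.mono h, isWeakDeriv_iff.2 fun θ hθ => isWeakDeriv_iff.1 hw θ (hθ.mono h)⟩

/-- This covers k ≤ 1, where no regularity is assumed and r = 0. -/
theorem MemLpLoc.memSobolevLoc_zero {u : 𝔼 → ℂ} (hu : MemLpLoc p Ω u) : MemSobolevLoc 0 p Ω u := by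
  refine ⟨hu, fun α hα => ⟨u, hu, isWeakDeriv_iff.2 fun θ _ => ?_⟩⟩
  have h0 : ∑ i, α i = 0 := Nat.le_zero.1 (mem_multiIndices.1 hα)
  have hw : word α = [] := List.length_eq_zero_iff.1 ((length_word α).trans h0)
  rw [multiD_eq_wordD, hw, wordD_nil, h0, pow_zero, one_mul]

theorem WeakEq.mono {u : Fin d → 𝔼 → ℂ} {g : 𝔼 → ℂ} (hu : WeakEq Ω k a u g) (h : Ω' ⊆ Ω) :
    WeakEq Ω' k a u g := fun θ hθ => hu θ (hθ.mono h)

theorem integral_mul_test_congr {u v θ : 𝔼 → ℂ} (huv : ∀ y ∈ Ω, u y = v y) (hθ : IsTest Ω θ) :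
    ∫ y, u y * θ y = ∫ y, v y * θ y := by
  refine integral_congr_ae (ae_of_all _ fun y => ?_)
  by_cases hy : y ∈ Ω
  · simp only [huv y hy]
  · simp only [hθ.eq_zero hy, mul_zero]

theorem WeakEq.congr (hΩ : IsOpen Ω) (ha : ∀ α i, ContDiffOn ℝ ∞ (a α i) Ω)
    {u u' : Fin d → 𝔼 → ℂ} {g g' : 𝔼 → ℂ} (hu : WeakEq Ω k a u g)
    (hu' : ∀ i, ∀ y ∈ Ω, u' i y = u i y) (hg' : ∀ y ∈ Ω, g' y = g y) : WeakEq Ω k a u' g' := by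
  intro θ hθ
  rw [integral_mul_test_congr hg' hθ, ← hu θ hθ]
  refine Finset.sum_congr rfl fun i _ => Finset.sum_congr rfl fun α _ => ?_
  rw [integral_mul_test_congr (hu' i) ((hθ.mul hΩ (ha α i)).multiD α)]

/-- A cut-off equal to 1 near K turns test functions on Ω into test functions on Ω' without
affecting the integrals, since u and g vanish off K. -/
theorem WeakEq.extend (hΩ' : IsOpen Ω') {u : Fin d → 𝔼 → ℂ} {g : 𝔼 → ℂ}
    (h : WeakEq Ω' k a u g) {K : Set 𝔼} (hK : IsCompact K) (hKΩ' : K ⊆ Ω')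
    (hu : ∀ i, ∀ y ∉ K, u i y = 0) (hg : ∀ y ∉ K, g y = 0) : WeakEq Ω k a u g := by
  obtain ⟨κ, hκ, W, hW, hKW, hκ1⟩ := exists_isTest_eq_one hΩ' hK hKΩ'
  intro θ hθ
  have hκθ : IsTest Ω' fun y => κ y * θ y := by
    simpa only [mul_comm] using hκ.mul_smooth hθ.smooth
  have e : ∫ y, g y * θ y = ∫ y, g y * (κ y * θ y) := by
    refine integral_congr_ae (ae_of_all _ fun y => ?_)
    by_cases hy : y ∈ K
    · simp only [hκ1 y (hKW hy), one_mul]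
    · simp only [hg y hy, zero_mul]
  rw [e, ← h _ hκθ]
  refine Finset.sum_congr rfl fun i _ => Finset.sum_congr rfl fun α _ => ?_
  congr 1
  refine integral_congr_ae (ae_of_all _ fun y => ?_)
  by_cases hy : y ∈ K
  · have he : Set.EqOn (fun y => a α i y * θ y) (fun y => a α i y * (κ y * θ y)) W :=
      fun z hz => by simp only [hκ1 z hz, one_mul]
    simp only [multiD_eq_wordD, wordD_eqOn hW he (word α) (hKW hy)]
  · simp only [hu i y hy, zero_mul]

end EuclideanLocality

/-! ### From the Euclidean approximation to sections over a chart -/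

section ChartApprox

variable {m : ℕ} {X : Type*} [TopologicalSpace X] [T2Space X] [SecondCountableTopology X]
  [ChartedSpace (EuclideanSpace ℝ (Fin m)) X] [IsManifold (𝓡 m) ∞ X]
  [MeasurableSpace X] [BorelSpace X] {μ : Measure X}
variable {φ : OpenPartialHomeomorph X (EuclideanSpace ℝ (Fin m))}
variable {ρ : EuclideanSpace ℝ (Fin m) → ℝ} {p : ℝ≥0∞}

local notation "𝔼" => EuclideanSpace ℝ (Fin m)

/-- Positivity of the density makes Lebesgue measure on the chart target absolutely continuous with
respect to the transported μ. -/
theorem IsDensity.ae_symm_of_ae (hρ : IsDensity μ φ ρ) {q : X → Prop}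
    (h : ∀ᵐ x ∂μ, x ∈ φ.source → q x) : ∀ᵐ y : 𝔼, y ∈ φ.target → q (φ.symm y) := by
  have h1 := (ae_restrict_iff' φ.open_source.measurableSet).2 h
  rw [hρ.restrict_source] at h1
  have h2 := ae_of_ae_map (IsDensity.aemeasurable_symm φ.open_target.measurableSet subset_rfl ρ) h1
  rw [ae_withDensity_iff' (hρ.smooth.continuousOn.aemeasurable
    φ.open_target.measurableSet).ennreal_ofReal, ae_restrict_iff' φ.open_target.measurableSet] at h2
  filter_upwards [h2] with y hy hyt
  exact hy hyt (ENNReal.ofReal_pos.2 (hρ.pos y hyt)).ne'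

/-- Compactly supported smooth functions on a chart domain are test functions in the chart. -/
theorem exists_isTest_of_contMDiff (hφ : φ ∈ IsManifold.maximalAtlas (𝓡 m) ∞ X) {χ : X → ℝ}
    (hχ : ContMDiff (𝓡 m) 𝓘(ℝ) ∞ χ) (hχc : HasCompactSupport χ) (hχs : tsupport χ ⊆ φ.source)
    {Ω : Set 𝔼} (hΩ : IsOpen Ω) (hΩt : Ω ⊆ φ.target) (hs : φ '' tsupport χ ⊆ Ω) :
    ∃ θ : 𝔼 → ℂ, IsTest Ω θ ∧ ∀ y ∈ φ.target, θ y = χ (φ.symm y) := by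
  have hK : IsCompact (φ '' tsupport χ) :=
    IsCompact.image_of_continuousOn hχc (φ.continuousOn.mono hχs)
  obtain ⟨κ, hκ, W, -, hKW, hκ1⟩ := exists_isTest_eq_one hΩ hK hs
  have hd : ContDiffOn ℝ ∞ (fun y => ((χ (φ.symm y) : ℝ) : ℂ)) φ.target :=
    contDiffOn_comp_symm hφ (g := fun x => ((χ x : ℝ) : ℂ)) fun x _ =>
      Complex.ofRealCLM.contDiff.contMDiff.contMDiffAt.comp x (hχ x)
  refine ⟨_, hκ.mul hΩ (hd.mono hΩt), fun y hy => ?_⟩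
  by_cases hy0 : χ (φ.symm y) = 0
  · simp [hy0]
  · have : y ∈ φ '' tsupport χ :=
      ⟨φ.symm y, subset_tsupport _ hy0, φ.right_inv hy⟩
    rw [hκ1 y (hKW this), mul_one]

variable {F : Type*} [NormedAddCommGroup F] [NormedSpace ℂ F] [FiniteDimensional ℂ F]
variable {E : X → Type*} [∀ x, AddCommGroup (E x)] [∀ x, Module ℂ (E x)]
  [∀ x, TopologicalSpace (E x)] [TopologicalSpace (TotalSpace F E)]
  [FiberBundle F E] [VectorBundle ℂ F E] [IsSmoothComplexBundle m F E]
variable {s : ℕ} {G : Fin s → Type*} [∀ i, NormedAddCommGroup (G i)] [∀ i, NormedSpace ℂ (G i)]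
  [∀ i, FiniteDimensional ℂ (G i)]
variable {V : Fin s → X → Type*} [∀ i x, AddCommGroup (V i x)] [∀ i x, Module ℂ (V i x)]
  [∀ i x, TopologicalSpace (V i x)] [∀ i, TopologicalSpace (TotalSpace (G i) (V i))]
  [∀ i, FiberBundle (G i) (V i)] [∀ i, VectorBundle ℂ (G i) (V i)]
  [∀ i, IsSmoothComplexBundle m (G i) (V i)]
variable {hE : HermitianStructure m F E} {hV : ∀ i, HermitianStructure m (G i) (V i)}
variable {k : Fin s → ℕ} {P : ∀ i, SheafMorphism m F E (G i) (V i)}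
variable {T : Trivialization F (π F E)} [MemTrivializationAtlas T]
variable {T' : ∀ i, Trivialization (G i) (π (G i) (V i))} [∀ i, MemTrivializationAtlas (T' i)]

/-- A section supported in a chart is small if its components are small. -/
theorem exists_lpNorm_le_mul (h : HermitianStructure m F E) (hp1 : 1 ≤ p)
    (hp : p ≠ ⊤) (hφ : φ ∈ IsManifold.maximalAtlas (𝓡 m) ∞ X) (hT : φ.source ⊆ T.baseSet)
    (hρ : IsDensity μ φ ρ) {K : Set 𝔼} (hK : IsCompact K) (hKt : K ⊆ φ.target) :
    ∃ C : ℝ≥0∞, C ≠ ⊤ ∧ ∀ f : ∀ x, E x, IsBorelSection F f → (∀ x ∉ φ.symm '' K, f x = 0) →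
      ∀ (c : Fin (Module.finrank ℂ F) → 𝔼 → ℂ) (ε : ℝ≥0∞), (∀ i, ∀ y ∈ K, comp T φ f i y = c i y) →
        (∀ i, eLpNorm (c i) p volume ≤ ε) → h.lpNorm p μ f ≤ C * ε := by
  obtain ⟨C, hC, h1⟩ := h.exists_lpNorm_le hp1 hp hφ hT hρ hK hKt
  refine ⟨C * Module.finrank ℂ F, ENNReal.mul_ne_top hC (ENNReal.natCast_ne_top _),
    fun f hf hf0 c ε hc hcε => (h1 f hf hf0).trans ?_⟩
  rw [mul_assoc]
  refine mul_le_mul_right ((Finset.sum_le_card_nsmul _ _ ε fun i _ => ?_).trans (by simp)) C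
  rw [eLpNorm_congr_ae ((ae_restrict_iff' hK.measurableSet).2 (ae_of_all _ (hc i)))]
  exact (eLpNorm_restrict_le _ _ _ _).trans (hcε i)

/-- The local form of the theorem: a section of the Sobolev space, multiplied by a cut-off function
supported in a chart, is approximated by smooth sections. -/
theorem exists_approx_in_chart (hμ : IsSmoothMeasure (m := m) μ) (hp1 : 1 ≤ p) (hp : p ≠ ⊤)
    (hP : ∀ i, (P i).IsDiffOp (k i))
    (hreg : 2 ≤ Finset.univ.sup k → ∀ f : ∀ x, E x, MemSobolev μ hE hV P p f →
      MemSobolevLocSection m F (Finset.univ.sup k - 1) p f)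
    (hφ : φ ∈ IsManifold.maximalAtlas (𝓡 m) ∞ X) (hT : φ.source ⊆ T.baseSet)
    (hT' : ∀ i, φ.source ⊆ (T' i).baseSet) {f : ∀ x, E x} (hf : MemSobolev μ hE hV P p f)
    {χ : X → ℝ} (hχ : ContMDiff (𝓡 m) 𝓘(ℝ) ∞ χ) (hχc : HasCompactSupport χ)
    (hχs : tsupport χ ⊆ φ.source) {ε : ℝ≥0∞} (hε : 0 < ε) (hε' : ε ≠ ⊤) :
    ∃ (w : SmoothSec m F E ⊤) (g : ∀ i x, V i x),
      (∀ x ∉ φ.source, globalSec w x = 0) ∧ HasCompactSupp (globalSec w) ∧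
      (∀ i, ∀ x ∉ φ.source, g i x = 0) ∧ (∀ i, IsBorelSection (G i) (g i)) ∧
      hE.lpNorm p μ (fun x => globalSec w x - (χ x : ℂ) • f x) ≤ ε ∧
      (∀ i, (hV i).lpNorm p μ (g i) ≤ ε) ∧
      (∀ i, IsDistribImage μ hE (hV i) (P i)
        (fun x => globalSec w x - (χ x : ℂ) • f x) (g i)) ∧
      ((∀ᵐ x ∂μ, x ∈ φ.source → f x = 0) → ∀ x, globalSec w x = 0) := by
  have := hμ.isLocallyFiniteMeasure
  obtain ⟨ρ, hρ⟩ := hμ.exists_isDensity hφ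
  choose b hb using fun i => (hP i).exists_isLocalExpr hφ hT (hT' i)
  choose g₀ hg₀ hfg using hf.2
  have hK₀ : IsCompact (φ '' tsupport χ) :=
    IsCompact.image_of_continuousOn hχc (φ.continuousOn.mono hχs)
  have hK₀t : φ '' tsupport χ ⊆ φ.target := by
    rintro _ ⟨x, hx, rfl⟩
    exact φ.map_source (hχs hx)
  -- The Euclidean approximation is run on the interior of `L`. All supports then stay in the fixed
  -- compact set `L`, so the norm comparison constants can be chosen before the approximants.
  obtain ⟨L, hL, hK₀L, hLt⟩ := exists_compact_between hK₀ φ.open_target hK₀t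
  have hLt' : interior L ⊆ φ.target := interior_subset.trans hLt
  obtain ⟨θ, hθ, hθχ⟩ := exists_isTest_of_contMDiff hφ hχ hχc hχs isOpen_interior hLt' hK₀L
  obtain ⟨C, hC, hC'⟩ := exists_lpNorm_le_mul (T := T) hE hp1 hp hφ hT hρ hL hLt
  choose D hD hD' using fun i => exists_lpNorm_le_mul (T := T' i) (hV i) hp1 hp hφ (hT' i) hρ hL hLt
  -- `B` dominates all comparison constants, so accuracy ε / B for components gives accuracy ε for
  -- sections.
  set B : ℝ≥0∞ := C + ∑ i, D i + 1 with hB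
  have hBt : B ≠ ⊤ := by
    simp only [hB, ne_eq, ENNReal.add_eq_top, ENNReal.sum_eq_top, hC, hD, or_false,
      and_false, exists_false, ENNReal.one_ne_top, not_false_eq_true]
  have hCB : C * (ε / B) ≤ ε := le_trans
    (mul_le_mul_left (le_self_add.trans le_self_add) _) ENNReal.mul_div_le
  have hDB : ∀ i, D i * (ε / B) ≤ ε := fun i => le_trans
    (mul_le_mul_left (((Finset.single_le_sum (f := D) (fun _ _ => bot_le)
      (Finset.mem_univ i)).trans le_add_self).trans le_self_add) _) ENNReal.mul_div_le
  -- Truncated subtraction: r = 0 when all orders are at most 1. In every case the orders are at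
  -- most r + 1.
  set r := Finset.univ.sup k - 1 with hr
  have hu : ∀ i, MemSobolevLoc r p φ.target (comp T φ f i) := by
    by_cases h2 : 2 ≤ Finset.univ.sup k
    · exact (hreg h2 f hf).2 φ hφ (frameSec T hT) (isFrame_frameSec hT) (comp T φ f) fun x => by
        have := secOfComp_comp (T := T) hT (f := f) x.2
        rw [secOfComp, if_pos (show (x : X) ∈ φ.source from x.2)] at this
        exact this.symm
    · have hr0 : r = 0 := by omega
      rw [hr0]
      exact fun i => (hf.1.memLpLoc_comp hp1 hp hφ hT hρ i).memSobolevLoc_zero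
  -- The index set consists of all scalar component equations of all operators, so a single smooth
  -- approximant works for every P_i.
  obtain ⟨w, hw, hwε, hw0, hG⟩ := exists_local_approx (r := r) hp1 hp
    (isOpen_interior (s := L)) (Λ := Σ i : Fin s, Fin (Module.finrank ℂ (G i)))
    (κ := fun l => k l.1) (a := fun l α i => b l.1 α i l.2) (u := comp T φ f)
    (g := fun l => comp (T' l.1) φ (g₀ l.1) l.2)
    (fun l => by
      have := Finset.le_sup (f := k) (Finset.mem_univ l.1)
      change k l.1 ≤ r + 1
      omega)
    (fun l α i => ((hb l.1).smooth α i l.2).mono hLt') (fun i => (hu i).mono hLt')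
    (fun l => ((hg₀ l.1).memLpLoc_comp hp1 hp hφ (hT' l.1) hρ l.2).mono hLt')
    (fun l => ((hfg l.1).weakEq hp1 hp (hb l.1) hφ hT (hT' l.1) hρ hf.1 (hg₀ l.1) l.2).mono hLt')
    hθ (ε := ε / B) (ENNReal.div_pos hε.ne' hBt)
  choose g hgm hgK hgε hgw using hG
  choose K hK hKL hgK0 using hgK
  obtain ⟨W, hW⟩ := exists_globalSec_eq_secOfComp (T := T) hφ hT fun i => (hw i).mono hLt'
  have hgL : ∀ i (j : Fin (Module.finrank ℂ (G i))) y, y ∉ L → g ⟨i, j⟩ y = 0 := fun i j y hy =>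
    hgK0 _ y fun h => hy (interior_subset (hKL _ h))
  have hwL : ∀ i y, y ∉ L → w i y = 0 := fun i y hy => (hw i).eq_zero fun h => hy (interior_subset h)
  have hW0 : ∀ x ∉ φ.symm '' L, globalSec W x = 0 := fun x hx =>
    (hW x).trans (secOfComp_eq_zero_of_notMem hwL hx)
  set δ : ∀ x, E x := fun x => globalSec W x - (χ x : ℂ) • f x with hδ
  set γ : ∀ i x, V i x := fun i => secOfComp (T' i) φ fun j => g ⟨i, j⟩ with hγ
  have hγ0 : ∀ i, ∀ x ∉ φ.symm '' L, γ i x = 0 := fun i x hx =>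
    secOfComp_eq_zero_of_notMem (hgL i) hx
  have hδ0 : ∀ x ∉ φ.symm '' L, δ x = 0 := by
    intro x hx
    have hχx : χ x = 0 := by
      by_contra h0
      have hxt : x ∈ tsupport χ := subset_tsupport _ h0
      exact hx ⟨φ x, interior_subset (hK₀L ⟨x, hxt, rfl⟩), φ.left_inv (hχs hxt)⟩
    simp only [hδ, hW0 x hx, hχx, Complex.ofReal_zero, zero_smul, sub_zero]
  have hδm : IsBorelSection F δ := (SmoothSec.isBorelSection W).sub
    (hf.1.1.smul (Complex.measurable_ofReal.comp hχ.continuous.measurable))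
  have hγm : ∀ i, IsBorelSection (G i) (γ i) := fun i =>
    isBorelSection_secOfComp (hT' i) (fun j => hgm _) hL hLt (hgL i)
  have hδc : ∀ i, ∀ y ∈ φ.target, comp T φ δ i y = w i y - θ y * comp T φ f i y := by
    intro i y hy
    simp only [hδ, comp, map_sub, map_smul, Pi.sub_apply, Pi.smul_apply, smul_eq_mul, hW,
      hθχ y hy]
    rw [coordAt_secOfComp hT (φ.map_target hy), φ.right_inv hy]
  have hγc : ∀ i j, ∀ y ∈ φ.target, comp (T' i) φ (γ i) j y = g ⟨i, j⟩ y := fun i j y hy =>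
    comp_secOfComp (hT' i) hy j
  have hδε : hE.lpNorm p μ δ ≤ ε :=
    (hC' δ hδm hδ0 _ _ (fun i y hy => hδc i y (hLt hy)) hwε).trans hCB
  have hγε : ∀ i, (hV i).lpNorm p μ (γ i) ≤ ε := fun i =>
    (hD' i (γ i) (hγm i) (hγ0 i) _ _ (fun j y hy => hγc i j y (hLt hy)) fun j => hgε _).trans (hDB i)
  have hsub : ∀ x, x ∉ φ.source → x ∉ φ.symm '' L := fun x hx h => hx (symm_image_subset hLt h)
  refine ⟨W, γ, fun x hx => hW0 x (hsub x hx), ⟨_, isCompact_symm_image hL hLt, hW0⟩,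
    fun i x hx => hγ0 i x (hsub x hx), hγm, hδε, hγε, fun i => ?_, fun h0 x => ?_⟩
  · refine isDistribImage_of_weakEq hp1 hp (hb i) hφ hT (hT' i) hρ ⟨hδm, hδε.trans_lt hε'.lt_top⟩
      ⟨hγm i, (hγε i).trans_lt hε'.lt_top⟩ hL hLt hδ0 (hγ0 i) fun j => ?_
    obtain ⟨K₁, hK₁, hK₁L, hK₁0⟩ := exists_compact_of_isTest hw
    -- The equation was obtained on the interior of `L`; compact supports there extend it to the
    -- whole chart target.
    have hext := (hgw ⟨i, j⟩).extend (Ω := φ.target) isOpen_interior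
      (K := K₁ ∪ tsupport θ ∪ K ⟨i, j⟩)
      ((hK₁.union hθ.compact).union (hK _))
      (Set.union_subset (Set.union_subset hK₁L hθ.subset) (hKL _))
      (fun l y hy => by
        simp only [Set.mem_union, not_or] at hy
        rw [hK₁0 l y hy.1.1, image_eq_zero_of_notMem_tsupport hy.1.2, zero_mul, sub_zero])
      (fun y hy => hgK0 _ y fun h => hy (Or.inr h))
    exact hext.congr φ.open_target (fun α l => (hb i).smooth α l j) hδc (hγc i j)
  -- If f is null on the chart, its components are null, and the mollified components vanish
  -- identically.
  · have h1 := hρ.ae_symm_of_ae h0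
    have h2 := hw0 fun i => by
      filter_upwards [h1] with y hy hyL
      rw [comp, hy (hLt' hyL), map_zero]
      rfl
    rw [hW]
    exact secOfComp_eq_zero fun i => by rw [h2 i]; rfl

end ChartApprox

/-! ### Locally finite sums of sections -/

section LocallyFiniteSums

variable {m : ℕ} {X : Type*} [TopologicalSpace X] [T2Space X] [SecondCountableTopology X]
  [ChartedSpace (EuclideanSpace ℝ (Fin m)) X] [IsManifold (𝓡 m) ∞ X]
  [MeasurableSpace X] [BorelSpace X] {μ : Measure X}
variable {p : ℝ≥0∞}
variable {F : Type*} [NormedAddCommGroup F] [NormedSpace ℂ F] [FiniteDimensional ℂ F]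
variable {E : X → Type*} [∀ x, AddCommGroup (E x)] [∀ x, Module ℂ (E x)]
  [∀ x, TopologicalSpace (E x)] [TopologicalSpace (TotalSpace F E)]
  [FiberBundle F E] [VectorBundle ℂ F E] [IsSmoothComplexBundle m F E]
variable {G : Type*} [NormedAddCommGroup G] [NormedSpace ℂ G] [FiniteDimensional ℂ G]
variable {V : X → Type*} [∀ x, AddCommGroup (V x)] [∀ x, Module ℂ (V x)]
  [∀ x, TopologicalSpace (V x)] [TopologicalSpace (TotalSpace G V)]
  [FiberBundle G V] [VectorBundle ℂ G V] [IsSmoothComplexBundle m G V]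
variable {hE : HermitianStructure m F E} {hV : HermitianStructure m G V}
variable {P : SheafMorphism m F E G V}
variable {ι : Type*} {A : ι → Set X}

local notation "𝔼" => EuclideanSpace ℝ (Fin m)

theorem finsum_section_eq {w : ι → ∀ x, E x} (hw : ∀ i, ∀ x ∉ A i, w i x = 0) {S : Set X}
    (hS : {i | (A i ∩ S).Nonempty}.Finite) {x : X} (hx : x ∈ S) :
    ∑ᶠ i, w i x = ∑ i ∈ hS.toFinset, w i x := by
  refine finsum_eq_sum_of_support_subset _ fun i hi => ?_
  rw [Set.Finite.coe_toFinset]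
  exact ⟨x, by_contra fun h => hi (hw i x h), hx⟩

theorem globalSec_sum (I : Finset ι) (w : ι → SmoothSec m F E ⊤) (x : X) :
    globalSec (∑ i ∈ I, w i) x = ∑ i ∈ I, globalSec (w i) x := by
  simp only [globalSec, Submodule.coe_sum, Finset.sum_apply]

theorem exists_globalSec_eq_finsum (hA : LocallyFinite A) {w : ι → SmoothSec m F E ⊤}
    (hw : ∀ i, ∀ x ∉ A i, globalSec (w i) x = 0) :
    ∃ W : SmoothSec m F E ⊤, ∀ x, globalSec W x = ∑ᶠ i, globalSec (w i) x := by
  refine ⟨secOfSmooth (fun x => ∑ᶠ i, globalSec (w i) x) fun x₀ => ?_, fun _ => rfl⟩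
  obtain ⟨N, hN, hfin⟩ := hA x₀
  refine (globalSec_contMDiff (∑ i ∈ hfin.toFinset, w i) x₀).congr_of_eventuallyEq ?_
  filter_upwards [hN] with x hx
  rw [finsum_section_eq (w := fun i => globalSec (w i)) hw hfin hx, globalSec_sum]

theorem isBorelSection_finsum (hA : LocallyFinite A) {w : ι → ∀ x, E x}
    (hw : ∀ i, ∀ x ∉ A i, w i x = 0) (hwm : ∀ i, IsBorelSection F (w i)) :
    IsBorelSection F fun x => ∑ᶠ i, w i x := by
  refine IsBorelSection.of_eventuallyEq fun x₀ => ?_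
  obtain ⟨N, hN, hfin⟩ := hA x₀
  refine ⟨_, IsBorelSection.sum hfin.toFinset fun i _ => hwm i, ?_⟩
  filter_upwards [hN] with x hx using finsum_section_eq hw hfin hx

theorem HermitianStructure.lpNorm_sum_le (h : HermitianStructure m F E) (hp1 : 1 ≤ p)
    (I : Finset ι) {w : ι → ∀ x, E x} (hwm : ∀ i, IsBorelSection F (w i)) :
    h.lpNorm p μ (fun x => ∑ i ∈ I, w i x) ≤ ∑ i ∈ I, h.lpNorm p μ (w i) := by
  classical
  induction I using Finset.induction_on with
  | empty => simp [lpNorm]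
  | insert i I hi ih =>
    simp only [Finset.sum_insert hi]
    exact (h.lpNorm_add_le hp1 (hwm i) (IsBorelSection.sum I fun i _ => hwm i)).trans
      (add_le_add_right ih _)

theorem HermitianStructure.memLpSection_sum (h : HermitianStructure m F E) (hp1 : 1 ≤ p)
    (I : Finset ι) {w : ι → ∀ x, E x} (hw : ∀ i, h.MemLpSection p μ (w i)) :
    h.MemLpSection p μ fun x => ∑ i ∈ I, w i x :=
  ⟨IsBorelSection.sum I fun i _ => (hw i).1, (h.lpNorm_sum_le hp1 I fun i => (hw i).1).trans_lt
    (ENNReal.sum_lt_top.2 fun i _ => (hw i).2)⟩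

/-- Only finitely many terms meet a given compact set, so Minkowski's inequality bounds the norm
there; Fatou's lemma along a compact exhaustion removes the restriction. -/
theorem HermitianStructure.lpNorm_finsum_le [SigmaCompactSpace X] (h : HermitianStructure m F E)
    (hp1 : 1 ≤ p) (hA : LocallyFinite A) {w : ι → ∀ x, E x} (hw : ∀ i, ∀ x ∉ A i, w i x = 0)
    (hwm : ∀ i, IsBorelSection F (w i)) {δ : ι → ℝ≥0∞} (hwδ : ∀ i, h.lpNorm p μ (w i) ≤ δ i) :
    h.lpNorm p μ (fun x => ∑ᶠ i, w i x) ≤ ∑' i, δ i := by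
  set N : X → ℝ := fun x => h.norm x (∑ᶠ i, w i x) with hN
  have hNm : AEStronglyMeasurable N μ :=
    (h.aemeasurable_norm (isBorelSection_finsum hA hw hwm) μ).aestronglyMeasurable
  have h1 : ∀ n, eLpNorm ((compactCovering X n).indicator N) p μ ≤ ∑' i, δ i := by
    intro n
    have hfin := hA.finite_nonempty_inter_compact (isCompact_compactCovering X n)
    refine le_trans (eLpNorm_mono (g := fun x => h.norm x (∑ i ∈ hfin.toFinset, w i x))
      fun x => ?_) ((h.lpNorm_sum_le (μ := μ) hp1 hfin.toFinset hwm).trans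
        ((Finset.sum_le_sum fun i _ => hwδ i).trans (ENNReal.sum_le_tsum _)))
    by_cases hx : x ∈ compactCovering X n
    · simp only [Set.indicator_of_mem hx, hN, finsum_section_eq hw hfin hx, le_refl]
    · rw [Set.indicator_of_notMem hx, _root_.norm_zero]
      exact _root_.norm_nonneg _
  refine (Lp.eLpNorm_lim_le_liminf_eLpNorm
    (fun n => hNm.indicator (isCompact_compactCovering X n).measurableSet) N
    (ae_of_all _ fun x => ?_)).trans
      (liminf_le_of_frequently_le' (Frequently.of_forall h1))
  obtain ⟨n, hn⟩ := exists_mem_compactCovering x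
  refine tendsto_const_nhds.congr' ?_
  filter_upwards [eventually_ge_atTop n] with k hk
  rw [Set.indicator_of_mem (compactCovering_subset X hk hn)]

theorem IsDistribImage.sum [IsLocallyFiniteMeasure μ] (hp1 : 1 ≤ p) (I : Finset ι)
    {f : ι → ∀ x, E x} {g : ι → ∀ x, V x} (hf : ∀ i, hE.MemLpSection p μ (f i))
    (hg : ∀ i, hV.MemLpSection p μ (g i)) (h : ∀ i, IsDistribImage μ hE hV P (f i) (g i)) :
    IsDistribImage μ hE hV P (fun x => ∑ i ∈ I, f i x) fun x => ∑ i ∈ I, g i x := by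
  classical
  induction I using Finset.induction_on with
  | empty => intro ψ _ η _; simp
  | insert i I hi ih =>
    simp only [Finset.sum_insert hi]
    exact (h i).add hp1 (hf i) (hE.memLpSection_sum hp1 I hf) (hg i) (hV.memLpSection_sum hp1 I hg) ih

/-- The two test sections have compact support, so only the finitely many terms meeting these
supports matter. No summability is needed. -/
theorem IsDistribImage.finsum [IsLocallyFiniteMeasure μ] (hp1 : 1 ≤ p) (hA : LocallyFinite A)
    {f : ι → ∀ x, E x} {g : ι → ∀ x, V x} (hf0 : ∀ i, ∀ x ∉ A i, f i x = 0)
    (hg0 : ∀ i, ∀ x ∉ A i, g i x = 0) (hf : ∀ i, hE.MemLpSection p μ (f i))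
    (hg : ∀ i, hV.MemLpSection p μ (g i)) (h : ∀ i, IsDistribImage μ hE hV P (f i) (g i)) :
    IsDistribImage μ hE hV P (fun x => ∑ᶠ i, f i x) fun x => ∑ᶠ i, g i x := by
  intro ψ hψ η hη
  obtain ⟨K, hK, hK0⟩ := hψ
  obtain ⟨L, hL, hL0⟩ := hη.1
  have hfin := hA.finite_nonempty_inter_compact (hK.union hL)
  have := IsDistribImage.sum hp1 hfin.toFinset hf hg h ψ ⟨K, hK, hK0⟩ η hη
  calc ∫ x, hE.inner x (globalSec η x) (∑ᶠ i, f i x) ∂μ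
      = ∫ x, hE.inner x (globalSec η x) (∑ i ∈ hfin.toFinset, f i x) ∂μ := by
        refine integral_congr_ae (ae_of_all _ fun x => ?_)
        by_cases hx : x ∈ L
        · simp only [finsum_section_eq hf0 hfin (Or.inr hx)]
        · simp only [hL0 x hx, map_zero, LinearMap.zero_apply]
    _ = _ := this
    _ = _ := by
        refine integral_congr_ae (ae_of_all _ fun x => ?_)
        by_cases hx : x ∈ K
        · simp only [finsum_section_eq hg0 hfin (Or.inl hx)]
        · simp only [hK0 x hx, map_zero, LinearMap.zero_apply]

/-- A countable locally finite atlas with small, relatively compact chart domains. -/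
theorem exists_locallyFinite_charts {N : X → Set X} (hN : ∀ x, N x ∈ 𝓝 x) :
    ∃ (s : Set X) (φ : s → OpenPartialHomeomorph X 𝔼), s.Countable ∧
      (∀ c, φ c ∈ IsManifold.maximalAtlas (𝓡 m) ∞ X) ∧ (∀ c : s, (φ c).source ⊆ N c) ∧
      (∀ c, ∃ K, IsCompact K ∧ (φ c).source ⊆ K) ∧ LocallyFinite (fun c => (φ c).source) ∧
      ⋃ c, (φ c).source = Set.univ := by
  have : LocallyCompactSpace X := ChartedSpace.locallyCompactSpace 𝔼 X
  choose K hK hKx using fun x : X => exists_compact_mem_nhds x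
  obtain ⟨s, hs, φ, hφ, hφs, hcov⟩ := exists_countable_charts (m := m) fun x : X =>
    inter_mem (hN x) (hKx x)
  -- Paracompactness gives a locally finite refinement with the same index set, so countability and
  -- the choice of trivializations at the centres survive.
  obtain ⟨v, hv, hvc, hvf, hvs⟩ := precise_refinement (fun c : s => (φ c).source)
    (fun c => (φ c).open_source) (by rw [← hcov, Set.biUnion_eq_iUnion])
  have hsrc : ∀ c : s, ((φ c).restr (v c)).source = v c := fun c => by
    rw [OpenPartialHomeomorph.restr_source' _ _ (hv c), Set.inter_eq_right]
    exact hvs c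
  refine ⟨s, fun c => (φ c).restr (v c), hs, fun c => restr_mem_maximalAtlas _ (hφ c) (hv c),
    fun c => ?_, fun c => ⟨K c, hK c, ?_⟩, ?_, ?_⟩
  · rw [hsrc]; exact (hvs c).trans ((hφs c).trans Set.inter_subset_left)
  · rw [hsrc]; exact (hvs c).trans ((hφs c).trans Set.inter_subset_right)
  · simpa only [hsrc] using hvf
  · simpa only [hsrc] using hvc

end LocallyFiniteSums

/-! ### The global approximation -/

section Global

variable {m : ℕ} {X : Type*} [TopologicalSpace X] [T2Space X] [SecondCountableTopology X]
  [ChartedSpace (EuclideanSpace ℝ (Fin m)) X] [IsManifold (𝓡 m) ∞ X]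
  [MeasurableSpace X] [BorelSpace X] {μ : Measure X}
variable {p : ℝ≥0∞}
variable {F : Type*} [NormedAddCommGroup F] [NormedSpace ℂ F] [FiniteDimensional ℂ F]
variable {E : X → Type*} [∀ x, AddCommGroup (E x)] [∀ x, Module ℂ (E x)]
  [∀ x, TopologicalSpace (E x)] [TopologicalSpace (TotalSpace F E)]
  [FiberBundle F E] [VectorBundle ℂ F E] [IsSmoothComplexBundle m F E]
variable {s : ℕ} {G : Fin s → Type*} [∀ i, NormedAddCommGroup (G i)] [∀ i, NormedSpace ℂ (G i)]
  [∀ i, FiniteDimensional ℂ (G i)]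
variable {V : Fin s → X → Type*} [∀ i x, AddCommGroup (V i x)] [∀ i x, Module ℂ (V i x)]
  [∀ i x, TopologicalSpace (V i x)] [∀ i, TopologicalSpace (TotalSpace (G i) (V i))]
  [∀ i, FiberBundle (G i) (V i)] [∀ i, VectorBundle ℂ (G i) (V i)]
  [∀ i, IsSmoothComplexBundle m (G i) (V i)]
variable {hE : HermitianStructure m F E} {hV : ∀ i, HermitianStructure m (G i) (V i)}
variable {k : Fin s → ℕ} {P : ∀ i, SheafMorphism m F E (G i) (V i)}

/-- The Meyers–Serrin gluing. The images of the error W - f are produced directly, as sums of the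
local error images, so P W and P f are never compared. -/
theorem exists_approx (hμ : IsSmoothMeasure (m := m) μ) (hp1 : 1 ≤ p) (hp : p ≠ ⊤)
    (hP : ∀ i, (P i).IsDiffOp (k i))
    (hreg : 2 ≤ Finset.univ.sup k → ∀ f : ∀ x, E x, MemSobolev μ hE hV P p f →
      MemSobolevLocSection m F (Finset.univ.sup k - 1) p f)
    {f : ∀ x, E x} (hf : MemSobolev μ hE hV P p f) {ε : ℝ≥0∞} (hε : 0 < ε) :
    ∃ (W : SmoothSec m F E ⊤) (g : ∀ i x, V i x),
      hE.lpNorm p μ (fun x => globalSec W x - f x) ≤ ε ∧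
      (∀ i, IsBorelSection (G i) (g i)) ∧ (∀ i, (hV i).lpNorm p μ (g i) ≤ ε) ∧
      (∀ i, IsDistribImage μ hE (hV i) (P i) (fun x => globalSec W x - f x) (g i)) ∧
      (HasCompactEssSupp μ f → HasCompactSupp (globalSec W)) := by
  have := hμ.isLocallyFiniteMeasure
  have : LocallyCompactSpace X :=
    ChartedSpace.locallyCompactSpace (EuclideanSpace ℝ (Fin m)) X
  obtain ⟨S, φ, hS, hφ, hφN, hφK, hlf, hcov⟩ := exists_locallyFinite_charts (m := m) fun x : X =>
    inter_mem ((trivializationAt F E x).open_baseSet.mem_nhds (mem_baseSet_trivializationAt F E x))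
      (Filter.iInter_mem.2 fun i => (trivializationAt (G i) (V i) x).open_baseSet.mem_nhds
        (mem_baseSet_trivializationAt (G i) (V i) x))
  have := hS.to_subtype
  obtain ⟨χ, hχ⟩ := SmoothPartitionOfUnity.exists_isSubordinate (𝓡 m) isClosed_univ
    (fun c : S => (φ c).source) (fun c => (φ c).open_source) hcov.ge
  have hχc : ∀ c, HasCompactSupport (χ c) := fun c => by
    obtain ⟨K, hK, hKs⟩ := hφK c
    exact hK.of_isClosed_subset (isClosed_tsupport _) ((hχ c).trans hKs)
  -- Accuracies for the countably many charts with sum less than ε.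
  obtain ⟨δ, hδ, hδε⟩ := ENNReal.exists_pos_sum_of_countable hε.ne' S
  have hT' : ∀ (c : S) i, (φ c).source ⊆ (trivializationAt (G i) (V i) (c : X)).baseSet :=
    fun c i => (hφN c).trans (Set.inter_subset_right.trans (Set.iInter_subset _ i))
  choose w g hw0 hwc hg0 hgm hwδ hgδ hwg hwz using fun c : S =>
    exists_approx_in_chart (T := trivializationAt F E (c : X))
      (T' := fun i => trivializationAt (G i) (V i) (c : X)) hμ hp1 hp hP hreg (hφ c)
      ((hφN c).trans Set.inter_subset_left) (hT' c) hf (χ c).contMDiff (hχc c) (hχ c)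
      (ENNReal.coe_pos.2 (hδ c)) ENNReal.coe_ne_top
  obtain ⟨W, hW⟩ := exists_globalSec_eq_finsum hlf hw0
  set d : S → ∀ x, E x := fun c x => globalSec (w c) x - (χ c x : ℂ) • f x with hd
  have hχ0 : ∀ c, ∀ x ∉ (φ c).source, χ c x = 0 := fun c x hx =>
    image_eq_zero_of_notMem_tsupport fun h => hx (hχ c h)
  have hd0 : ∀ c, ∀ x ∉ (φ c).source, d c x = 0 := fun c x hx => by
    simp only [hd, hw0 c x hx, hχ0 c x hx, Complex.ofReal_zero, zero_smul, sub_zero]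
  have hdm : ∀ c, IsBorelSection F (d c) := fun c => (SmoothSec.isBorelSection (w c)).sub
    (hf.1.1.smul (Complex.measurable_ofReal.comp (χ c).contMDiff.continuous.measurable))
  -- Since ∑ χ_c = 1, the global error is the locally finite sum of the local errors.
  have hWf : ∀ x, globalSec W x - f x = ∑ᶠ c, d c x := by
    intro x
    have hfin := hlf.finite_nonempty_inter_compact (isCompact_singleton (x := x))
    have hx : x ∈ ({x} : Set X) := rfl
    have h1 : ∑ c ∈ hfin.toFinset, χ c x = 1 := by
      rw [← χ.sum_eq_one (Set.mem_univ x)]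
      refine (finsum_eq_sum_of_support_subset _ fun c hc => ?_).symm
      rw [Set.Finite.coe_toFinset]
      exact ⟨x, by_contra fun h => hc (hχ0 c x h), hx⟩
    rw [hW, finsum_section_eq (w := fun c => globalSec (w c)) hw0 hfin hx,
      finsum_section_eq hd0 hfin hx, hd, Finset.sum_sub_distrib, ← Finset.sum_smul,
      ← Complex.ofReal_sum, h1, Complex.ofReal_one, one_smul]
  have hdp : ∀ c, hE.MemLpSection p μ (d c) := fun c =>
    ⟨hdm c, (hwδ c).trans_lt ENNReal.coe_lt_top⟩
  refine ⟨W, fun i x => ∑ᶠ c, g c i x, ?_, fun i => ?_, fun i => ?_, fun i => ?_, ?_⟩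
  · simp only [hWf]
    exact (hE.lpNorm_finsum_le hp1 hlf hd0 hdm hwδ).trans hδε.le
  · exact isBorelSection_finsum hlf (fun c => hg0 c i) fun c => hgm c i
  · exact ((hV i).lpNorm_finsum_le hp1 hlf (fun c => hg0 c i) (fun c => hgm c i)
      fun c => hgδ c i).trans hδε.le
  · simp only [hWf]
    exact IsDistribImage.finsum hp1 hlf hd0 (fun c => hg0 c i) hdp
      (fun c => ⟨hgm c i, (hgδ c i).trans_lt ENNReal.coe_lt_top⟩) fun c => hwg c i
  -- Only finitely many charts meet the compact set `K`; on every other chart f is null, so its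
  -- local approximant is identically zero.
  · rintro ⟨K, hK, hK0⟩
    have hfin := hlf.finite_nonempty_inter_compact hK
    choose C hC hC0 using hwc
    refine ⟨⋃ c ∈ hfin.toFinset, C c, hfin.toFinset.isCompact_biUnion fun c _ => hC c,
      fun x hx => ?_⟩
    rw [hW]
    refine finsum_eq_zero_of_forall_eq_zero fun c => ?_
    by_cases hc : ((φ c).source ∩ K).Nonempty
    · refine hC0 c x fun h => hx (Set.mem_biUnion (x := c) ?_ h)
      exact hfin.mem_toFinset.2 hc
    · refine hwz c ?_ x
      filter_upwards [hK0] with z hz hzs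
      exact hz fun hzK => hc ⟨z, hzs, hzK⟩

/-- `distribImage` is an arbitrary choice; almost everywhere uniqueness makes its norm computable
from any representative. -/
theorem lpNorm_distribImage (hμ : IsSmoothMeasure (m := m) μ) (hp1 : 1 ≤ p) (hp : p ≠ ⊤)
    {i : Fin s} (hP : (P i).IsDiffOp (k i)) {f : ∀ x, E x} {g : ∀ x, V i x}
    (hf : hE.MemLpSection p μ f) (hg : (hV i).MemLpSection p μ g)
    (h : IsDistribImage μ hE (hV i) (P i) f g) :
    (hV i).lpNorm p μ (distribImage μ hE (hV i) (P i) p f) = (hV i).lpNorm p μ g := by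
  have H : DistribImageMemLp μ hE (hV i) (P i) p f := ⟨g, hg, h⟩
  rw [distribImage, dif_pos H]
  exact (hV i).lpNorm_congr_ae
    (IsDistribImage.ae_eq hμ hp1 hp hP hf H.choose_spec.1 hg H.choose_spec.2 h)

theorem exists_seq_tendsto_sobolevNorm (hμ : IsSmoothMeasure (m := m) μ) (hp1 : 1 ≤ p) (hp : p ≠ ⊤)
    (hP : ∀ i, (P i).IsDiffOp (k i))
    (hreg : 2 ≤ Finset.univ.sup k → ∀ f : ∀ x, E x, MemSobolev μ hE hV P p f →
      MemSobolevLocSection m F (Finset.univ.sup k - 1) p f)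
    {f : ∀ x, E x} (hf : MemSobolev μ hE hV P p f) :
    ∃ fn : ℕ → SmoothSec m F E ⊤, (∀ n, MemSobolev μ hE hV P p (globalSec (fn n))) ∧
      (HasCompactEssSupp μ f → ∀ n, HasCompactSupp (globalSec (fn n))) ∧
      Tendsto (fun n => sobolevNorm μ hE hV P p fun x => globalSec (fn n) x - f x) atTop (𝓝 0) := by
  have := hμ.isLocallyFiniteMeasure
  set ε : ℕ → ℝ≥0∞ := fun n => ((n : ℝ≥0∞) + 1)⁻¹ with hε
  have hε0 : ∀ n, 0 < ε n := fun n => ENNReal.inv_pos.2 (by simp)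
  have hεt : ∀ n, ε n < ⊤ := fun n => ENNReal.inv_lt_top.2 (by positivity)
  choose W g hW hgm hg hWg hWc using fun n => exists_approx hμ hp1 hp hP hreg hf (hε0 n)
  have hWp : ∀ n, hE.MemLpSection p μ fun x => globalSec (W n) x - f x := fun n =>
    ⟨(SmoothSec.isBorelSection (W n)).sub hf.1.1, (hW n).trans_lt (hεt n)⟩
  have hgp : ∀ n i, (hV i).MemLpSection p μ (g n i) := fun n i =>
    ⟨hgm n i, (hg n i).trans_lt (hεt n)⟩
  -- The approximants lie in the Sobolev space because the error and f do.
  have he : ∀ n, (fun x => (globalSec (W n) x - f x) + f x) = globalSec (W n) := fun n =>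
    funext fun x => sub_add_cancel _ _
  refine ⟨W, fun n => ⟨?_, fun i => ?_⟩, fun h n => hWc n h, ?_⟩
  · rw [← he n]
    exact (hWp n).add hp1 hf.1
  · obtain ⟨g₀, hg₀, hfg⟩ := hf.2 i
    refine ⟨_, (hgp n i).add hp1 hg₀, ?_⟩
    rw [← he n]
    exact (hWg n i).add hp1 (hWp n) hf.1 (hgp n i) hg₀ hfg
  · have hpr : 0 < p.toReal := ENNReal.toReal_pos (zero_lt_one.trans_le hp1).ne' hp
    have hεlim : Tendsto ε atTop (𝓝 0) := by
      have := (tendsto_add_atTop_iff_nat 1).2 ENNReal.tendsto_inv_nat_nhds_zero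
      simpa only [Nat.cast_add, Nat.cast_one] using this
    -- At t = `ε n` this expression bounds the Sobolev norm of the n-th error, because the norm of
    -- the error and those of its s images are at most `ε n`; it is continuous and vanishes at 0.
    have hcont : Continuous fun t : ℝ≥0∞ =>
        (t ^ p.toReal + ∑ _i : Fin s, t ^ p.toReal) ^ (1 / p.toReal) := by
      have h1 : Continuous fun t : ℝ≥0∞ => t ^ p.toReal := ENNReal.continuous_rpow_const
      exact ENNReal.continuous_rpow_const.comp (h1.add (continuous_finsetSum _ fun _ _ => h1))
    have hlim := (hcont.tendsto 0).comp hεlim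
    simp only [ENNReal.zero_rpow_of_pos hpr, Finset.sum_const_zero, add_zero,
      ENNReal.zero_rpow_of_pos (one_div_pos.2 hpr)] at hlim
    refine tendsto_of_tendsto_of_tendsto_of_le_of_le tendsto_const_nhds hlim (fun _ => bot_le)
      fun n => ?_
    refine ENNReal.rpow_le_rpow (add_le_add (ENNReal.rpow_le_rpow (hW n) hpr.le)
      (Finset.sum_le_sum fun i _ => ENNReal.rpow_le_rpow ?_ hpr.le)) (one_div_pos.2 hpr).le
    rw [lpNorm_distribImage hμ hp1 hp (hP i) (hWp n) (hgp n i) (hWg n i)]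
    exact hg n i

end Global

end MeyersSerrin

end

/-! ### The Meyers–Serrin theorem -/

theorem mainTheorem2
    {m : ℕ} {X : Type*} [TopologicalSpace X] [T2Space X] [SecondCountableTopology X]
    [ChartedSpace (EuclideanSpace ℝ (Fin m)) X] [IsManifold (𝓡 m) ∞ X]
    [MeasurableSpace X] [BorelSpace X] (μ : Measure X) (hμ : MeyersSerrin.IsSmoothMeasure (m := m) μ)
    (p : ℝ≥0∞) (hp1 : 1 ≤ p) (hp : p ≠ ⊤)
    {F : Type*} [NormedAddCommGroup F] [NormedSpace ℂ F] [FiniteDimensional ℂ F]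
    {E : X → Type*} [∀ x, AddCommGroup (E x)] [∀ x, Module ℂ (E x)]
    [∀ x, TopologicalSpace (E x)] [TopologicalSpace (TotalSpace F E)]
    [FiberBundle F E] [VectorBundle ℂ F E] [MeyersSerrin.IsSmoothComplexBundle m F E]
    (hE : MeyersSerrin.HermitianStructure m F E)
    {s : ℕ} {G : Fin s → Type*} [∀ i, NormedAddCommGroup (G i)] [∀ i, NormedSpace ℂ (G i)]
    [∀ i, FiniteDimensional ℂ (G i)]
    {V : Fin s → X → Type*} [∀ i x, AddCommGroup (V i x)] [∀ i x, Module ℂ (V i x)]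
    [∀ i x, TopologicalSpace (V i x)] [∀ i, TopologicalSpace (TotalSpace (G i) (V i))]
    [∀ i, FiberBundle (G i) (V i)] [∀ i, VectorBundle ℂ (G i) (V i)]
    [∀ i, MeyersSerrin.IsSmoothComplexBundle m (G i) (V i)]
    (hV : ∀ i, MeyersSerrin.HermitianStructure m (G i) (V i))
    (k : Fin s → ℕ) (P : ∀ i, MeyersSerrin.SheafMorphism m F E (G i) (V i))
    (hP : ∀ i, (P i).IsDiffOp (k i))
    (hreg : 2 ≤ Finset.univ.sup k → ∀ f : ∀ x, E x, MeyersSerrin.MemSobolev μ hE hV P p f →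
      MeyersSerrin.MemSobolevLocSection m F (Finset.univ.sup k - 1) p f)
    (f : ∀ x, E x) (hf : MeyersSerrin.MemSobolev μ hE hV P p f) :
    ∃ fn : ℕ → MeyersSerrin.SmoothSec m F E ⊤,
      (∀ n, MeyersSerrin.MemSobolev μ hE hV P p (MeyersSerrin.globalSec (fn n))) ∧
      (MeyersSerrin.HasCompactEssSupp μ f → ∀ n, MeyersSerrin.HasCompactSupp (MeyersSerrin.globalSec (fn n))) ∧
      Tendsto (fun n => MeyersSerrin.sobolevNorm μ hE hV P p (fun x => MeyersSerrin.globalSec (fn n) x - f x))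
        atTop (𝓝 0) :=
  MeyersSerrin.exists_seq_tendsto_sobolevNorm hμ hp1 hp hP hreg hf
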